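/- Write $\mathbb R_+=[0,\infty)$, let $$E_2=\{u:\mathbb R_+^2\to\mathbb R:\ u,u_x,u_y,u_{xy}\in L^2(\mathbb R_+^2)\},$$ where the derivatives are weak derivatives on the open quadrant $(0,\infty)^2$ and every element of $E_2$ is identified with its continuous representative on the closed quadrant $\mathbb R_+^2$. For $a,c,d>0$ and $u\in E_2$ put $$J_{a,c,d}(u)=\int_{\mathbb R_+^2}\bigl(u_{xy}^2+a\,u_x^2+c\,u_y^2+d\,u^2\bigr)\,dx\,dy,$$ and for $(x,y)\in\mathbb R_+^2$ put $$K_{a,c,d}(x,y)=\frac{4}{\pi^2}\int_0^\infty\!\!\int_0^\infty\frac{\cos(x\xi)\cos(y\eta)}{\xi^2\eta^2+a\xi^2+c\eta^2+d}\,d\xi\,d\eta .$$ **Theorem (sharp two-dimensional positivity threshold).** Let $a,c,d>0$. The integral defining $K_{a,c,d}(x,y)$ converges absolutely for every $(x,y)\in\mathbb R_+^2$, and $J_{a,c,d}$ has a unique minimizer $u_{a,c,d}$ on $\{u\in E_2: u(0,0)=1\}$. The following are equivalent: 1. $u_{a,c,d}(x,y)>0$ for every $(x,y)\in\mathbb R_+^2$;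 2. $K_{a,c,d}(x,y)>0$ for every $(x,y)\in\mathbb R_+^2$; 3. $d\le ac$. Moreover, if $d>ac$, then both $u_{a,c,d}$ and $K_{a,c,d}$ change sign, i.e. each takes a positive value and a negative value on $\mathbb R_+^2$. -/

import Mathlib

open scoped ContDiff

noncomputable section

namespace EkelandNirenberg

/-- The closed quadrant `[0,∞)²`. -/
def closedQuadrant : Set (ℝ × ℝ) := Set.Ici (0 : ℝ) ×ˢ Set.Ici (0 : ℝ)

/-- The open quadrant `(0,∞)²`, the domain of integration and of the weak derivatives. -/
def openQuadrant : Set (ℝ × ℝ) := Set.Ioi (0 : ℝ) ×ˢ Set.Ioi (0 : ℝ)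

/-- Classical partial derivative in the first variable. -/
def partialX (φ : ℝ × ℝ → ℝ) : ℝ × ℝ → ℝ := fun p => fderiv ℝ φ p (1, 0)

/-- Classical partial derivative in the second variable. -/
def partialY (φ : ℝ × ℝ → ℝ) : ℝ × ℝ → ℝ := fun p => fderiv ℝ φ p (0, 1)

/-- Test functions: smooth, with compact support contained in the open quadrant. -/
def IsTestFunction (φ : ℝ × ℝ → ℝ) : Prop :=
  ContDiff ℝ ∞ φ ∧ HasCompactSupport φ ∧ tsupport φ ⊆ openQuadrant

/-- `g` is a weak derivative `u_x` of `u` on the open quadrant. -/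
def IsWeakX (u g : ℝ × ℝ → ℝ) : Prop :=
  MeasureTheory.LocallyIntegrableOn g openQuadrant ∧
    ∀ φ : ℝ × ℝ → ℝ, IsTestFunction φ →
      ∫ p in openQuadrant, u p * partialX φ p = -∫ p in openQuadrant, g p * φ p

/-- `g` is a weak derivative `u_y` of `u` on the open quadrant. -/
def IsWeakY (u g : ℝ × ℝ → ℝ) : Prop :=
  MeasureTheory.LocallyIntegrableOn g openQuadrant ∧
    ∀ φ : ℝ × ℝ → ℝ, IsTestFunction φ →
      ∫ p in openQuadrant, u p * partialY φ p = -∫ p in openQuadrant, g p * φ p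

/-- `g` is a weak mixed derivative `u_xy` of `u` on the open quadrant. -/
def IsWeakXY (u g : ℝ × ℝ → ℝ) : Prop :=
  MeasureTheory.LocallyIntegrableOn g openQuadrant ∧
    ∀ φ : ℝ × ℝ → ℝ, IsTestFunction φ →
      ∫ p in openQuadrant, u p * partialX (partialY φ) p = ∫ p in openQuadrant, g p * φ p

/-- `g` is square integrable on the quadrant. -/
def InL2 (g : ℝ × ℝ → ℝ) : Prop :=
  MeasureTheory.MemLp g 2 (MeasureTheory.volume.restrict openQuadrant)

/-- Membership in the mixed Sobolev space `E₂`: `u, u_x, u_y, u_xy ∈ L²`. -/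
def MemE2 (u : ℝ × ℝ → ℝ) : Prop :=
  InL2 u ∧ (∃ g, IsWeakX u g ∧ InL2 g) ∧ (∃ g, IsWeakY u g ∧ InL2 g) ∧
    (∃ g, IsWeakXY u g ∧ InL2 g)

open Classical in
/-- The weak derivative `u_x` (unique up to null sets; `0` if there is none). -/
def weakX (u : ℝ × ℝ → ℝ) : ℝ × ℝ → ℝ :=
  if h : ∃ g, IsWeakX u g then h.choose else 0

open Classical in
/-- The weak derivative `u_y` (unique up to null sets; `0` if there is none). -/
def weakY (u : ℝ × ℝ → ℝ) : ℝ × ℝ → ℝ :=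
  if h : ∃ g, IsWeakY u g then h.choose else 0

open Classical in
/-- The weak derivative `u_xy` (unique up to null sets; `0` if there is none). -/
def weakXY (u : ℝ × ℝ → ℝ) : ℝ × ℝ → ℝ :=
  if h : ∃ g, IsWeakXY u g then h.choose else 0

/-- The energy `J_{a,c,d}(u) = ∫ (u_xy² + a u_x² + c u_y² + d u²)` (meaningful for `u ∈ E₂`). -/
def energy (a c d : ℝ) (u : ℝ × ℝ → ℝ) : ℝ :=
  ∫ p in openQuadrant,
    (weakXY u p ^ 2 + a * weakX u p ^ 2 + c * weakY u p ^ 2 + d * u p ^ 2)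

/-- The admissible class `{u ∈ E₂ : u(0,0) = 1}`. An element of `E₂` is represented by its
continuous representative on the closed quadrant, which gives the corner value its meaning. -/
def Admissible (u : ℝ × ℝ → ℝ) : Prop :=
  MemE2 u ∧ ContinuousOn u closedQuadrant ∧ u (0, 0) = 1

/-- `u` minimizes `J_{a,c,d}` over `{u ∈ E₂ : u(0,0) = 1}`. -/
def IsMinimizer (a c d : ℝ) (u : ℝ × ℝ → ℝ) : Prop :=
  Admissible u ∧ ∀ v, Admissible v → energy a c d u ≤ energy a c d v

/-- The integrand of the cosine kernel at `(x, y)`, as a function of `(ξ, η)`. -/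
def kernelIntegrand (a c d : ℝ) (p q : ℝ × ℝ) : ℝ :=
  Real.cos (p.1 * q.1) * Real.cos (p.2 * q.2) /
    (q.1 ^ 2 * q.2 ^ 2 + a * q.1 ^ 2 + c * q.2 ^ 2 + d)

/-- The cosine kernel `K_{a,c,d}`. -/
def kernel (a c d : ℝ) (p : ℝ × ℝ) : ℝ :=
  4 / Real.pi ^ 2 * ∫ q in openQuadrant, kernelIntegrand a c d p q

/-- `f` takes both a positive and a negative value on the closed quadrant. -/
def ChangesSign (f : ℝ × ℝ → ℝ) : Prop :=
  (∃ p ∈ closedQuadrant, 0 < f p) ∧ ∃ p ∈ closedQuadrant, f p < 0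

end EkelandNirenberg

end

/-!
Throughout, `u` denotes an element of `E₂` with weak derivatives `u_x`, `u_y`, `u_xy`, and `K` is the
cosine kernel.

**The minimizer is `K / K(0,0)`.** The energy inner product of an admissible function `v` with `K`
is the corner value `v(0,0)` (`reproducing`): formally `K` solves
`K_xxyy - a K_xx - c K_yy + d K = 0` with the natural boundary conditions on the two sides, and
integrating the mixed term by parts in both variables leaves `v(0,0)` behind. Completing the square
then gives
`J(v) - J(u) ≥ d ∫ (v - u)²` for `u = K / K(0,0)`, hence existence and uniqueness of the minimizer
(`le_energy_sub`, `isMinimizer_kernel`).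

To make sense of the formal computation, one frequency of the double integral is integrated out,
which turns `K` into a single cosine integral of `exp (-x k(η)) / (k(η) (η² + a))` with the rate
`k(η)² = (c η² + d) / (η² + a)` (`kernel_eq_integral_rate`). As `η → ∞` the rate tends to `√c`; the
limiting exponential contributes a product of two exponentials, and the remainder converges fast
enough to be differentiated under the integral sign (`kernel_eq_lead_add_corr`). The formula shows
exponential decay in `x`; the symmetry exchanging the variables gives exponential decay in `y`, and
together they put `K` and its derivatives in `L²` (`inL2_of_decay`). The reproducing identity
follows by multiplying with cutoffs, integrating by parts up to the corner, and applying Fubini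
(`form_ker`).

**Positivity for `d ≤ a c`.** The denominator is `(ξ² + c)(η² + a) - (a c - d)`, so for `d ≤ a c` its
inverse is a geometric series in `(a c - d) / ((ξ² + c)(η² + a))` with nonnegative terms. Each term
is a product of powers of `1 / (ξ² + c)` and `1 / (η² + a)`, mixtures of Gaussians, whose cosine
transforms are nonnegative, and the leading term has a positive transform (`kernel_pos`).

**Sign change for `a c < d`.** For fixed `x`, the function `y ↦ K(x, y)` is the cosine transform of
`η ↦ exp (-x k(η)) / (k(η) (η² + a))`. If it were nonnegative, the latter would attain its maximum
at `η = 0` (`norm_le_of_fourier_nonneg`). But for `a c < d` the rate `k` is strictly decreasing in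
`|η|`, so for large `x` the exponential factor makes the value at `η = 1` larger than the value at
`η = 0` (`exists_kernel_neg`). Positivity of `K(0,0)` supplies the other sign.
-/

namespace EkelandNirenberg

open MeasureTheory Set Filter Topology

/-! ### One-dimensional cosine integrals -/

lemma integrable_inv_sq_add {m : ℝ} (hm : 0 < m) :
    Integrable (fun ξ : ℝ => (ξ ^ 2 + m)⁻¹) := by
  have hs : 0 < √m := Real.sqrt_pos.2 hm
  have h := (integrable_inv_one_add_sq.comp_div hs.ne').const_mul m⁻¹
  refine h.congr (Eventually.of_forall fun ξ => ?_)
  have : (√m) ^ 2 = m := Real.sq_sqrt hm.le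
  simp only [div_pow, this]
  rw [← mul_inv]
  congr 1
  field_simp
  ring

open Complex in
/-- The Fourier transform of the two-sided exponential `t ↦ exp (-p|t|)`. -/
lemma fourier_exp_neg_abs {p : ℝ} (hp : 0 < p) (w : ℝ) :
    Integrable (fun t : ℝ => (Real.exp (-(p * |t|)) : ℂ)) ∧
    FourierTransform.fourier (fun t : ℝ => (Real.exp (-(p * |t|)) : ℂ)) w =
      ((2 * p / ((2 * Real.pi * w) ^ 2 + p ^ 2) : ℝ) : ℂ) := by
  set s : ℂ := 2 * Real.pi * w * I with hs
  have h1 : (-p - s : ℂ).re < 0 := by simp [hs, hp]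
  have h2 : 0 < (p - s : ℂ).re := by simp [hs, hp]
  have e1 : EqOn (fun t : ℝ => cexp ((-p - s) * t))
      (fun t : ℝ => cexp (-s * t) * (Real.exp (-(p * |t|)) : ℂ)) (Ioi 0) := by
    intro t ht
    simp only [abs_of_pos (mem_Ioi.1 ht), ofReal_exp, ← Complex.exp_add]
    congr 1; push_cast; ring
  have e2 : EqOn (fun t : ℝ => cexp ((p - s) * t))
      (fun t : ℝ => cexp (-s * t) * (Real.exp (-(p * |t|)) : ℂ)) (Iic 0) := by
    intro t ht
    simp only [abs_of_nonpos (mem_Iic.1 ht), ofReal_exp, ← Complex.exp_add]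
    congr 1; push_cast; ring
  have i1 := (integrableOn_exp_mul_complex_Ioi h1 0).congr_fun e1 measurableSet_Ioi
  have i2 := (integrableOn_exp_mul_complex_Iic h2 0).congr_fun e2 measurableSet_Iic
  have hi : Integrable (fun t : ℝ => cexp (-s * t) * (Real.exp (-(p * |t|)) : ℂ)) := by
    rw [← integrableOn_univ, ← Iic_union_Ioi (a := (0:ℝ))]
    exact i2.union i1
  have hn : ∀ t : ℝ, ‖cexp (-s * t)‖ = 1 := by
    intro t
    rw [Complex.norm_exp]
    simp [hs]
  refine ⟨?_, ?_⟩
  · have hm : AEStronglyMeasurable (fun t : ℝ => (Real.exp (-(p * |t|)) : ℂ)) :=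
      Continuous.aestronglyMeasurable (by fun_prop)
    refine hi.congr' hm (Eventually.of_forall fun t => ?_)
    rw [norm_mul, hn, one_mul]
  · rw [Real.fourier_eq']
    have : (fun v : ℝ => cexp ((↑(-2 * Real.pi * inner ℝ v w) * I)) •
        (Real.exp (-(p * |v|)) : ℂ)) =
        fun t : ℝ => cexp (-s * t) * (Real.exp (-(p * |t|)) : ℂ) := by
      ext t
      simp only [smul_eq_mul, hs]
      congr 2
      simp
      ring
    rw [this, ← integral_add_compl (measurableSet_Iic (a := (0:ℝ))) hi, compl_Iic,
      ← setIntegral_congr_fun measurableSet_Iic e2, ← setIntegral_congr_fun measurableSet_Ioi e1,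
      integral_exp_mul_complex_Iic h2, integral_exp_mul_complex_Ioi h1]
    have hne1 : (-p - s : ℂ) ≠ 0 := fun h => by rw [h] at h1; simp at h1
    have hne2 : (p - s : ℂ) ≠ 0 := fun h => by rw [h] at h2; simp at h2
    have hne3 : ((2 * Real.pi * w) ^ 2 + p ^ 2 : ℂ) ≠ 0 := by
      have : ((2 * Real.pi * w) ^ 2 + p ^ 2 : ℝ) ≠ 0 := by positivity
      exact_mod_cast this
    have key : ((2 * Real.pi * w) ^ 2 + p ^ 2 : ℂ) = -((-p - s) * (p - s)) := by
      rw [hs]; ring_nf; simp [I_sq]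
    push_cast
    rw [key]
    field_simp
    simp
    ring

/-- The cosine transform of the resolvent symbol `1 / (ξ² + p²)`. -/
lemma integral_cos_div_sq_add_sq {p : ℝ} (hp : 0 < p) (x : ℝ) :
    ∫ ξ in Ioi (0 : ℝ), Real.cos (x * ξ) / (ξ ^ 2 + p ^ 2) =
      Real.pi / (2 * p) * Real.exp (-(p * |x|)) := by
  have hpi := Real.pi_pos
  set f : ℝ → ℂ := fun t : ℝ => (Real.exp (-(p * |t|)) : ℂ) with hf
  have hF : FourierTransform.fourier f =
      fun w : ℝ => ((2 * p / ((2 * Real.pi * w) ^ 2 + p ^ 2) : ℝ) : ℂ) :=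
    funext fun w => (fourier_exp_neg_abs hp w).2
  have hint : Integrable (FourierTransform.fourier f) := by
    rw [hF]
    refine Integrable.ofReal ?_
    have h := ((integrable_inv_sq_add (m := p ^ 2) (by positivity)).comp_mul_left'
      (R := 2 * Real.pi) (by positivity)).const_mul (2 * p)
    exact h.congr (Eventually.of_forall fun w => (div_eq_mul_inv _ _).symm)
  have hc : Continuous f := by rw [hf]; fun_prop
  have inv := congrFun (hc.fourierInv_fourier_eq (fourier_exp_neg_abs hp 0).1 hint) x
  rw [Real.fourierInv_eq', hF] at inv
  have hre := congrArg Complex.re inv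
  rw [← RCLike.re_eq_complex_re, ← integral_re] at hre
  swap
  · have := (VectorFourier.fourierIntegral_convergent_iff (μ := volume) Real.continuous_fourierChar
      (L := innerₗ ℝ) (by exact continuous_inner) (-x)).2 hint
    refine this.congr (Eventually.of_forall fun w => ?_)
    simp only [hF, Circle.smul_def, Real.fourierChar_apply, smul_eq_mul]
    congr 2
    simp
  have e : ∀ w : ℝ, RCLike.re (Complex.exp (↑(2 * Real.pi * inner ℝ w x) * Complex.I) •
      ((2 * p / ((2 * Real.pi * w) ^ 2 + p ^ 2) : ℝ) : ℂ)) =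
      (fun ξ => 2 * p * (Real.cos (x * ξ) / (ξ ^ 2 + p ^ 2))) (2 * Real.pi * w) := by
    intro w
    rw [RCLike.re_eq_complex_re, smul_eq_mul, Complex.re_mul_ofReal, Complex.exp_ofReal_mul_I_re]
    simp only [RCLike.inner_apply, conj_trivial]
    rw [show 2 * Real.pi * (x * w) = x * (2 * Real.pi * w) by ring]
    ring
  simp_rw [e] at hre
  rw [Measure.integral_comp_mul_left (fun ξ => 2 * p * (Real.cos (x * ξ) / (ξ ^ 2 + p ^ 2))),
    integral_const_mul] at hre
  have hev : ∫ ξ : ℝ, Real.cos (x * ξ) / (ξ ^ 2 + p ^ 2) =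
      2 * ∫ ξ in Ioi (0:ℝ), Real.cos (x * ξ) / (ξ ^ 2 + p ^ 2) := by
    rw [← integral_comp_abs (f := fun ξ => Real.cos (x * ξ) / (ξ ^ 2 + p ^ 2))]
    congr 1; ext ξ
    rcases abs_choice ξ with h | h <;> simp [h]
  rw [hev, hf] at hre
  simp only [RCLike.re_eq_complex_re, Complex.ofReal_re, smul_eq_mul] at hre
  rw [abs_of_pos (by positivity)] at hre
  rw [← hre]
  field_simp

/-! ### Integration by parts up to the corner -/

lemma measurableSet_openQuadrant : MeasurableSet openQuadrant :=
  measurableSet_Ioi.prod measurableSet_Ioi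

lemma isOpen_openQuadrant : IsOpen openQuadrant := isOpen_Ioi.prod isOpen_Ioi

lemma restrict_openQuadrant :
    (volume : Measure (ℝ × ℝ)).restrict openQuadrant =
      (volume.restrict (Ioi (0 : ℝ))).prod (volume.restrict (Ioi (0 : ℝ))) := by
  rw [openQuadrant, Measure.prod_restrict, Measure.volume_eq_prod]

lemma setIntegral_openQuadrant {f : ℝ × ℝ → ℝ} (hf : IntegrableOn f openQuadrant) :
    ∫ p in openQuadrant, f p = ∫ x in Ioi (0 : ℝ), ∫ y in Ioi (0 : ℝ), f (x, y) := by
  rw [restrict_openQuadrant, integral_prod]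
  rwa [← restrict_openQuadrant]

lemma setIntegral_openQuadrant_symm {f : ℝ × ℝ → ℝ} (hf : IntegrableOn f openQuadrant) :
    ∫ p in openQuadrant, f p = ∫ y in Ioi (0 : ℝ), ∫ x in Ioi (0 : ℝ), f (x, y) := by
  rw [restrict_openQuadrant, integral_prod_symm]
  rwa [← restrict_openQuadrant]

lemma setIntegral_openQuadrant_swap (f : ℝ × ℝ → ℝ) :
    ∫ p in openQuadrant, f p.swap = ∫ p in openQuadrant, f p := by
  rw [restrict_openQuadrant]
  exact integral_prod_swap f

/-- Smooth functions of one variable with compact support. -/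
def IsBump (P : ℝ → ℝ) : Prop := ContDiff ℝ ∞ P ∧ HasCompactSupport P

lemma IsBump.continuous {P : ℝ → ℝ} (h : IsBump P) : Continuous P := h.1.continuous

lemma IsBump.deriv {P : ℝ → ℝ} (h : IsBump P) : IsBump (deriv P) :=
  ⟨(contDiff_infty_iff_deriv.1 h.1).2, h.2.deriv⟩

lemma IsBump.hasDerivAt {P : ℝ → ℝ} (h : IsBump P) (x : ℝ) : HasDerivAt P (_root_.deriv P x) x :=
  ((h.1.differentiable (by simp)) x).hasDerivAt

lemma IsBump.mul_left {P f : ℝ → ℝ} (h : IsBump P) (hf : ContDiff ℝ ∞ f) :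
    IsBump (fun x => f x * P x) := ⟨hf.mul h.1, h.2.mul_left⟩

lemma hasCompactSupport_mul_prod {P Q : ℝ → ℝ} (hP : HasCompactSupport P)
    (hQ : HasCompactSupport Q) : HasCompactSupport (fun p : ℝ × ℝ => P p.1 * Q p.2) := by
  refine HasCompactSupport.intro (hP.isCompact.prod hQ.isCompact) fun p hp => ?_
  by_cases h1 : p.1 ∈ tsupport P
  · have h2 : p.2 ∉ tsupport Q := fun h2 => hp ⟨h1, h2⟩
    simp [image_eq_zero_of_notMem_tsupport h2]
  · simp [image_eq_zero_of_notMem_tsupport h1]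

lemma partialX_mul {P Q : ℝ → ℝ} (hP : Differentiable ℝ P) (hQ : Differentiable ℝ Q) :
    partialX (fun p : ℝ × ℝ => P p.1 * Q p.2) = fun p => deriv P p.1 * Q p.2 := by
  ext p
  have h1 := (hP p.1).hasDerivAt.hasFDerivAt.comp p (hasFDerivAt_fst (𝕜 := ℝ) (p := p))
  have h2 := (hQ p.2).hasDerivAt.hasFDerivAt.comp p (hasFDerivAt_snd (𝕜 := ℝ) (p := p))
  have h := (h1.mul h2).fderiv
  simp only [Function.comp_def] at h
  rw [partialX]
  erw [h]
  simp
  ring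

lemma partialY_mul {P Q : ℝ → ℝ} (hP : Differentiable ℝ P) (hQ : Differentiable ℝ Q) :
    partialY (fun p : ℝ × ℝ => P p.1 * Q p.2) = fun p => P p.1 * deriv Q p.2 := by
  ext p
  have h1 := (hP p.1).hasDerivAt.hasFDerivAt.comp p (hasFDerivAt_fst (𝕜 := ℝ) (p := p))
  have h2 := (hQ p.2).hasDerivAt.hasFDerivAt.comp p (hasFDerivAt_snd (𝕜 := ℝ) (p := p))
  have h := (h1.mul h2).fderiv
  simp only [Function.comp_def] at h
  rw [partialY]
  erw [h]
  simp

lemma isTestFunction_mul {P Q : ℝ → ℝ} (hP : IsBump P) (hQ : IsBump Q)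
    (hP0 : tsupport P ⊆ Ioi 0) (hQ0 : tsupport Q ⊆ Ioi 0) :
    IsTestFunction (fun p : ℝ × ℝ => P p.1 * Q p.2) := by
  refine ⟨(hP.1.comp contDiff_fst).mul (hQ.1.comp contDiff_snd),
    hasCompactSupport_mul_prod hP.2 hQ.2, ?_⟩
  have : tsupport (fun p : ℝ × ℝ => P p.1 * Q p.2) ⊆ tsupport P ×ˢ tsupport Q := by
    refine closure_minimal (fun p hp => ?_)
      ((isClosed_tsupport _).prod (isClosed_tsupport _))
    exact ⟨subset_tsupport _ (left_ne_zero_of_mul hp), subset_tsupport _ (right_ne_zero_of_mul hp)⟩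
  exact this.trans (prod_mono hP0 hQ0)

/-- A smooth step vanishing on `(-∞, 1]` and equal to `1` on `[2, ∞)`. -/
noncomputable def step (x : ℝ) : ℝ := Real.smoothTransition (x - 1)

lemma contDiff_step : ContDiff ℝ ∞ step :=
  Real.smoothTransition.contDiff.comp (contDiff_id.sub contDiff_const)

lemma step_of_le {x : ℝ} (h : x ≤ 1) : step x = 0 :=
  Real.smoothTransition.zero_of_nonpos (by linarith)

lemma step_of_ge {x : ℝ} (h : 2 ≤ x) : step x = 1 :=
  Real.smoothTransition.one_of_one_le (by linarith)

lemma abs_step_le (x : ℝ) : |step x| ≤ 1 := by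
  rw [step, abs_of_nonneg (Real.smoothTransition.nonneg _)]
  exact Real.smoothTransition.le_one _

lemma isBump_deriv_step : IsBump (deriv step) := by
  refine ⟨(contDiff_infty_iff_deriv.1 contDiff_step).2, ?_⟩
  refine HasCompactSupport.intro (isCompact_Icc (a := (1:ℝ)) (b := 2)) fun x hx => ?_
  rw [mem_Icc, not_and_or, not_le, not_le] at hx
  rcases hx with hx | hx
  · have : step =ᶠ[𝓝 x] fun _ => 0 := by
      filter_upwards [Iio_mem_nhds hx] with t ht using step_of_le (le_of_lt ht)
    rw [this.deriv_eq, deriv_const]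
  · have : step =ᶠ[𝓝 x] fun _ => 1 := by
      filter_upwards [Ioi_mem_nhds hx] with t ht using step_of_ge (le_of_lt ht)
    rw [this.deriv_eq, deriv_const]

lemma integral_deriv_step : ∫ x in Ioi (0:ℝ), deriv step x = 1 := by
  have h := integral_Ioi_of_hasDerivAt_of_tendsto' (a := (0:ℝ)) (m := 1) (f := step)
    (fun x _ => ((contDiff_step.differentiable (by simp)) x).hasDerivAt)
    (isBump_deriv_step.continuous.integrable_of_hasCompactSupport isBump_deriv_step.2).integrableOn
    (tendsto_const_nhds.congr' ?_)
  · rw [h, step_of_le zero_le_one, sub_zero]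
  · filter_upwards [Ici_mem_atTop (2:ℝ)] with x hx using (step_of_ge hx).symm

lemma tendsto_step {t : ℝ} (ht : 0 < t) :
    Tendsto (fun n : ℕ => step ((n + 1 : ℝ) * t)) atTop (𝓝 1) := by
  refine tendsto_const_nhds.congr' ?_
  obtain ⟨N, hN⟩ := exists_nat_gt (2 / t)
  filter_upwards [Ici_mem_atTop N] with n hn
  refine (step_of_ge ?_).symm
  have : (N : ℝ) ≤ n := by exact_mod_cast hn
  rw [div_lt_iff₀ ht] at hN
  nlinarith

/-- Multiplying an integrable function by steps that sharpen at `t = 0` does not change the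
integral in the limit. -/
lemma tendsto_integral_step {α : Type*} [MeasurableSpace α] {μ : Measure α} {f t : α → ℝ}
    (hf : Integrable f μ) (ht : Measurable t) (h0 : ∀ᵐ z ∂μ, 0 < t z) :
    Tendsto (fun n : ℕ => ∫ z, f z * step ((n + 1 : ℝ) * t z) ∂μ) atTop (𝓝 (∫ z, f z ∂μ)) := by
  refine tendsto_integral_of_dominated_convergence (fun z => |f z|) (fun n => ?_) hf.norm
    (fun n => Eventually.of_forall fun z => ?_) ?_
  · exact hf.1.mul ((contDiff_step.continuous.measurable.comp
      (ht.const_mul _)).aestronglyMeasurable)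
  · rw [Real.norm_eq_abs, abs_mul]
    exact mul_le_of_le_one_right (abs_nonneg _) (abs_step_le _)
  · filter_upwards [h0] with z hz
    simpa using (tendsto_step hz).const_mul (f z)

/-- The bump `P` cut off near `0` by a step of width `1 / (n + 1)`. -/
lemma isBump_step_mul {P : ℝ → ℝ} (hP : IsBump P) (n : ℕ) :
    IsBump (fun x => step ((n + 1 : ℝ) * x) * P x) ∧
      tsupport (fun x => step ((n + 1 : ℝ) * x) * P x) ⊆ Ioi 0 := by
  refine ⟨hP.mul_left (contDiff_step.comp (contDiff_const.mul contDiff_id)), ?_⟩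
  have hn : (0:ℝ) < n + 1 := by positivity
  have : tsupport (fun x => step ((n + 1 : ℝ) * x) * P x) ⊆ Ici (1 / (n + 1 : ℝ)) := by
    refine closure_minimal (fun x hx => ?_) isClosed_Ici
    by_contra hlt
    rw [mem_Ici, not_le, lt_div_iff₀ hn] at hlt
    exact hx (by simp [step_of_le (show (n + 1 : ℝ) * x ≤ 1 by linarith)])
  exact this.trans fun x hx => lt_of_lt_of_le (one_div_pos.2 hn) hx

/-- A weak derivative on the half-line tested against functions that need not vanish at `0`:
the boundary value of the continuous function `V` appears. -/
lemma integral_mul_deriv_halfLine {V G P : ℝ → ℝ} (hV : Continuous V) (hP : IsBump P)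
    (hG : IntegrableOn (fun x => G x * P x) (Ioi 0))
    (h : ∀ R, IsBump R → tsupport R ⊆ Ioi 0 →
      ∫ x in Ioi (0 : ℝ), V x * deriv R x = -∫ x in Ioi (0 : ℝ), G x * R x) :
    ∫ x in Ioi (0 : ℝ), V x * deriv P x = -(∫ x in Ioi (0 : ℝ), G x * P x) - V 0 * P 0 := by
  have hpos : ∀ᵐ x ∂volume.restrict (Ioi (0:ℝ)), 0 < x := ae_restrict_mem measurableSet_Ioi
  have hVP' : Integrable (fun x => V x * deriv P x) :=
    (hV.mul hP.deriv.continuous).integrable_of_hasCompactSupport hP.deriv.2.mul_left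
  have hVPc : Continuous fun x => V x * P x := hV.mul hP.continuous
  have hVPs : HasCompactSupport fun x => V x * P x := hP.2.mul_left
  obtain ⟨C, hC⟩ := hVPs.exists_bound_of_continuous hVPc
  have hds : Integrable (deriv step) :=
    isBump_deriv_step.continuous.integrable_of_hasCompactSupport isBump_deriv_step.2
  have lim1 := tendsto_integral_step hVP'.integrableOn measurable_id hpos
  have lim2 := tendsto_integral_step hG measurable_id hpos
  -- the mass of the derivative of the step concentrates at the boundary point
  have lim3 : Tendsto (fun n : ℕ => ∫ s in Ioi (0:ℝ),
      (V ((n + 1 : ℝ)⁻¹ * s) * P ((n + 1 : ℝ)⁻¹ * s)) * deriv step s) atTop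
      (𝓝 (∫ s in Ioi (0:ℝ), (V 0 * P 0) * deriv step s)) := by
    refine tendsto_integral_of_dominated_convergence (fun s => C * |deriv step s|) (fun n => ?_)
      (hds.norm.const_mul C).integrableOn (fun n => Eventually.of_forall fun s => ?_)
      (Eventually.of_forall fun s => ?_)
    · refine Continuous.aestronglyMeasurable ?_
      exact (hVPc.comp (continuous_const.mul continuous_id)).mul isBump_deriv_step.continuous
    · rw [norm_mul, Real.norm_eq_abs (deriv step s)]
      exact mul_le_mul_of_nonneg_right (hC _) (abs_nonneg _)
    · refine Tendsto.mul_const _ ?_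
      have : Tendsto (fun n : ℕ => (n + 1 : ℝ)⁻¹ * s) atTop (𝓝 0) := by
        have := (tendsto_one_div_add_atTop_nhds_zero_nat (𝕜 := ℝ)).mul_const s
        simpa [one_div] using this
      exact (hVPc.tendsto 0).comp this
  rw [integral_const_mul, integral_deriv_step, mul_one] at lim3
  have key : ∀ n : ℕ, ∫ x in Ioi (0:ℝ), (V x * deriv P x) * step ((n + 1 : ℝ) * x) =
      -(∫ x in Ioi (0:ℝ), (G x * P x) * step ((n + 1 : ℝ) * x)) -
      ∫ s in Ioi (0:ℝ), (V ((n + 1 : ℝ)⁻¹ * s) * P ((n + 1 : ℝ)⁻¹ * s)) * deriv step s := by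
    intro n
    have hn : (0:ℝ) < n + 1 := by positivity
    obtain ⟨hb, hs⟩ := isBump_step_mul hP n
    have hh := h _ hb hs
    have hd : ∀ x, deriv (fun x => step ((n + 1 : ℝ) * x) * P x) x =
        ((n + 1 : ℝ) * deriv step ((n + 1 : ℝ) * x)) * P x +
          step ((n + 1 : ℝ) * x) * deriv P x := by
      intro x
      have h1 : HasDerivAt step (deriv step ((n + 1 : ℝ) * x)) ((n + 1 : ℝ) * x) :=
        ((contDiff_step.differentiable (by simp)) _).hasDerivAt
      have h2 : HasDerivAt (fun x : ℝ => (n + 1 : ℝ) * x) (n + 1 : ℝ) x := by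
        simpa using (hasDerivAt_id x).const_mul (n + 1 : ℝ)
      have h3 := (h1.comp x h2).mul (hP.hasDerivAt x)
      simp only [Function.comp_def] at h3
      have h4 := h3.deriv
      rw [mul_comm (deriv step ((n + 1 : ℝ) * x))] at h4
      exact h4
    simp_rw [hd] at hh
    have sub := integral_comp_mul_left_Ioi (fun s => (V ((n + 1 : ℝ)⁻¹ * s) *
      P ((n + 1 : ℝ)⁻¹ * s)) * deriv step s) 0 hn
    rw [mul_zero, smul_eq_mul, eq_inv_mul_iff_mul_eq₀ hn.ne', ← integral_const_mul] at sub
    have i1 : IntegrableOn (fun x => (n + 1 : ℝ) * ((V ((n + 1 : ℝ)⁻¹ * ((n + 1 : ℝ) * x)) *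
      P ((n + 1 : ℝ)⁻¹ * ((n + 1 : ℝ) * x))) * deriv step ((n + 1 : ℝ) * x))) (Ioi 0) := by
      refine Integrable.integrableOn ?_
      simp_rw [inv_mul_cancel_left₀ hn.ne']
      refine (Continuous.integrable_of_hasCompactSupport ?_ ?_).const_mul _
      · exact hVPc.mul (isBump_deriv_step.continuous.comp (continuous_const.mul continuous_id))
      · exact hVPs.mul_right
    have i2 : IntegrableOn (fun x => (V x * deriv P x) * step ((n + 1 : ℝ) * x)) (Ioi 0) := by
      refine Integrable.integrableOn (Continuous.integrable_of_hasCompactSupport ?_ ?_)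
      · exact (hV.mul hP.deriv.continuous).mul
          (contDiff_step.continuous.comp (continuous_const.mul continuous_id))
      · exact (hP.deriv.2.mul_left).mul_right
    rw [← sub, eq_sub_iff_add_eq, ← integral_add i2 i1]
    convert hh using 2
    · ext x
      rw [inv_mul_cancel_left₀ hn.ne']; ring
    · congr 1; ext x; ring
  refine tendsto_nhds_unique lim1 ?_
  simp only [id] at lim1 lim2 ⊢
  simp_rw [key]
  exact lim2.neg.sub lim3

lemma IsBump.memLp_prod {P Q : ℝ → ℝ} (hP : IsBump P) (hQ : IsBump Q) :
    InL2 (fun p : ℝ × ℝ => P p.1 * Q p.2) := by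
  refine (Continuous.memLp_of_hasCompactSupport ?_
    (hasCompactSupport_mul_prod hP.2 hQ.2)).restrict _
  exact (hP.continuous.comp continuous_fst).mul (hQ.continuous.comp continuous_snd)

lemma InL2.integrableOn_mul {g w : ℝ × ℝ → ℝ} (hg : InL2 g) (hw : InL2 w) :
    IntegrableOn (fun p => g p * w p) openQuadrant :=
  MemLp.integrable_mul hg hw

lemma integrableOn_mul_bump {g : ℝ × ℝ → ℝ} (hg : InL2 g) {P Q : ℝ → ℝ} (hP : IsBump P)
    (hQ : IsBump Q) : IntegrableOn (fun p => g p * (P p.1 * Q p.2)) openQuadrant :=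
  hg.integrableOn_mul (hP.memLp_prod hQ)

lemma integrable_continuous_mul_bump {v : ℝ × ℝ → ℝ} (hv : Continuous v) {P Q : ℝ → ℝ}
    (hP : IsBump P) (hQ : IsBump Q) :
    IntegrableOn (fun p => v p * (P p.1 * Q p.2)) openQuadrant := by
  refine (Continuous.integrable_of_hasCompactSupport ?_
    ((hasCompactSupport_mul_prod hP.2 hQ.2).mul_left)).integrableOn
  exact hv.mul ((hP.continuous.comp continuous_fst).mul (hQ.continuous.comp continuous_snd))

lemma continuous_integral_mul_bump {v : ℝ × ℝ → ℝ} (hv : Continuous v) {Q : ℝ → ℝ}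
    (hQ : Continuous Q) (hQs : HasCompactSupport Q) :
    Continuous fun x => ∫ y in Ioi (0:ℝ), v (x, y) * Q y := by
  have := continuous_parametric_integral_of_continuous (μ := volume.restrict (Ioi (0:ℝ)))
    (f := fun x y => v (x, y) * Q y) (s := tsupport Q) (by fun_prop) hQs.isCompact
  convert this using 2 with x
  refine (setIntegral_eq_integral_of_forall_compl_eq_zero fun y hy => ?_).symm
  rw [image_eq_zero_of_notMem_tsupport hy, mul_zero]

/-- Integration by parts in the first variable, for a weak derivative tested against products of
bumps, when the first factor need not vanish at the boundary. -/
lemma integral_deriv_fst_of_interior {v g : ℝ × ℝ → ℝ} {P W Q : ℝ → ℝ} (hv : Continuous v)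
    (hg : InL2 g) (hP : IsBump P) (hW : IsBump W) (hQ : IsBump Q)
    (h : ∀ R, IsBump R → tsupport R ⊆ Ioi 0 →
      ∫ p in openQuadrant, v p * (deriv R p.1 * W p.2) =
        -∫ p in openQuadrant, g p * (R p.1 * Q p.2)) :
    ∫ p in openQuadrant, v p * (deriv P p.1 * W p.2) =
      -(∫ p in openQuadrant, g p * (P p.1 * Q p.2)) -
        P 0 * ∫ y in Ioi (0 : ℝ), v (0, y) * W y := by
  have e1 : ∀ R, IsBump R → ∫ p in openQuadrant, v p * (deriv R p.1 * W p.2) =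
      ∫ x in Ioi (0:ℝ), (∫ y in Ioi (0:ℝ), v (x, y) * W y) * deriv R x := by
    intro R hR
    rw [setIntegral_openQuadrant (integrable_continuous_mul_bump hv hR.deriv hW)]
    congr 1; ext x
    rw [← integral_mul_const]
    congr 1; ext y; ring
  have e2 : ∀ R, IsBump R → ∫ p in openQuadrant, g p * (R p.1 * Q p.2) =
      ∫ x in Ioi (0:ℝ), (∫ y in Ioi (0:ℝ), g (x, y) * Q y) * R x := by
    intro R hR
    rw [setIntegral_openQuadrant (integrableOn_mul_bump hg hR hQ)]
    congr 1; ext x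
    rw [← integral_mul_const]
    congr 1; ext y; ring
  have hi : IntegrableOn (fun x => (∫ y in Ioi (0:ℝ), g (x, y) * Q y) * P x) (Ioi 0) := by
    have := integrableOn_mul_bump hg hP hQ
    rw [IntegrableOn, restrict_openQuadrant] at this
    refine this.integral_prod_left.congr (Eventually.of_forall fun x => ?_)
    simp only
    rw [← integral_mul_const]
    congr 1; ext y; ring
  have := integral_mul_deriv_halfLine
    (continuous_integral_mul_bump hv hW.continuous hW.2) hP hi (fun R hR hR0 => by
      rw [← e1 R hR, ← e2 R hR]; exact h R hR hR0)
  rw [e1 P hP, e2 P hP, this, mul_comm (P 0)]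

/-- `u_x` tested against a product of bumps that need not vanish at the boundary. -/
lemma integral_deriv_fst_corner {v g : ℝ × ℝ → ℝ} {P Q : ℝ → ℝ} (hv : Continuous v)
    (hg : InL2 g) (hP : IsBump P) (hQ : IsBump Q)
    (h : ∀ R T, IsBump R → tsupport R ⊆ Ioi 0 → IsBump T → tsupport T ⊆ Ioi 0 →
      ∫ p in openQuadrant, v p * (deriv R p.1 * T p.2) =
        -∫ p in openQuadrant, g p * (R p.1 * T p.2)) :
    ∫ p in openQuadrant, v p * (deriv P p.1 * Q p.2) =
      -(∫ p in openQuadrant, g p * (P p.1 * Q p.2)) -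
        P 0 * ∫ y in Ioi (0 : ℝ), v (0, y) * Q y := by
  have hpos : ∀ᵐ p ∂(volume : Measure (ℝ × ℝ)).restrict openQuadrant, 0 < p.2 := by
    filter_upwards [ae_restrict_mem measurableSet_openQuadrant] with p hp using hp.2
  have hpos' : ∀ᵐ x ∂volume.restrict (Ioi (0:ℝ)), 0 < x := ae_restrict_mem measurableSet_Ioi
  have hvQ : Integrable (fun y => v (0, y) * Q y) :=
    Continuous.integrable_of_hasCompactSupport (by have := hQ.continuous; fun_prop) hQ.2.mul_left
  have lim1 := tendsto_integral_step (integrable_continuous_mul_bump hv hP.deriv hQ)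
    measurable_snd hpos
  have lim2 := tendsto_integral_step (integrableOn_mul_bump hg hP hQ) measurable_snd hpos
  have lim3 := (tendsto_integral_step hvQ.integrableOn measurable_id hpos').const_mul (P 0)
  refine tendsto_nhds_unique lim1 ((lim2.neg.sub lim3).congr fun n => ?_)
  obtain ⟨hb, hs⟩ := isBump_step_mul hQ n
  have := integral_deriv_fst_of_interior hv hg hP hb hb (fun R hR hR0 => h R _ hR hR0 hb hs)
  simp only [id] at this ⊢
  have a : ∀ (f : ℝ × ℝ → ℝ) (A : ℝ → ℝ),
      ∫ p in openQuadrant, f p * (A p.1 * (step ((n + 1 : ℝ) * p.2) * Q p.2)) =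
        ∫ p in openQuadrant, f p * (A p.1 * Q p.2) * step ((n + 1 : ℝ) * p.2) := by
    intro f A; congr 1; ext p; ring
  have b : ∫ y in Ioi (0:ℝ), v (0, y) * (step ((n + 1 : ℝ) * y) * Q y) =
      ∫ y in Ioi (0:ℝ), v (0, y) * Q y * step ((n + 1 : ℝ) * y) := by
    congr 1; ext p; ring
  rw [a, a, b] at this
  exact this.symm

/-- Functions `g₁, g₂, g₁₂` that are `L²` weak derivatives `v_x, v_y, v_xy` of `v`. -/
structure IsWeakRep (v g₁ g₂ g₁₂ : ℝ × ℝ → ℝ) : Prop where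
  memL2 : InL2 v
  memL2_x : InL2 g₁
  memL2_y : InL2 g₂
  memL2_xy : InL2 g₁₂
  weak_x : IsWeakX v g₁
  weak_y : IsWeakY v g₂
  weak_xy : IsWeakXY v g₁₂

section Corner

variable {v g₁ g₂ g₁₂ : ℝ × ℝ → ℝ} {P Q : ℝ → ℝ}

lemma integral_x_corner (hw : IsWeakRep v g₁ g₂ g₁₂) (hv : Continuous v) (hP : IsBump P)
    (hQ : IsBump Q) :
    ∫ p in openQuadrant, g₁ p * (P p.1 * Q p.2) =
      -(∫ p in openQuadrant, v p * (deriv P p.1 * Q p.2)) -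
        P 0 * ∫ y in Ioi (0 : ℝ), v (0, y) * Q y := by
  rw [integral_deriv_fst_corner hv hw.memL2_x hP hQ]
  · ring
  · intro R T hR hR0 hT hT0
    have := hw.weak_x.2 _ (isTestFunction_mul hR hT hR0 hT0)
    rwa [partialX_mul (hR.1.differentiable (by simp)) (hT.1.differentiable (by simp))] at this

lemma integral_y_corner (hw : IsWeakRep v g₁ g₂ g₁₂) (hv : Continuous v) (hP : IsBump P)
    (hQ : IsBump Q) :
    ∫ p in openQuadrant, g₂ p * (P p.1 * Q p.2) =
      -(∫ p in openQuadrant, v p * (P p.1 * deriv Q p.2)) -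
        Q 0 * ∫ x in Ioi (0 : ℝ), v (x, 0) * P x := by
  have hsw : ∀ (f : ℝ × ℝ → ℝ) (A B : ℝ → ℝ), ∫ p in openQuadrant, f p * (A p.1 * B p.2) =
      ∫ p in openQuadrant, f p.swap * (B p.1 * A p.2) := by
    intro f A B
    rw [← setIntegral_openQuadrant_swap]
    congr 1; ext p; simp only [Prod.fst_swap, Prod.snd_swap]; ring
  have hg : InL2 (fun p => g₂ p.swap) := by
    have := hw.memL2_y
    rw [InL2, restrict_openQuadrant] at *
    exact this.comp_measurePreserving Measure.measurePreserving_swap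
  have := integral_deriv_fst_corner (v := fun p => v p.swap) (g := fun p => g₂ p.swap)
    (hv.comp continuous_swap) hg hQ hP ?_
  · rw [hsw g₂, hsw v, this]
    simp only [Prod.swap_prod_mk]
    ring
  · intro R T hR hR0 hT hT0
    have := hw.weak_y.2 _ (isTestFunction_mul hT hR hT0 hR0)
    rw [partialY_mul (hT.1.differentiable (by simp)) (hR.1.differentiable (by simp))] at this
    rw [← hsw v T (deriv R), ← hsw g₂ T R]
    exact this

/-- `u_xy` tested against a product of bumps that need not vanish at the boundary; the value of `v`
at the corner appears. -/
lemma integral_xy_corner (hw : IsWeakRep v g₁ g₂ g₁₂) (hv : Continuous v) (hP : IsBump P)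
    (hQ : IsBump Q) :
    ∫ p in openQuadrant, g₁₂ p * (P p.1 * Q p.2) =
      (∫ p in openQuadrant, v p * (deriv P p.1 * deriv Q p.2)) +
        P 0 * (∫ y in Ioi (0 : ℝ), v (0, y) * deriv Q y) +
        Q 0 * (∫ x in Ioi (0 : ℝ), v (x, 0) * deriv P x) + P 0 * Q 0 * v (0, 0) := by
  -- first the boundary term in `x`, for a second factor vanishing near `0`
  have h1 : ∀ T, IsBump T → tsupport T ⊆ Ioi 0 →
      ∫ p in openQuadrant, v p * (deriv P p.1 * deriv T p.2) =
        (∫ p in openQuadrant, g₁₂ p * (P p.1 * T p.2)) -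
          P 0 * ∫ y in Ioi (0 : ℝ), v (0, y) * deriv T y := by
    intro T hT hT0
    have := integral_deriv_fst_of_interior (g := fun p => -g₁₂ p) hv hw.memL2_xy.neg hP
      hT.deriv hT (fun R hR hR0 => ?_)
    · simpa [integral_neg] using this
    · have := hw.weak_xy.2 _ (isTestFunction_mul hR hT hR0 hT0)
      rw [partialY_mul (hR.1.differentiable (by simp)) (hT.1.differentiable (by simp)),
        partialX_mul (hR.1.differentiable (by simp)) (hT.deriv.1.differentiable (by simp))] at this
      simpa [integral_neg] using this
  -- then the boundary term in `y`
  have hV0 : Continuous fun y => ∫ x in Ioi (0:ℝ), v (x, y) * deriv P x :=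
    continuous_integral_mul_bump (v := fun p => v p.swap) (hv.comp continuous_swap)
      hP.deriv.continuous hP.deriv.2
  have hV : Continuous fun y => (∫ x in Ioi (0:ℝ), v (x, y) * deriv P x) + P 0 * v (0, y) := by
    fun_prop
  have e1 : ∀ T, IsBump T →
      ∫ y in Ioi (0:ℝ), ((∫ x in Ioi (0:ℝ), v (x, y) * deriv P x) + P 0 * v (0, y)) * deriv T y =
      (∫ p in openQuadrant, v p * (deriv P p.1 * deriv T p.2)) +
          P 0 * ∫ y in Ioi (0 : ℝ), v (0, y) * deriv T y := by
    intro T hT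
    have hTc := hT.deriv.continuous
    rw [setIntegral_openQuadrant_symm (integrable_continuous_mul_bump hv hP.deriv hT.deriv),
      ← integral_const_mul, ← integral_add]
    · congr 1; ext y
      rw [add_mul, ← integral_mul_const]
      congr 1
      · congr 1; ext x; ring
      · ring
    · refine (Continuous.integrable_of_hasCompactSupport (f := fun y =>
        (∫ x in Ioi (0:ℝ), v (x, y) * deriv P x) * deriv T y) (by fun_prop)
        hT.deriv.2.mul_left).integrableOn.congr (Eventually.of_forall fun y => ?_)
      simp only
      rw [← integral_mul_const]
      congr 1; ext x; ring
    · exact (Continuous.integrable_of_hasCompactSupport (by fun_prop)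
        (hT.deriv.2.mul_left.mul_left)).integrableOn
  have e2 : ∀ T, IsBump T → ∫ p in openQuadrant, g₁₂ p * (P p.1 * T p.2) =
      -∫ y in Ioi (0:ℝ), (-∫ x in Ioi (0:ℝ), g₁₂ (x, y) * P x) * T y := by
    intro T hT
    rw [setIntegral_openQuadrant_symm (integrableOn_mul_bump hw.memL2_xy hP hT), ← integral_neg]
    congr 1; ext y
    rw [neg_mul, neg_neg, ← integral_mul_const]
    congr 1; ext x; ring
  have hi : IntegrableOn (fun y => (-∫ x in Ioi (0:ℝ), g₁₂ (x, y) * P x) * Q y) (Ioi 0) := by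
    have := integrableOn_mul_bump hw.memL2_xy hP hQ
    rw [IntegrableOn, restrict_openQuadrant] at this
    refine this.integral_prod_right.neg.congr (Eventually.of_forall fun y => ?_)
    simp only [Pi.neg_apply]
    rw [neg_mul, ← integral_mul_const]
    congr 2; ext x; ring
  have := integral_mul_deriv_halfLine hV hQ hi (fun T hT hT0 => by
    rw [e1 T hT, h1 T hT hT0, e2 T hT]; ring)
  rw [e1 Q hQ] at this
  rw [e2 Q hQ]
  linarith

end Corner

/-! ### Truncation to compact support -/

lemma integral_lincomb_four {α : Type*} [MeasurableSpace α] {μ : Measure α} {f g h k : α → ℝ}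
    (hf : Integrable f μ) (hg : Integrable g μ) (hh : Integrable h μ) (hk : Integrable k μ)
    (s t u : ℝ) :
    ∫ z, (f z + s * g z + t * h z + u * k z) ∂μ =
      (∫ z, f z ∂μ) + s * (∫ z, g z ∂μ) + t * (∫ z, h z ∂μ) + u * ∫ z, k z ∂μ := by
  have i1 : Integrable (fun z => f z + s * g z) μ := hf.add (hg.const_mul s)
  have i2 : Integrable (fun z => f z + s * g z + t * h z) μ := i1.add (hh.const_mul t)
  rw [integral_add i2 (hk.const_mul u), integral_add i1 (hh.const_mul t),
    integral_add hf (hg.const_mul s), integral_const_mul, integral_const_mul, integral_const_mul]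

/-- Data `v, g₁, g₂, g₁₂` on the quadrant, integrable, for which integration by parts against
products of arbitrary smooth functions holds with the expected boundary and corner terms. -/
structure IsCornerRep (v g₁ g₂ g₁₂ : ℝ × ℝ → ℝ) : Prop where
  int : IntegrableOn v openQuadrant
  int_x : IntegrableOn g₁ openQuadrant
  int_y : IntegrableOn g₂ openQuadrant
  int_xy : IntegrableOn g₁₂ openQuadrant
  ibp_x : ∀ p q : ℝ → ℝ, ContDiff ℝ ∞ p → ContDiff ℝ ∞ q →
    ∫ z in openQuadrant, g₁ z * (p z.1 * q z.2) =
      -(∫ z in openQuadrant, v z * (deriv p z.1 * q z.2)) -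
        p 0 * ∫ y in Ioi (0 : ℝ), v (0, y) * q y
  ibp_y : ∀ p q : ℝ → ℝ, ContDiff ℝ ∞ p → ContDiff ℝ ∞ q →
    ∫ z in openQuadrant, g₂ z * (p z.1 * q z.2) =
      -(∫ z in openQuadrant, v z * (p z.1 * deriv q z.2)) -
        q 0 * ∫ x in Ioi (0 : ℝ), v (x, 0) * p x
  ibp_xy : ∀ p q : ℝ → ℝ, ContDiff ℝ ∞ p → ContDiff ℝ ∞ q →
    ∫ z in openQuadrant, g₁₂ z * (p z.1 * q z.2) =
      (∫ z in openQuadrant, v z * (deriv p z.1 * deriv q z.2)) +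
        p 0 * (∫ y in Ioi (0 : ℝ), v (0, y) * deriv q y) +
        q 0 * (∫ x in Ioi (0 : ℝ), v (x, 0) * deriv p x) + p 0 * q 0 * v (0, 0)

section Truncation

variable {v g₁ g₂ g₁₂ : ℝ × ℝ → ℝ} {χ : ℝ → ℝ}

lemma IsBump.mul_right {P f : ℝ → ℝ} (h : IsBump P) (hf : ContDiff ℝ ∞ f) :
    IsBump (fun x => P x * f x) := ⟨h.1.mul hf, h.2.mul_right⟩

lemma deriv_bump_mul {P f : ℝ → ℝ} (h : IsBump P) (hf : ContDiff ℝ ∞ f) (x : ℝ) :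
    deriv (fun x => P x * f x) x = deriv P x * f x + P x * deriv f x :=
  ((h.hasDerivAt x).mul ((hf.differentiable (by simp)) x).hasDerivAt).deriv

/-- Multiplying by `χ(x) χ(y)`, with `χ` a bump equal to `1` at `0`, and correcting the weak
derivatives by the product rule, gives data with compact support. -/
lemma IsWeakRep.isCornerRep (hw : IsWeakRep v g₁ g₂ g₁₂) (hv : Continuous v) (hχ : IsBump χ)
    (hχ0 : χ 0 = 1) :
    IsCornerRep (fun z => v z * (χ z.1 * χ z.2))
      (fun z => g₁ z * (χ z.1 * χ z.2) + v z * (deriv χ z.1 * χ z.2))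
      (fun z => g₂ z * (χ z.1 * χ z.2) + v z * (χ z.1 * deriv χ z.2))
      (fun z => g₁₂ z * (χ z.1 * χ z.2) + g₁ z * (χ z.1 * deriv χ z.2) +
        g₂ z * (deriv χ z.1 * χ z.2) + v z * (deriv χ z.1 * deriv χ z.2)) where
  int := integrable_continuous_mul_bump hv hχ hχ
  int_x := (integrableOn_mul_bump hw.memL2_x hχ hχ).add
    (integrableOn_mul_bump hw.memL2 hχ.deriv hχ)
  int_y := (integrableOn_mul_bump hw.memL2_y hχ hχ).add
    (integrableOn_mul_bump hw.memL2 hχ hχ.deriv)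
  int_xy := (((integrableOn_mul_bump hw.memL2_xy hχ hχ).add
    (integrableOn_mul_bump hw.memL2_x hχ hχ.deriv)).add
    (integrableOn_mul_bump hw.memL2_y hχ.deriv hχ)).add
    (integrableOn_mul_bump hw.memL2 hχ.deriv hχ.deriv)
  ibp_x := by
    intro p q hp hq
    have hP := hχ.mul_right hp
    have hQ := hχ.mul_right hq
    have hP1 := hχ.deriv.mul_right hp
    have hP2 := hχ.mul_right (contDiff_infty_iff_deriv.1 hp).2
    have key := integral_x_corner hw hv hP hQ
    simp_rw [deriv_bump_mul hχ hp, hχ0] at key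
    have e1 : ∫ z in openQuadrant, (g₁ z * (χ z.1 * χ z.2) + v z * (deriv χ z.1 * χ z.2)) *
        (p z.1 * q z.2) =
        (∫ z in openQuadrant, g₁ z * (χ z.1 * p z.1 * (χ z.2 * q z.2))) +
        ∫ z in openQuadrant, v z * (deriv χ z.1 * p z.1 * (χ z.2 * q z.2)) := by
      rw [← integral_add (integrableOn_mul_bump hw.memL2_x hP hQ)
        (integrableOn_mul_bump hw.memL2 hP1 hQ)]
      congr 1; ext z; ring
    have e2 : ∫ z in openQuadrant, v z *
        ((deriv χ z.1 * p z.1 + χ z.1 * deriv p z.1) * (χ z.2 * q z.2)) =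
        (∫ z in openQuadrant, v z * (deriv χ z.1 * p z.1 * (χ z.2 * q z.2))) +
        ∫ z in openQuadrant, v z * (χ z.1 * χ z.2) * (deriv p z.1 * q z.2) := by
      have : ∫ z in openQuadrant, v z * (χ z.1 * χ z.2) * (deriv p z.1 * q z.2) =
          ∫ z in openQuadrant, v z * (χ z.1 * deriv p z.1 * (χ z.2 * q z.2)) := by
        congr 1; ext z; ring
      rw [this, ← integral_add (integrableOn_mul_bump hw.memL2 hP1 hQ)
        (integrableOn_mul_bump hw.memL2 hP2 hQ)]
      congr 1; ext z; ring
    have e3 : ∫ y in Ioi (0 : ℝ), v (0, y) * (χ 0 * χ y) * q y =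
        ∫ y in Ioi (0 : ℝ), v (0, y) * (χ y * q y) := by
      rw [hχ0]; congr 1; ext y; ring
    rw [e1, key, e2, e3]
    ring
  ibp_y := by
    intro p q hp hq
    have hP := hχ.mul_right hp
    have hQ := hχ.mul_right hq
    have hQ1 := hχ.deriv.mul_right hq
    have hQ2 := hχ.mul_right (contDiff_infty_iff_deriv.1 hq).2
    have key := integral_y_corner hw hv hP hQ
    simp_rw [deriv_bump_mul hχ hq, hχ0] at key
    have e1 : ∫ z in openQuadrant, (g₂ z * (χ z.1 * χ z.2) + v z * (χ z.1 * deriv χ z.2)) *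
        (p z.1 * q z.2) =
        (∫ z in openQuadrant, g₂ z * (χ z.1 * p z.1 * (χ z.2 * q z.2))) +
        ∫ z in openQuadrant, v z * (χ z.1 * p z.1 * (deriv χ z.2 * q z.2)) := by
      rw [← integral_add (integrableOn_mul_bump hw.memL2_y hP hQ)
        (integrableOn_mul_bump hw.memL2 hP hQ1)]
      congr 1; ext z; ring
    have e2 : ∫ z in openQuadrant, v z *
        (χ z.1 * p z.1 * (deriv χ z.2 * q z.2 + χ z.2 * deriv q z.2)) =
        (∫ z in openQuadrant, v z * (χ z.1 * p z.1 * (deriv χ z.2 * q z.2))) +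
        ∫ z in openQuadrant, v z * (χ z.1 * χ z.2) * (p z.1 * deriv q z.2) := by
      have : ∫ z in openQuadrant, v z * (χ z.1 * χ z.2) * (p z.1 * deriv q z.2) =
          ∫ z in openQuadrant, v z * (χ z.1 * p z.1 * (χ z.2 * deriv q z.2)) := by
        congr 1; ext z; ring
      rw [this, ← integral_add (integrableOn_mul_bump hw.memL2 hP hQ1)
        (integrableOn_mul_bump hw.memL2 hP hQ2)]
      congr 1; ext z; ring
    have e3 : ∫ x in Ioi (0 : ℝ), v (x, 0) * (χ x * χ 0) * p x =
        ∫ x in Ioi (0 : ℝ), v (x, 0) * (χ x * p x) := by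
      rw [hχ0]; congr 1; ext y; ring
    rw [e1, key, e2, e3]
    ring
  ibp_xy := by
    intro p q hp hq
    have hP := hχ.mul_right hp
    have hQ := hχ.mul_right hq
    have hP1 := hχ.deriv.mul_right hp
    have hP2 := hχ.mul_right (contDiff_infty_iff_deriv.1 hp).2
    have hQ1 := hχ.deriv.mul_right hq
    have hQ2 := hχ.mul_right (contDiff_infty_iff_deriv.1 hq).2
    have kxy := integral_xy_corner hw hv hP hQ
    have kx := integral_x_corner hw hv hP hQ1
    have ky := integral_y_corner hw hv hP1 hQ
    simp_rw [deriv_bump_mul hχ hp, deriv_bump_mul hχ hq, hχ0] at kxy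
    simp_rw [deriv_bump_mul hχ hp, hχ0] at kx
    simp_rw [deriv_bump_mul hχ hq, hχ0] at ky
    have trace : ∀ (w : ℝ → ℝ) (f : ℝ → ℝ), Continuous w → ContDiff ℝ ∞ f →
        ∫ y in Ioi (0 : ℝ), w y * (deriv χ y * f y + χ y * deriv f y) =
        (∫ y in Ioi (0 : ℝ), w y * (deriv χ y * f y)) +
          ∫ y in Ioi (0 : ℝ), w y * χ y * deriv f y := by
      intro w f hwc hf
      have i1 : Integrable (fun y => w y * (deriv χ y * f y)) :=
        Continuous.integrable_of_hasCompactSupport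
          (hwc.mul (hχ.deriv.mul_right hf).continuous) (hχ.deriv.mul_right hf).2.mul_left
      have i2 : Integrable (fun y => w y * (χ y * deriv f y)) :=
        Continuous.integrable_of_hasCompactSupport
          (hwc.mul (hχ.mul_right (contDiff_infty_iff_deriv.1 hf).2).continuous)
          (hχ.mul_right (contDiff_infty_iff_deriv.1 hf).2).2.mul_left
      have : ∫ y in Ioi (0 : ℝ), w y * χ y * deriv f y =
          ∫ y in Ioi (0 : ℝ), w y * (χ y * deriv f y) := by
        congr 1; ext y; ring
      rw [this, ← integral_add i1.integrableOn i2.integrableOn]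
      congr 1; ext y; ring
    have e1 : ∫ z in openQuadrant, (g₁₂ z * (χ z.1 * χ z.2) + g₁ z * (χ z.1 * deriv χ z.2) +
        g₂ z * (deriv χ z.1 * χ z.2) + v z * (deriv χ z.1 * deriv χ z.2)) * (p z.1 * q z.2) =
        (∫ z in openQuadrant, g₁₂ z * (χ z.1 * p z.1 * (χ z.2 * q z.2))) +
        (∫ z in openQuadrant, g₁ z * (χ z.1 * p z.1 * (deriv χ z.2 * q z.2))) +
        (∫ z in openQuadrant, g₂ z * (deriv χ z.1 * p z.1 * (χ z.2 * q z.2))) +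
        ∫ z in openQuadrant, v z * (deriv χ z.1 * p z.1 * (deriv χ z.2 * q z.2)) := by
      have i1 := integrableOn_mul_bump hw.memL2_xy hP hQ
      have i2 := integrableOn_mul_bump hw.memL2_x hP hQ1
      have i3 := integrableOn_mul_bump hw.memL2_y hP1 hQ
      have i4 := integrableOn_mul_bump hw.memL2 hP1 hQ1
      have := integral_lincomb_four i1 i2 i3 i4 1 1 1
      simp only [one_mul] at this
      rw [← this]
      congr 1; ext z; ring
    have e2 : ∫ z in openQuadrant, v z * (χ z.1 * χ z.2) * (deriv p z.1 * deriv q z.2) =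
        (∫ z in openQuadrant, v z * ((deriv χ z.1 * p z.1 + χ z.1 * deriv p z.1) *
          (deriv χ z.2 * q z.2 + χ z.2 * deriv q z.2))) -
        (∫ z in openQuadrant, v z * ((deriv χ z.1 * p z.1 + χ z.1 * deriv p z.1) *
          (deriv χ z.2 * q z.2))) -
        (∫ z in openQuadrant, v z * (deriv χ z.1 * p z.1 *
          (deriv χ z.2 * q z.2 + χ z.2 * deriv q z.2))) +
        ∫ z in openQuadrant, v z * (deriv χ z.1 * p z.1 * (deriv χ z.2 * q z.2)) := by
      have hPd : IsBump (fun x => deriv χ x * p x + χ x * deriv p x) :=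
        ⟨hP1.1.add hP2.1, hP1.2.add hP2.2⟩
      have hQd : IsBump (fun x => deriv χ x * q x + χ x * deriv q x) :=
        ⟨hQ1.1.add hQ2.1, hQ1.2.add hQ2.2⟩
      have i1 := integrableOn_mul_bump hw.memL2 hPd hQd
      have i2 := integrableOn_mul_bump hw.memL2 hPd hQ1
      have i3 := integrableOn_mul_bump hw.memL2 hP1 hQd
      have i4 := integrableOn_mul_bump hw.memL2 hP1 hQ1
      have := integral_lincomb_four i1 i2 i3 i4 (-1) (-1) 1
      simp only [one_mul, neg_one_mul, ← sub_eq_add_neg] at this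
      rw [← this]
      congr 1; ext z; ring
    have t1 := trace (fun y => v (0, y)) q (by fun_prop) hq
    have t2 := trace (fun x => v (x, 0)) p (by fun_prop) hp
    have e3 : ∫ y in Ioi (0 : ℝ), v (0, y) * (χ 0 * χ y) * deriv q y =
        ∫ y in Ioi (0 : ℝ), v (0, y) * χ y * deriv q y := by
      rw [hχ0]; congr 1; ext y; ring
    have e4 : ∫ x in Ioi (0 : ℝ), v (x, 0) * (χ x * χ 0) * deriv p x =
        ∫ x in Ioi (0 : ℝ), v (x, 0) * χ x * deriv p x := by
      rw [hχ0]; congr 1; ext y; ring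
    rw [e1, e2, e3, e4, kxy, kx, ky, t1, t2]
    simp only [hχ0]
    ring

end Truncation

section Form

variable {v g₁ g₂ g₁₂ : ℝ × ℝ → ℝ}

lemma deriv_exp_neg_mul (k : ℝ) : deriv (fun x : ℝ => Real.exp (-(x * k))) =
    fun x => -k * Real.exp (-(x * k)) := by
  ext x
  have h : HasDerivAt (fun x : ℝ => -(x * k)) (-(1 * k)) x :=
    ((hasDerivAt_id x).mul_const k).neg
  rw [h.exp.deriv]; ring

lemma deriv_mul_sin_mul (η : ℝ) : deriv (fun y : ℝ => η * Real.sin (y * η)) =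
    fun y => η ^ 2 * Real.cos (y * η) := by
  ext y
  have := (((hasDerivAt_id y).mul_const η).sin.const_mul η).deriv
  simp only [id] at this
  erw [this]; ring

/-- The bilinear form of the energy, for `e^{-kx} cos (ηy) / k` against corner data. It involves
only the trace of `v` on `x = 0` when `k² (η² + a) = c η² + d`. -/
lemma IsCornerRep.form_exp_cos (hr : IsCornerRep v g₁ g₂ g₁₂) (a c d η : ℝ) {k : ℝ} (hk : 0 < k) :
    (∫ z in openQuadrant, g₁₂ z * (Real.exp (-(z.1 * k)) * (η * Real.sin (z.2 * η)))) -
      a * (∫ z in openQuadrant, g₁ z * (Real.exp (-(z.1 * k)) * Real.cos (z.2 * η))) -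
      c * (∫ z in openQuadrant, g₂ z * (Real.exp (-(z.1 * k)) / k * (η * Real.sin (z.2 * η)))) +
      d * (∫ z in openQuadrant, v z * (Real.exp (-(z.1 * k)) / k * Real.cos (z.2 * η))) =
    (c * η ^ 2 + d - k ^ 2 * (η ^ 2 + a)) *
        (∫ z in openQuadrant, v z * (Real.exp (-(z.1 * k)) / k * Real.cos (z.2 * η))) +
      (η ^ 2 + a) * ∫ y in Ioi (0 : ℝ), v (0, y) * Real.cos (y * η) := by
  have he : ContDiff ℝ ∞ (fun x : ℝ => Real.exp (-(x * k))) := by fun_prop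
  have hek : ContDiff ℝ ∞ (fun x : ℝ => Real.exp (-(x * k)) / k) := by fun_prop
  have hc : ContDiff ℝ ∞ (fun y : ℝ => Real.cos (y * η)) := by fun_prop
  have hs : ContDiff ℝ ∞ (fun y : ℝ => η * Real.sin (y * η)) := by fun_prop
  have e1 := hr.ibp_xy _ _ he hs
  have e2 := hr.ibp_x _ _ he hc
  have e3 := hr.ibp_y _ _ hek hs
  simp only [deriv_exp_neg_mul, deriv_mul_sin_mul, zero_mul, neg_zero, Real.exp_zero, one_mul,
    Real.sin_zero, mul_zero, sub_zero, add_zero] at e1 e2 e3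
  rw [e1, e2, e3]
  have r1 : ∫ z in openQuadrant, v z * (-k * Real.exp (-(z.1 * k)) *
      (η ^ 2 * Real.cos (z.2 * η))) = -(k ^ 2 * η ^ 2) *
      ∫ z in openQuadrant, v z * (Real.exp (-(z.1 * k)) / k * Real.cos (z.2 * η)) := by
    rw [← integral_const_mul]; congr 1; ext z; field_simp
  have r2 : ∫ z in openQuadrant, v z * (-k * Real.exp (-(z.1 * k)) * Real.cos (z.2 * η)) =
      -(k ^ 2) * ∫ z in openQuadrant, v z * (Real.exp (-(z.1 * k)) / k * Real.cos (z.2 * η)) := by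
    rw [← integral_const_mul]; congr 1; ext z; field_simp
  have r3 : ∫ z in openQuadrant, v z * (Real.exp (-(z.1 * k)) / k *
      (η ^ 2 * Real.cos (z.2 * η))) = η ^ 2 *
      ∫ z in openQuadrant, v z * (Real.exp (-(z.1 * k)) / k * Real.cos (z.2 * η)) := by
    rw [← integral_const_mul]; congr 1; ext z; ring
  have r4 : ∫ y in Ioi (0:ℝ), v (0, y) * (η ^ 2 * Real.cos (y * η)) =
      η ^ 2 * ∫ y in Ioi (0:ℝ), v (0, y) * Real.cos (y * η) := by
    rw [← integral_const_mul]; congr 1; ext z; ring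
  rw [r1, r2, r3, r4]
  ring

/-- The bilinear form of the energy with `a = r²` and `c = p²`, for `e^{-px - ry} / (pr)` against
corner data. The traces on both sides cancel, and the corner value is left. -/
lemma IsCornerRep.form_exp_exp (hr : IsCornerRep v g₁ g₂ g₁₂) (d : ℝ) {p r : ℝ} (hp : 0 < p)
    (hq : 0 < r) :
    (∫ z in openQuadrant, g₁₂ z * (Real.exp (-(z.1 * p)) * Real.exp (-(z.2 * r)))) -
      r ^ 2 * (∫ z in openQuadrant, g₁ z * (Real.exp (-(z.1 * p)) * Real.exp (-(z.2 * r)))) / r -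
      p ^ 2 * (∫ z in openQuadrant, g₂ z * (Real.exp (-(z.1 * p)) * Real.exp (-(z.2 * r)))) / p +
      d * (∫ z in openQuadrant, v z * (Real.exp (-(z.1 * p)) * Real.exp (-(z.2 * r)))) / (p * r) =
    (d - r ^ 2 * p ^ 2) / (p * r) *
        (∫ z in openQuadrant, v z * (Real.exp (-(z.1 * p)) * Real.exp (-(z.2 * r)))) +
      v (0, 0) := by
  have he : ContDiff ℝ ∞ (fun x : ℝ => Real.exp (-(x * p))) := by fun_prop
  have hc : ContDiff ℝ ∞ (fun x : ℝ => Real.exp (-(x * r))) := by fun_prop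
  have e1 := hr.ibp_xy _ _ he hc
  have e2 := hr.ibp_x _ _ he hc
  have e3 := hr.ibp_y _ _ he hc
  simp only [deriv_exp_neg_mul, zero_mul, neg_zero, Real.exp_zero, one_mul] at e1 e2 e3
  rw [e1, e2, e3]
  have r1 : ∫ z in openQuadrant, v z * (-p * Real.exp (-(z.1 * p)) *
      (-r * Real.exp (-(z.2 * r)))) = (p * r) *
      ∫ z in openQuadrant, v z * (Real.exp (-(z.1 * p)) * Real.exp (-(z.2 * r))) := by
    rw [← integral_const_mul]; congr 1; ext z; ring
  have r2 : ∫ z in openQuadrant, v z * (-p * Real.exp (-(z.1 * p)) * Real.exp (-(z.2 * r))) =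
      -p * ∫ z in openQuadrant, v z * (Real.exp (-(z.1 * p)) * Real.exp (-(z.2 * r))) := by
    rw [← integral_const_mul]; congr 1; ext z; ring
  have r3 : ∫ z in openQuadrant, v z * (Real.exp (-(z.1 * p)) * (-r * Real.exp (-(z.2 * r)))) =
      -r * ∫ z in openQuadrant, v z * (Real.exp (-(z.1 * p)) * Real.exp (-(z.2 * r))) := by
    rw [← integral_const_mul]; congr 1; ext z; ring
  have r4 : ∫ y in Ioi (0:ℝ), v (0, y) * (-r * Real.exp (-(y * r))) =
      -r * ∫ y in Ioi (0:ℝ), v (0, y) * Real.exp (-(y * r)) := by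
    rw [← integral_const_mul]; congr 1; ext z; ring
  have r5 : ∫ x in Ioi (0:ℝ), v (x, 0) * (-p * Real.exp (-(x * p))) =
      -p * ∫ x in Ioi (0:ℝ), v (x, 0) * Real.exp (-(x * p)) := by
    rw [← integral_const_mul]; congr 1; ext z; ring
  rw [r1, r2, r3, r4, r5]
  field_simp
  ring

end Form

/-! ### Parameter integrals with exponential decay in the first variable -/

/-- A family of integrands in `η`, continuous jointly with the parameter `p`, dominated by
`exp (-σ p.1) / (η² + a)` on the half-plane `0 ≤ p.1`. -/
structure IsDecaying (a : ℝ) (J : ℝ × ℝ → ℝ → ℝ) : Prop where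
  cont : Continuous (Function.uncurry J)
  bound : ∃ M σ : ℝ, 0 < σ ∧ ∀ p : ℝ × ℝ, 0 ≤ p.1 → ∀ η,
    |J p η| ≤ M * Real.exp (-(σ * p.1)) * (η ^ 2 + a)⁻¹

namespace IsDecaying

variable {a : ℝ} {J J' : ℝ × ℝ → ℝ → ℝ}

lemma continuous_right (hJ : IsDecaying a J) (p : ℝ × ℝ) : Continuous (J p) :=
  hJ.cont.comp (Continuous.prodMk_right p)

lemma continuous_left (hJ : IsDecaying a J) (η : ℝ) : Continuous fun p => J p η :=
  hJ.cont.comp (Continuous.prodMk_left η)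

lemma exists_uniform_bound (ha : 0 < a) (hJ : IsDecaying a J) :
    ∃ M : ℝ, ∀ p : ℝ × ℝ, 0 ≤ p.1 → ∀ η, |J p η| ≤ M * (η ^ 2 + a)⁻¹ := by
  obtain ⟨M, σ, hσ, h⟩ := hJ.bound
  refine ⟨|M|, fun p hp η => (h p hp η).trans ?_⟩
  have h1 : Real.exp (-(σ * p.1)) ≤ 1 := Real.exp_le_one_iff.2 (by nlinarith)
  have h2 : M * Real.exp (-(σ * p.1)) ≤ |M| :=
    (mul_le_mul_of_nonneg_right (le_abs_self M) (Real.exp_pos _).le).trans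
      (mul_le_of_le_one_right (abs_nonneg _) h1)
  exact mul_le_mul_of_nonneg_right h2 (by positivity)

lemma integrable (ha : 0 < a) (hJ : IsDecaying a J) {p : ℝ × ℝ} (hp : 0 ≤ p.1) :
    IntegrableOn (J p) (Ioi 0) := by
  obtain ⟨M, hM⟩ := hJ.exists_uniform_bound ha
  exact (((integrable_inv_sq_add ha).const_mul M).mono'
    (hJ.continuous_right p).aestronglyMeasurable
    (Eventually.of_forall fun η => hM p hp η)).integrableOn

lemma continuousOn (ha : 0 < a) (hJ : IsDecaying a J) :
    ContinuousOn (fun p => ∫ η in Ioi (0:ℝ), J p η) {p | 0 ≤ p.1} := by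
  obtain ⟨M, hM⟩ := hJ.exists_uniform_bound ha
  exact continuousOn_of_dominated (bound := fun η => M * (η ^ 2 + a)⁻¹)
    (fun p _ => (hJ.continuous_right p).aestronglyMeasurable)
    (fun p hp => Eventually.of_forall fun η => hM p hp η)
    ((integrable_inv_sq_add ha).const_mul M).integrableOn
    (Eventually.of_forall fun η => (hJ.continuous_left η).continuousOn)

lemma exists_abs_integral_le (ha : 0 < a) (hJ : IsDecaying a J) :
    ∃ M σ : ℝ, 0 < σ ∧ ∀ p : ℝ × ℝ, 0 ≤ p.1 →
      |∫ η in Ioi (0:ℝ), J p η| ≤ M * Real.exp (-(σ * p.1)) := by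
  obtain ⟨M, σ, hσ, h⟩ := hJ.bound
  refine ⟨M * ∫ η in Ioi (0:ℝ), (η ^ 2 + a)⁻¹, σ, hσ, fun p hp => ?_⟩
  have h2 := norm_integral_le_of_norm_le (μ := volume.restrict (Ioi (0:ℝ))) (f := J p)
    ((integrable_inv_sq_add ha).const_mul (M * Real.exp (-(σ * p.1)))).integrableOn
    (Eventually.of_forall fun η => h p hp η)
  rw [integral_const_mul] at h2
  calc _ ≤ _ := h2
    _ = _ := by ring

lemma hasDerivAt_fst (ha : 0 < a) (hJ : IsDecaying a J) (hJ' : IsDecaying a J')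
    (hd : ∀ p η, HasDerivAt (fun x => J (x, p.2) η) (J' p η) p.1) {p : ℝ × ℝ} (hp : 0 < p.1) :
    HasDerivAt (fun x => ∫ η in Ioi (0:ℝ), J (x, p.2) η) (∫ η in Ioi (0:ℝ), J' p η) p.1 := by
  obtain ⟨M, hM⟩ := hJ'.exists_uniform_bound ha
  exact (hasDerivAt_integral_of_dominated_loc_of_deriv_le (F := fun x η => J (x, p.2) η)
    (F' := fun x η => J' (x, p.2) η) (bound := fun η => M * (η ^ 2 + a)⁻¹) (Ioi_mem_nhds hp)
    (Eventually.of_forall fun x => (hJ.continuous_right _).aestronglyMeasurable)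
    (hJ.integrable ha hp.le) (hJ'.continuous_right _).aestronglyMeasurable
    (Eventually.of_forall fun η x hx => hM (x, p.2) (le_of_lt hx) η)
    ((integrable_inv_sq_add ha).const_mul M).integrableOn
    (Eventually.of_forall fun η x _ => hd (x, p.2) η)).2

lemma hasDerivAt_snd (ha : 0 < a) (hJ : IsDecaying a J) (hJ' : IsDecaying a J')
    (hd : ∀ p η, HasDerivAt (fun y => J (p.1, y) η) (J' p η) p.2) {p : ℝ × ℝ} (hp : 0 ≤ p.1) :
    HasDerivAt (fun y => ∫ η in Ioi (0:ℝ), J (p.1, y) η) (∫ η in Ioi (0:ℝ), J' p η) p.2 := by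
  obtain ⟨M, hM⟩ := hJ'.exists_uniform_bound ha
  exact (hasDerivAt_integral_of_dominated_loc_of_deriv_le (F := fun y η => J (p.1, y) η)
    (F' := fun y η => J' (p.1, y) η) (bound := fun η => M * (η ^ 2 + a)⁻¹) univ_mem
    (Eventually.of_forall fun x => (hJ.continuous_right _).aestronglyMeasurable)
    (hJ.integrable ha hp) (hJ'.continuous_right _).aestronglyMeasurable
    (Eventually.of_forall fun η y _ => hM (p.1, y) hp η)
    ((integrable_inv_sq_add ha).const_mul M).integrableOn
    (Eventually.of_forall fun η y _ => hd (p.1, y) η)).2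

lemma integrable_prod (ha : 0 < a) (hJ : IsDecaying a J) {g : ℝ × ℝ → ℝ}
    (hg : IntegrableOn g openQuadrant) :
    Integrable (Function.uncurry fun p η => g p * J p η)
      ((volume.restrict openQuadrant).prod (volume.restrict (Ioi (0:ℝ)))) := by
  obtain ⟨M, hM⟩ := hJ.exists_uniform_bound ha
  refine (hg.norm.mul_prod
    (((integrable_inv_sq_add ha).const_mul M).integrableOn (s := Ioi 0))).mono' ?_ ?_
  · exact (hg.1.comp_fst).mul hJ.cont.aestronglyMeasurable
  · rw [Measure.prod_restrict]
    filter_upwards [ae_restrict_mem (measurableSet_openQuadrant.prod measurableSet_Ioi)] with z hz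
    simp only [Function.uncurry, norm_mul]
    exact mul_le_mul_of_nonneg_left (hM z.1 (le_of_lt hz.1.1) z.2) (norm_nonneg _)

/-- Fubini's theorem for a decaying parameter integral against an integrable function. -/
lemma integral_swap (ha : 0 < a) (hJ : IsDecaying a J) {g : ℝ × ℝ → ℝ}
    (hg : IntegrableOn g openQuadrant) :
    ∫ p in openQuadrant, g p * ∫ η in Ioi (0:ℝ), J p η =
      ∫ η in Ioi (0:ℝ), ∫ p in openQuadrant, g p * J p η := by
  simp_rw [← integral_const_mul]
  exact integral_integral_swap (hJ.integrable_prod ha hg)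

lemma integrable_slice (ha : 0 < a) (hJ : IsDecaying a J) {g : ℝ × ℝ → ℝ}
    (hg : IntegrableOn g openQuadrant) :
    IntegrableOn (fun η => ∫ p in openQuadrant, g p * J p η) (Ioi 0) :=
  (hJ.integrable_prod ha hg).integral_prod_right

end IsDecaying

/-! ### The kernel as a cosine integral in one frequency -/

/-- The decay rate in `x` of the mode of frequency `η` in `y`. -/
noncomputable def rate (a c d η : ℝ) : ℝ := √((c * η ^ 2 + d) / (η ^ 2 + a))

section Rate

variable {a c d : ℝ}

lemma rate_sq_mul (ha : 0 < a) (hc : 0 < c) (hd : 0 < d) (η : ℝ) :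
    rate a c d η ^ 2 * (η ^ 2 + a) = c * η ^ 2 + d := by
  rw [rate, Real.sq_sqrt (by positivity)]
  field_simp

lemma rate_pos (ha : 0 < a) (hc : 0 < c) (hd : 0 < d) (η : ℝ) : 0 < rate a c d η :=
  Real.sqrt_pos.2 (by positivity)

lemma continuous_rate (ha : 0 < a) : Continuous (rate a c d) := by
  unfold rate
  refine Real.continuous_sqrt.comp (Continuous.div (by fun_prop) (by fun_prop) fun η => ?_)
  positivity

lemma exists_le_rate (ha : 0 < a) (hc : 0 < c) (hd : 0 < d) :
    ∃ κ > 0, κ ≤ √c ∧ ∀ η, κ ≤ rate a c d η := by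
  refine ⟨√(min c (d / a)), Real.sqrt_pos.2 (by positivity),
    Real.sqrt_le_sqrt (min_le_left _ _), fun η => Real.sqrt_le_sqrt ?_⟩
  rw [le_div_iff₀ (by positivity)]
  have h1 := min_le_left c (d / a)
  have h2 : min c (d / a) * a ≤ d := by
    rw [← le_div_iff₀ ha]; exact min_le_right _ _
  nlinarith [sq_nonneg η]

lemma abs_rate_sub_le (ha : 0 < a) (hc : 0 < c) (hd : 0 < d) (η : ℝ) :
    |rate a c d η - √c| ≤ |d - a * c| / √c * (η ^ 2 + a)⁻¹ := by
  have hp := Real.sqrt_pos.2 hc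
  have hk := rate_pos ha hc hd η
  have hB : 0 < η ^ 2 + a := by positivity
  have h : (rate a c d η - √c) * (rate a c d η + √c) * (η ^ 2 + a) = d - a * c := by
    have := rate_sq_mul ha hc hd η
    have h2 := Real.sq_sqrt hc.le
    calc _ = rate a c d η ^ 2 * (η ^ 2 + a) - √c ^ 2 * (η ^ 2 + a) := by ring
      _ = _ := by rw [this, h2]; ring
  rw [← h, abs_mul, abs_mul, abs_of_pos hB, abs_of_pos (add_pos hk hp), ← div_eq_mul_inv,
    le_div_iff₀ hB, le_div_iff₀ hp]
  have : 0 ≤ |rate a c d η - √c| * (η ^ 2 + a) := by positivity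
  nlinarith

end Rate

/-- The difference of the exponentials with rates `rate a c d η` and `√c`, each divided by its
rate. -/
noncomputable def expDiff₀ (a c d x η : ℝ) : ℝ :=
  Real.exp (-(x * rate a c d η)) / rate a c d η - Real.exp (-(x * √c)) / √c

/-- The difference of the exponentials with rates `rate a c d η` and `√c`. -/
noncomputable def expDiff₁ (a c d x η : ℝ) : ℝ :=
  Real.exp (-(x * rate a c d η)) - Real.exp (-(x * √c))

lemma abs_exp_sub_exp_le {κ k p x : ℝ} (hk : κ ≤ k) (hp : κ ≤ p) (hx : 0 ≤ x) :
    |Real.exp (-(x * k)) - Real.exp (-(x * p))| ≤ x * Real.exp (-(κ * x)) * |k - p| := by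
  have := Convex.norm_image_sub_le_of_norm_hasDerivWithin_le (s := Ici κ)
    (f := fun k : ℝ => Real.exp (-(x * k))) (f' := fun k => Real.exp (-(x * k)) * -x)
    (C := x * Real.exp (-(κ * x))) (fun t _ => ?_) (fun t ht => ?_) (convex_Ici κ) hp hk
  · simpa using this
  · have h : HasDerivAt (fun k : ℝ => -(x * k)) (-x) t := by
      simpa using ((hasDerivAt_id t).const_mul x).fun_neg
    exact h.exp.hasDerivWithinAt
  · rw [norm_mul, norm_neg, Real.norm_eq_abs, Real.norm_eq_abs, abs_of_nonneg hx,
      Real.abs_exp, mul_comm]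
    refine mul_le_mul_of_nonneg_left (Real.exp_le_exp.2 ?_) hx
    have : κ ≤ t := ht
    nlinarith

/-- Both differences decay exponentially in `x` and like `1 / (η² + a)` in the frequency, the latter
because the rate tends to `√c` at that speed. -/
lemma exists_expDiff_bound {a c d : ℝ} (ha : 0 < a) (hc : 0 < c) (hd : 0 < d) :
    ∃ M σ : ℝ, 0 < M ∧ 0 < σ ∧ ∀ x, 0 ≤ x → ∀ η,
      |expDiff₀ a c d x η| ≤ M * Real.exp (-(σ * x)) * (η ^ 2 + a)⁻¹ ∧
      |expDiff₁ a c d x η| ≤ M * Real.exp (-(σ * x)) * (η ^ 2 + a)⁻¹ := by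
  obtain ⟨κ, hκ, hκp, hκk⟩ := exists_le_rate ha hc hd
  have hp := Real.sqrt_pos.2 hc
  set D := |d - a * c| / √c + 1 with hD
  have hDpos : 0 < D := by positivity
  -- half of the decay rate `κ` is spent on absorbing the factor `x` from the mean value theorem
  refine ⟨(3 / κ ^ 2 + 2 / κ) * D, κ / 2, by positivity, by positivity, fun x hx η => ?_⟩
  have hk := rate_pos ha hc hd η
  have hkp : |rate a c d η - √c| ≤ D * (η ^ 2 + a)⁻¹ := by
    refine (abs_rate_sub_le ha hc hd η).trans ?_
    exact mul_le_mul_of_nonneg_right (by rw [hD]; linarith) (by positivity)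
  set E := Real.exp (-(κ / 2 * x)) with hE
  have hEpos : 0 < E := Real.exp_pos _
  have hexp : Real.exp (-(κ * x)) = E * E := by rw [hE, ← Real.exp_add]; congr 1; ring
  have hE1 : E ≤ 1 := Real.exp_le_one_iff.2 (by nlinarith)
  have hxE : x * E ≤ 2 / κ := by
    have h1 : κ / 2 * x ≤ Real.exp (κ / 2 * x) := by
      linarith [Real.add_one_le_exp (κ / 2 * x)]
    have h2 : Real.exp (κ / 2 * x) * E = 1 := by rw [hE, ← Real.exp_add]; simp
    rw [le_div_iff₀ hκ]
    nlinarith [mul_le_mul_of_nonneg_right h1 hEpos.le]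
  have b1 : |expDiff₁ a c d x η| ≤ 2 / κ * E * |rate a c d η - √c| := by
    refine (abs_exp_sub_exp_le (hκk η) hκp hx).trans ?_
    refine mul_le_mul_of_nonneg_right ?_ (abs_nonneg _)
    rw [hexp, ← mul_assoc]
    exact mul_le_mul_of_nonneg_right hxE hEpos.le
  have b0 : |expDiff₀ a c d x η| ≤ 3 / κ ^ 2 * E * |rate a c d η - √c| := by
    have split : expDiff₀ a c d x η = expDiff₁ a c d x η / rate a c d η +
        Real.exp (-(x * √c)) * (√c - rate a c d η) / (rate a c d η * √c) := by
      rw [expDiff₀, expDiff₁]; field_simp; ring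
    rw [split]
    refine (abs_add_le _ _).trans ?_
    have t1 : |expDiff₁ a c d x η / rate a c d η| ≤ 2 / κ ^ 2 * E * |rate a c d η - √c| := by
      rw [abs_div, abs_of_pos hk]
      calc |expDiff₁ a c d x η| / rate a c d η ≤ (2 / κ * E * |rate a c d η - √c|) / κ := by
            have := hκk η
            gcongr
        _ = _ := by field_simp
    have t2 : |Real.exp (-(x * √c)) * (√c - rate a c d η) / (rate a c d η * √c)| ≤
        1 / κ ^ 2 * E * |rate a c d η - √c| := by
      rw [abs_div, abs_mul, Real.abs_exp, abs_of_pos (mul_pos hk hp), abs_sub_comm]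
      have e1 : Real.exp (-(x * √c)) ≤ E := by
        rw [hE]; apply Real.exp_le_exp.2; nlinarith
      calc _ ≤ E * |rate a c d η - √c| / (κ * κ) := by
            have := hκk η
            gcongr
        _ = _ := by field_simp
    calc _ ≤ _ := add_le_add t1 t2
      _ = _ := by ring
  have hpos2 : 0 ≤ E * (D * (η ^ 2 + a)⁻¹) := by positivity
  have q1 : 0 ≤ 3 / κ ^ 2 := by positivity
  have q2 : 0 ≤ 2 / κ := by positivity
  constructor
  · calc _ ≤ 3 / κ ^ 2 * E * (D * (η ^ 2 + a)⁻¹) := b0.trans (by gcongr)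
      _ ≤ _ := by nlinarith [mul_nonneg q2 hpos2]
  · calc _ ≤ 2 / κ * E * (D * (η ^ 2 + a)⁻¹) := b1.trans (by gcongr)
      _ ≤ _ := by nlinarith [mul_nonneg q1 hpos2]

section Integrands

variable (a c d : ℝ)

/-- The integrand of the correction to the leading exponential. -/
noncomputable def corrI (p : ℝ × ℝ) (η : ℝ) : ℝ :=
  Real.cos (p.2 * η) * (expDiff₀ a c d p.1 η / (η ^ 2 + a))

/-- The `x`-derivative of `corrI`. -/
noncomputable def corrIX (p : ℝ × ℝ) (η : ℝ) : ℝ :=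
  -(Real.cos (p.2 * η) * (expDiff₁ a c d p.1 η / (η ^ 2 + a)))

/-- The `y`-derivative of `corrI`. -/
noncomputable def corrIY (p : ℝ × ℝ) (η : ℝ) : ℝ :=
  -(η * Real.sin (p.2 * η) * (expDiff₀ a c d p.1 η / (η ^ 2 + a)))

/-- The mixed derivative of `corrI`. -/
noncomputable def corrIXY (p : ℝ × ℝ) (η : ℝ) : ℝ :=
  η * Real.sin (p.2 * η) * (expDiff₁ a c d p.1 η / (η ^ 2 + a))

end Integrands

section Decaying

variable {a c d : ℝ}

lemma isDecaying_of_factor (ha : 0 < a) {w : ℝ → ℝ → ℝ} {f : ℝ → ℝ → ℝ}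
    (hw : Continuous (Function.uncurry w)) (hf : Continuous (Function.uncurry f))
    (hwb : ∀ y η, |w y η| ≤ 1 + |η|)
    (hfb : ∃ M σ : ℝ, 0 < M ∧ 0 < σ ∧ ∀ x, 0 ≤ x → ∀ η,
      |f x η| ≤ M * Real.exp (-(σ * x)) * (η ^ 2 + a)⁻¹) :
    IsDecaying a (fun p η => w p.2 η * (f p.1 η / (η ^ 2 + a))) where
  cont := by
    have h1 : Continuous fun z : (ℝ × ℝ) × ℝ => w z.1.2 z.2 :=
      hw.comp ((continuous_snd.comp continuous_fst).prodMk continuous_snd)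
    have h2 : Continuous fun z : (ℝ × ℝ) × ℝ => f z.1.1 z.2 :=
      hf.comp ((continuous_fst.comp continuous_fst).prodMk continuous_snd)
    refine h1.mul (h2.div (by fun_prop) fun z => ?_)
    positivity
  bound := by
    obtain ⟨M, σ, hM, hσ, h⟩ := hfb
    refine ⟨(1 + 2 / a) * M, σ, hσ, fun p hp η => ?_⟩
    have hB : 0 < η ^ 2 + a := by positivity
    have h1 : (1 + |η|) ≤ (1 + 2 / a) * (η ^ 2 + a) := by
      have : (1 + 2 / a) * (η ^ 2 + a) = η ^ 2 + a + 2 + 2 / a * η ^ 2 := by field_simp; ring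
      have h3 : 0 ≤ 2 / a * η ^ 2 := by positivity
      rw [this]
      nlinarith [sq_abs η, sq_nonneg (|η| - 1)]
    rw [abs_mul, abs_div, abs_of_pos hB]
    calc |w p.2 η| * (|f p.1 η| / (η ^ 2 + a))
        ≤ ((1 + 2 / a) * (η ^ 2 + a)) *
          ((M * Real.exp (-(σ * p.1)) * (η ^ 2 + a)⁻¹) / (η ^ 2 + a)) := by
          gcongr
          · exact (hwb _ _).trans h1
          · exact h _ hp _
      _ = _ := by field_simp

lemma abs_cos_le_one_add (y η : ℝ) : |Real.cos (y * η)| ≤ 1 + |η| :=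
  (Real.abs_cos_le_one _).trans (by linarith [abs_nonneg η])

lemma abs_mul_sin_le_one_add (y η : ℝ) : |η * Real.sin (y * η)| ≤ 1 + |η| := by
  rw [abs_mul]
  have := mul_le_of_le_one_right (abs_nonneg η) (Real.abs_sin_le_one (y * η))
  linarith

lemma continuous_expDiff₁ (ha : 0 < a) :
    Continuous (Function.uncurry (expDiff₁ a c d)) := by
  have := continuous_rate (c := c) (d := d) ha
  unfold Function.uncurry expDiff₁
  fun_prop

lemma continuous_expDiff₀ (ha : 0 < a) (hc : 0 < c) (hd : 0 < d) :
    Continuous (Function.uncurry (expDiff₀ a c d)) := by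
  have h := continuous_rate (c := c) (d := d) ha
  unfold Function.uncurry expDiff₀
  refine Continuous.sub (Continuous.div (by fun_prop) (by fun_prop) fun z => ?_) (by fun_prop)
  exact (rate_pos ha hc hd _).ne'

lemma isDecaying_corrI (ha : 0 < a) (hc : 0 < c) (hd : 0 < d) :
    IsDecaying a (corrI a c d) := by
  obtain ⟨M, σ, hM, hσ, h⟩ := exists_expDiff_bound ha hc hd
  exact isDecaying_of_factor ha (w := fun y η => Real.cos (y * η))
    (by unfold Function.uncurry; fun_prop) (continuous_expDiff₀ ha hc hd)
    abs_cos_le_one_add ⟨M, σ, hM, hσ, fun x hx η => (h x hx η).1⟩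

lemma isDecaying_corrIXY (ha : 0 < a) (hc : 0 < c) (hd : 0 < d) :
    IsDecaying a (corrIXY a c d) := by
  obtain ⟨M, σ, hM, hσ, h⟩ := exists_expDiff_bound ha hc hd
  exact isDecaying_of_factor ha (w := fun y η => η * Real.sin (y * η))
    (by unfold Function.uncurry; fun_prop) (continuous_expDiff₁ ha)
    abs_mul_sin_le_one_add ⟨M, σ, hM, hσ, fun x hx η => (h x hx η).2⟩

lemma IsDecaying.neg {J : ℝ × ℝ → ℝ → ℝ} (hJ : IsDecaying a J) :
    IsDecaying a (fun p η => -J p η) where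
  cont := hJ.cont.neg
  bound := by simpa only [abs_neg] using hJ.bound

lemma isDecaying_corrIX (ha : 0 < a) (hc : 0 < c) (hd : 0 < d) :
    IsDecaying a (corrIX a c d) := by
  obtain ⟨M, σ, hM, hσ, h⟩ := exists_expDiff_bound ha hc hd
  exact (isDecaying_of_factor ha (w := fun y η => Real.cos (y * η))
    (by unfold Function.uncurry; fun_prop) (continuous_expDiff₁ ha)
    abs_cos_le_one_add ⟨M, σ, hM, hσ, fun x hx η => (h x hx η).2⟩).neg

lemma isDecaying_corrIY (ha : 0 < a) (hc : 0 < c) (hd : 0 < d) :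
    IsDecaying a (corrIY a c d) := by
  obtain ⟨M, σ, hM, hσ, h⟩ := exists_expDiff_bound ha hc hd
  exact (isDecaying_of_factor ha (w := fun y η => η * Real.sin (y * η))
    (by unfold Function.uncurry; fun_prop) (continuous_expDiff₀ ha hc hd)
    abs_mul_sin_le_one_add ⟨M, σ, hM, hσ, fun x hx η => (h x hx η).1⟩).neg

lemma hasDerivAt_exp_neg_mul (k x : ℝ) :
    HasDerivAt (fun x : ℝ => Real.exp (-(x * k))) (-k * Real.exp (-(x * k))) x := by
  have h1 : HasDerivAt (fun x : ℝ => -(x * k)) (-k) x := by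
    simpa using ((hasDerivAt_id x).mul_const k).fun_neg
  exact h1.exp.congr_deriv (by ring)

lemma hasDerivAt_expDiff₀ (ha : 0 < a) (hc : 0 < c) (hd : 0 < d) (x η : ℝ) :
    HasDerivAt (fun x => expDiff₀ a c d x η) (-expDiff₁ a c d x η) x := by
  have h : ∀ k : ℝ, 0 < k →
      HasDerivAt (fun x : ℝ => Real.exp (-(x * k)) / k) (-Real.exp (-(x * k))) x := fun k hk =>
    ((hasDerivAt_exp_neg_mul k x).div_const k).congr_deriv (by field_simp)
  exact ((h _ (rate_pos ha hc hd η)).fun_sub (h _ (Real.sqrt_pos.2 hc))).congr_deriv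
    (by rw [expDiff₁]; ring)

lemma hasDerivAt_corrI_fst (ha : 0 < a) (hc : 0 < c) (hd : 0 < d) (p : ℝ × ℝ) (η : ℝ) :
    HasDerivAt (fun x => corrI a c d (x, p.2) η) (corrIX a c d p η) p.1 :=
  (((hasDerivAt_expDiff₀ ha hc hd p.1 η).div_const (η ^ 2 + a)).const_mul
    (Real.cos (p.2 * η))).congr_deriv (by rw [corrIX]; ring)

lemma hasDerivAt_corrIY_fst (ha : 0 < a) (hc : 0 < c) (hd : 0 < d) (p : ℝ × ℝ) (η : ℝ) :
    HasDerivAt (fun x => corrIY a c d (x, p.2) η) (corrIXY a c d p η) p.1 :=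
  (((hasDerivAt_expDiff₀ ha hc hd p.1 η).div_const (η ^ 2 + a)).const_mul
    (η * Real.sin (p.2 * η))).fun_neg.congr_deriv (by rw [corrIXY]; ring)

lemma hasDerivAt_cos_mul (y η : ℝ) :
    HasDerivAt (fun y => Real.cos (y * η)) (-(η * Real.sin (y * η))) y :=
  ((hasDerivAt_id y).mul_const η).cos.congr_deriv (by simp; ring)

lemma hasDerivAt_corrI_snd (p : ℝ × ℝ) (η : ℝ) :
    HasDerivAt (fun y => corrI a c d (p.1, y) η) (corrIY a c d p η) p.2 :=
  ((hasDerivAt_cos_mul p.2 η).mul_const (expDiff₀ a c d p.1 η / (η ^ 2 + a))).congr_deriv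
    (by rw [corrIY]; ring)

lemma hasDerivAt_corrIX_snd (p : ℝ × ℝ) (η : ℝ) :
    HasDerivAt (fun y => corrIX a c d (p.1, y) η) (corrIXY a c d p η) p.2 :=
  ((hasDerivAt_cos_mul p.2 η).mul_const
    (expDiff₁ a c d p.1 η / (η ^ 2 + a))).fun_neg.congr_deriv (by rw [corrIXY]; ring)

end Decaying

/-! ### The cosine kernel: integrability, symmetry, decay and derivatives -/

section Kernel

variable {a c d : ℝ}

lemma integrableOn_kernelIntegrand (ha : 0 < a) (hc : 0 < c) (hd : 0 < d) (p : ℝ × ℝ) :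
    IntegrableOn (kernelIntegrand a c d p) openQuadrant := by
  -- the denominator is at least `ε (ξ² + c)(η² + a)`
  set ε := min 1 (d / (a * c)) with hε
  have hεpos : 0 < ε := by positivity
  have hε1 : ε ≤ 1 := min_le_left _ _
  have hε2 : ε * (a * c) ≤ d := by
    rw [← le_div_iff₀ (by positivity)]; exact min_le_right _ _
  have hb : IntegrableOn (fun q : ℝ × ℝ => ε⁻¹ * ((q.1 ^ 2 + c)⁻¹ * (q.2 ^ 2 + a)⁻¹))
      openQuadrant := by
    rw [IntegrableOn, restrict_openQuadrant]
    exact ((integrable_inv_sq_add hc).integrableOn.mul_prod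
      (integrable_inv_sq_add ha).integrableOn).const_mul _
  refine hb.mono' (Continuous.aestronglyMeasurable ?_) (Eventually.of_forall fun q => ?_)
  · unfold kernelIntegrand
    refine Continuous.div (by fun_prop) (by fun_prop) fun q => ?_
    positivity
  · rw [kernelIntegrand, norm_div, norm_mul, Real.norm_eq_abs, Real.norm_eq_abs,
      Real.norm_eq_abs, abs_of_pos (a := _ + d) (by positivity)]
    have h1 : |Real.cos (p.1 * q.1)| * |Real.cos (p.2 * q.2)| ≤ 1 :=
      mul_le_one₀ (Real.abs_cos_le_one _) (abs_nonneg _) (Real.abs_cos_le_one _)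
    have h2 : ε * ((q.1 ^ 2 + c) * (q.2 ^ 2 + a)) ≤
        q.1 ^ 2 * q.2 ^ 2 + a * q.1 ^ 2 + c * q.2 ^ 2 + d := by
      have t1 : 0 ≤ q.1 ^ 2 * q.2 ^ 2 := by positivity
      have t2 : 0 ≤ a * q.1 ^ 2 := by positivity
      have t3 : 0 ≤ c * q.2 ^ 2 := by positivity
      nlinarith
    rw [← mul_inv, ← mul_inv, ← one_div]
    exact div_le_div₀ zero_le_one h1 (by positivity) h2

/-- Integrating out the first frequency. -/
lemma kernel_eq_integral_rate (ha : 0 < a) (hc : 0 < c) (hd : 0 < d) {p : ℝ × ℝ}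
    (hp : 0 ≤ p.1) :
    kernel a c d p = 2 / Real.pi * ∫ η in Ioi (0:ℝ), Real.cos (p.2 * η) *
      (Real.exp (-(p.1 * rate a c d η)) / rate a c d η / (η ^ 2 + a)) := by
  have hpi := Real.pi_pos
  rw [kernel, setIntegral_openQuadrant_symm (integrableOn_kernelIntegrand ha hc hd p)]
  have : ∀ η : ℝ, ∫ ξ in Ioi (0:ℝ), kernelIntegrand a c d p (ξ, η) =
      Real.pi / 2 * (Real.cos (p.2 * η) *
      (Real.exp (-(p.1 * rate a c d η)) / rate a c d η / (η ^ 2 + a))) := by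
    intro η
    have hk := rate_pos ha hc hd η
    have hB : 0 < η ^ 2 + a := by positivity
    have e : ∀ ξ : ℝ, kernelIntegrand a c d p (ξ, η) = Real.cos (p.2 * η) / (η ^ 2 + a) *
        (Real.cos (p.1 * ξ) / (ξ ^ 2 + rate a c d η ^ 2)) := by
      intro ξ
      have hD : ξ ^ 2 * η ^ 2 + a * ξ ^ 2 + c * η ^ 2 + d =
          (η ^ 2 + a) * (ξ ^ 2 + rate a c d η ^ 2) := by
        linear_combination -rate_sq_mul ha hc hd η
      simp only [kernelIntegrand, hD]
      rw [div_mul_div_comm, mul_comm (Real.cos (p.2 * η))]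
    simp_rw [e]
    rw [integral_const_mul, integral_cos_div_sq_add_sq hk, abs_of_nonneg hp,
      mul_comm (rate a c d η) p.1]
    field_simp
  simp_rw [this]
  rw [integral_const_mul]
  field_simp
  ring

lemma kernel_swap (a c d : ℝ) (p : ℝ × ℝ) : kernel c a d p.swap = kernel a c d p := by
  rw [kernel, kernel, ← setIntegral_openQuadrant_swap]
  congr 2
  ext q
  simp only [kernelIntegrand, Prod.fst_swap, Prod.snd_swap]
  congr 1 <;> ring

/-- The leading exponential profile `e^{-√c x - √a y}`. -/
noncomputable def leadExp (a c : ℝ) (p : ℝ × ℝ) : ℝ :=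
  Real.exp (-(p.1 * √c)) * Real.exp (-(p.2 * √a))

/-- The correction: on the closed quadrant, the kernel minus its leading exponential term. -/
noncomputable def corr (a c d : ℝ) (p : ℝ × ℝ) : ℝ :=
  2 / Real.pi * ∫ η in Ioi (0:ℝ), corrI a c d p η

/-- The `x`-derivative of `corr`. -/
noncomputable def corrX (a c d : ℝ) (p : ℝ × ℝ) : ℝ :=
  2 / Real.pi * ∫ η in Ioi (0:ℝ), corrIX a c d p η

/-- The `y`-derivative of `corr`. -/
noncomputable def corrY (a c d : ℝ) (p : ℝ × ℝ) : ℝ :=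
  2 / Real.pi * ∫ η in Ioi (0:ℝ), corrIY a c d p η

/-- The mixed derivative of `corr`. -/
noncomputable def corrXY (a c d : ℝ) (p : ℝ × ℝ) : ℝ :=
  2 / Real.pi * ∫ η in Ioi (0:ℝ), corrIXY a c d p η

lemma integral_cos_div_sq_add (ha : 0 < a) {y : ℝ} (hy : 0 ≤ y) :
    ∫ η in Ioi (0:ℝ), Real.cos (y * η) / (η ^ 2 + a) =
      Real.pi / (2 * √a) * Real.exp (-(y * √a)) := by
  have h := integral_cos_div_sq_add_sq (Real.sqrt_pos.2 ha) y
  rwa [Real.sq_sqrt ha.le, abs_of_nonneg hy, mul_comm (√a) y] at h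

lemma integrable_cos_div_sq_add (ha : 0 < a) (y : ℝ) :
    Integrable (fun η : ℝ => Real.cos (y * η) / (η ^ 2 + a)) := by
  refine (integrable_inv_sq_add ha).mono' (Continuous.aestronglyMeasurable ?_)
    (Eventually.of_forall fun η => ?_)
  · refine Continuous.div (by fun_prop) (by fun_prop) fun q => ?_
    positivity
  · have hB : 0 < η ^ 2 + a := by positivity
    rw [norm_div, Real.norm_eq_abs, Real.norm_eq_abs, abs_of_pos hB, div_eq_mul_inv]
    exact mul_le_of_le_one_left (by positivity) (Real.abs_cos_le_one _)

/-- Splitting off the limit `√c` of the rate at high frequency. -/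
lemma kernel_eq_lead_add_corr (ha : 0 < a) (hc : 0 < c) (hd : 0 < d) {p : ℝ × ℝ}
    (hp : p ∈ closedQuadrant) :
    kernel a c d p = leadExp a c p / (√c * √a) + corr a c d p := by
  have hpi := Real.pi_pos
  rw [kernel_eq_integral_rate ha hc hd hp.1, corr]
  have e : ∀ η : ℝ, Real.cos (p.2 * η) *
      (Real.exp (-(p.1 * rate a c d η)) / rate a c d η / (η ^ 2 + a)) =
      Real.exp (-(p.1 * √c)) / √c * (Real.cos (p.2 * η) / (η ^ 2 + a)) + corrI a c d p η := by
    intro η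
    rw [corrI, expDiff₀]
    ring
  simp_rw [e]
  rw [integral_add ((integrable_cos_div_sq_add ha p.2).integrableOn.const_mul _)
    ((isDecaying_corrI ha hc hd).integrable ha hp.1), integral_const_mul,
    integral_cos_div_sq_add ha hp.2, leadExp]
  field_simp

lemma corr_swap (ha : 0 < a) (hc : 0 < c) (hd : 0 < d) {p : ℝ × ℝ} (hp : p ∈ closedQuadrant) :
    corr a c d p = corr c a d p.swap := by
  have h1 := kernel_eq_lead_add_corr ha hc hd hp
  have h2 := kernel_eq_lead_add_corr hc ha hd (p := p.swap) ⟨hp.2, hp.1⟩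
  rw [kernel_swap, h1] at h2
  simp only [leadExp, Prod.fst_swap, Prod.snd_swap] at h2
  rw [mul_comm (Real.exp (-(p.2 * √a))), mul_comm (√a)] at h2
  linarith

lemma hasDerivAt_corr_fst (ha : 0 < a) (hc : 0 < c) (hd : 0 < d) {p : ℝ × ℝ} (hp : 0 < p.1) :
    HasDerivAt (fun x => corr a c d (x, p.2)) (corrX a c d p) p.1 :=
  ((isDecaying_corrI ha hc hd).hasDerivAt_fst ha (isDecaying_corrIX ha hc hd)
    (hasDerivAt_corrI_fst ha hc hd) hp).const_mul _

lemma hasDerivAt_corrY_fst (ha : 0 < a) (hc : 0 < c) (hd : 0 < d) {p : ℝ × ℝ} (hp : 0 < p.1) :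
    HasDerivAt (fun x => corrY a c d (x, p.2)) (corrXY a c d p) p.1 :=
  ((isDecaying_corrIY ha hc hd).hasDerivAt_fst ha (isDecaying_corrIXY ha hc hd)
    (hasDerivAt_corrIY_fst ha hc hd) hp).const_mul _

lemma hasDerivAt_corr_snd (ha : 0 < a) (hc : 0 < c) (hd : 0 < d) {p : ℝ × ℝ} (hp : 0 ≤ p.1) :
    HasDerivAt (fun y => corr a c d (p.1, y)) (corrY a c d p) p.2 :=
  ((isDecaying_corrI ha hc hd).hasDerivAt_snd ha (isDecaying_corrIY ha hc hd)
    hasDerivAt_corrI_snd hp).const_mul _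

lemma hasDerivAt_corrX_snd (ha : 0 < a) (hc : 0 < c) (hd : 0 < d) {p : ℝ × ℝ} (hp : 0 ≤ p.1) :
    HasDerivAt (fun y => corrX a c d (p.1, y)) (corrXY a c d p) p.2 :=
  ((isDecaying_corrIX ha hc hd).hasDerivAt_snd ha (isDecaying_corrIXY ha hc hd)
    hasDerivAt_corrIX_snd hp).const_mul _

lemma openQuadrant_subset_closedQuadrant : openQuadrant ⊆ closedQuadrant :=
  prod_mono Ioi_subset_Ici_self Ioi_subset_Ici_self

/-- The symmetry of the kernel passes to the derivatives of the correction, although the variables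
enter the defining integrals asymmetrically. -/
lemma corrX_swap (ha : 0 < a) (hc : 0 < c) (hd : 0 < d) {p : ℝ × ℝ} (hp : p ∈ openQuadrant) :
    corrX a c d p = corrY c a d p.swap := by
  have h1 := hasDerivAt_corr_fst ha hc hd hp.1
  have h2 := hasDerivAt_corr_snd hc ha hd (p := p.swap) (le_of_lt hp.2)
  refine h1.unique (h2.congr_of_eventuallyEq ?_)
  filter_upwards [Ioi_mem_nhds hp.1] with x hx
  exact corr_swap ha hc hd (p := (x, p.2))
    (openQuadrant_subset_closedQuadrant ⟨hx, hp.2⟩)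

lemma corrY_swap (ha : 0 < a) (hc : 0 < c) (hd : 0 < d) {p : ℝ × ℝ} (hp : p ∈ openQuadrant) :
    corrY a c d p = corrX c a d p.swap :=
  (corrX_swap hc ha hd (p := p.swap) ⟨hp.2, hp.1⟩).symm

lemma corrXY_swap (ha : 0 < a) (hc : 0 < c) (hd : 0 < d) {p : ℝ × ℝ} (hp : p ∈ openQuadrant) :
    corrXY a c d p = corrXY c a d p.swap := by
  have h1 := hasDerivAt_corrX_snd ha hc hd (le_of_lt hp.1)
  have h2 := hasDerivAt_corrY_fst hc ha hd (p := p.swap) hp.2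
  refine h1.unique (h2.congr_of_eventuallyEq ?_)
  filter_upwards [Ioi_mem_nhds hp.2] with y hy
  exact corrX_swap ha hc hd (p := (p.1, y)) ⟨hp.1, hy⟩

/-- Exponential decay in each variable separately suffices for square integrability, by taking
the geometric mean of the two bounds. -/
lemma inL2_of_decay {f : ℝ × ℝ → ℝ} (hf : ContinuousOn f openQuadrant)
    (h1 : ∃ M σ : ℝ, 0 < σ ∧ ∀ p ∈ openQuadrant, |f p| ≤ M * Real.exp (-(σ * p.1)))
    (h2 : ∃ M σ : ℝ, 0 < σ ∧ ∀ p ∈ openQuadrant, |f p| ≤ M * Real.exp (-(σ * p.2))) :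
    InL2 f := by
  obtain ⟨M, σ, hσ, h⟩ := h1
  obtain ⟨M', σ', hσ', h'⟩ := h2
  have hm : AEStronglyMeasurable f (volume.restrict openQuadrant) :=
    hf.aestronglyMeasurable measurableSet_openQuadrant
  have hexp : ∀ s : ℝ, 0 < s → IntegrableOn (fun x : ℝ => Real.exp (-(s * x))) (Ioi 0) := by
    intro s hs
    simpa only [neg_mul] using exp_neg_integrableOn_Ioi 0 hs
  have hb : IntegrableOn (fun p : ℝ × ℝ => (M * M') *
      (Real.exp (-(σ * p.1)) * Real.exp (-(σ' * p.2)))) openQuadrant := by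
    rw [IntegrableOn, restrict_openQuadrant]
    exact ((hexp σ hσ).mul_prod (hexp σ' hσ')).const_mul _
  rw [InL2, memLp_two_iff_integrable_sq hm]
  refine hb.mono' (hm.pow 2) ?_
  filter_upwards [ae_restrict_mem measurableSet_openQuadrant] with p hp
  rw [norm_pow, Real.norm_eq_abs, sq]
  calc |f p| * |f p| ≤ (M * Real.exp (-(σ * p.1))) * (M' * Real.exp (-(σ' * p.2))) :=
        mul_le_mul (h p hp) (h' p hp) (abs_nonneg _) ((abs_nonneg _).trans (h p hp))
    _ = _ := by ring

lemma inL2_leadExp (ha : 0 < a) (hc : 0 < c) : InL2 (leadExp a c) := by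
  have hp := Real.sqrt_pos.2 hc
  have hr := Real.sqrt_pos.2 ha
  refine inL2_of_decay (by unfold leadExp; fun_prop) ⟨1, √c, hp, fun p hq => ?_⟩
    ⟨1, √a, hr, fun p hq => ?_⟩
  · rw [leadExp, abs_mul, Real.abs_exp, Real.abs_exp, one_mul, mul_comm p.1]
    refine mul_le_of_le_one_right (Real.exp_pos _).le (Real.exp_le_one_iff.2 ?_)
    have : 0 < p.2 := hq.2
    nlinarith
  · rw [leadExp, abs_mul, Real.abs_exp, Real.abs_exp, one_mul, mul_comm p.2]
    refine mul_le_of_le_one_left (Real.exp_pos _).le (Real.exp_le_one_iff.2 ?_)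
    have : 0 < p.1 := hq.1
    nlinarith

lemma IsDecaying.continuousOn_openQuadrant {J : ℝ × ℝ → ℝ → ℝ} (ha : 0 < a)
    (hJ : IsDecaying a J) :
    ContinuousOn (fun p => 2 / Real.pi * ∫ η in Ioi (0:ℝ), J p η) openQuadrant :=
  ((hJ.continuousOn ha).mono fun _ hp => le_of_lt (mem_Ioi.1 hp.1)).const_mul _

lemma IsDecaying.exists_bound {J : ℝ × ℝ → ℝ → ℝ} (ha : 0 < a) (hJ : IsDecaying a J) :
    ∃ M σ : ℝ, 0 < σ ∧ ∀ p ∈ openQuadrant,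
      |2 / Real.pi * ∫ η in Ioi (0:ℝ), J p η| ≤ M * Real.exp (-(σ * p.1)) := by
  obtain ⟨M, σ, hσ, h⟩ := hJ.exists_abs_integral_le ha
  have hpi := Real.pi_pos
  refine ⟨2 / Real.pi * M, σ, hσ, fun p hp => ?_⟩
  rw [abs_mul, abs_of_pos (by positivity : 0 < 2 / Real.pi), mul_assoc]
  exact mul_le_mul_of_nonneg_left (h p (le_of_lt hp.1)) (by positivity)

lemma exists_bound_swap {f g : ℝ × ℝ → ℝ} (hfg : ∀ p ∈ openQuadrant, f p = g p.swap)
    (h : ∃ M σ : ℝ, 0 < σ ∧ ∀ p ∈ openQuadrant, |g p| ≤ M * Real.exp (-(σ * p.1))) :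
    ∃ M σ : ℝ, 0 < σ ∧ ∀ p ∈ openQuadrant, |f p| ≤ M * Real.exp (-(σ * p.2)) := by
  obtain ⟨M, σ, hσ, h⟩ := h
  refine ⟨M, σ, hσ, fun p hp => ?_⟩
  rw [hfg p hp]
  exact h p.swap ⟨hp.2, hp.1⟩

lemma inL2_corr (ha : 0 < a) (hc : 0 < c) (hd : 0 < d) : InL2 (corr a c d) :=
  inL2_of_decay ((isDecaying_corrI ha hc hd).continuousOn_openQuadrant ha)
    ((isDecaying_corrI ha hc hd).exists_bound ha)
    (exists_bound_swap (fun _ hp => corr_swap ha hc hd (openQuadrant_subset_closedQuadrant hp))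
      ((isDecaying_corrI hc ha hd).exists_bound hc))

lemma inL2_corrX (ha : 0 < a) (hc : 0 < c) (hd : 0 < d) : InL2 (corrX a c d) :=
  inL2_of_decay ((isDecaying_corrIX ha hc hd).continuousOn_openQuadrant ha)
    ((isDecaying_corrIX ha hc hd).exists_bound ha)
    (exists_bound_swap (fun _ hp => corrX_swap ha hc hd hp)
      ((isDecaying_corrIY hc ha hd).exists_bound hc))

lemma inL2_corrY (ha : 0 < a) (hc : 0 < c) (hd : 0 < d) : InL2 (corrY a c d) :=
  inL2_of_decay ((isDecaying_corrIY ha hc hd).continuousOn_openQuadrant ha)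
    ((isDecaying_corrIY ha hc hd).exists_bound ha)
    (exists_bound_swap (fun _ hp => corrY_swap ha hc hd hp)
      ((isDecaying_corrIX hc ha hd).exists_bound hc))

lemma inL2_corrXY (ha : 0 < a) (hc : 0 < c) (hd : 0 < d) : InL2 (corrXY a c d) :=
  inL2_of_decay ((isDecaying_corrIXY ha hc hd).continuousOn_openQuadrant ha)
    ((isDecaying_corrIXY ha hc hd).exists_bound ha)
    (exists_bound_swap (fun _ hp => corrXY_swap ha hc hd hp)
      ((isDecaying_corrIXY hc ha hd).exists_bound hc))

/-- Leading exponential plus correction, which is the kernel on the closed quadrant. -/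
noncomputable def ker (a c d : ℝ) (p : ℝ × ℝ) : ℝ := leadExp a c p / (√c * √a) + corr a c d p

/-- The `x`-derivative of `ker`. -/
noncomputable def kerX (a c d : ℝ) (p : ℝ × ℝ) : ℝ := -(leadExp a c p / √a) + corrX a c d p

/-- The `y`-derivative of `ker`. -/
noncomputable def kerY (a c d : ℝ) (p : ℝ × ℝ) : ℝ := -(leadExp a c p / √c) + corrY a c d p

/-- The mixed derivative of `ker`. -/
noncomputable def kerXY (a c d : ℝ) (p : ℝ × ℝ) : ℝ := leadExp a c p + corrXY a c d p

lemma inL2_ker (ha : 0 < a) (hc : 0 < c) (hd : 0 < d) : InL2 (ker a c d) := by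
  refine MemLp.add ?_ (inL2_corr ha hc hd)
  simpa only [div_eq_inv_mul] using (inL2_leadExp ha hc).const_mul (√c * √a)⁻¹

lemma inL2_kerX (ha : 0 < a) (hc : 0 < c) (hd : 0 < d) : InL2 (kerX a c d) := by
  refine MemLp.add (MemLp.neg (f := fun p => leadExp a c p / √a) ?_) (inL2_corrX ha hc hd)
  simpa only [div_eq_inv_mul] using (inL2_leadExp ha hc).const_mul (√a)⁻¹

lemma inL2_kerY (ha : 0 < a) (hc : 0 < c) (hd : 0 < d) : InL2 (kerY a c d) := by
  refine MemLp.add (MemLp.neg (f := fun p => leadExp a c p / √c) ?_) (inL2_corrY ha hc hd)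
  simpa only [div_eq_inv_mul] using (inL2_leadExp ha hc).const_mul (√c)⁻¹

lemma inL2_kerXY (ha : 0 < a) (hc : 0 < c) (hd : 0 < d) : InL2 (kerXY a c d) :=
  MemLp.add (inL2_leadExp ha hc) (inL2_corrXY ha hc hd)

lemma continuous_leadExp (a c : ℝ) : Continuous (leadExp a c) := by unfold leadExp; fun_prop

lemma continuousOn_ker (ha : 0 < a) (hc : 0 < c) (hd : 0 < d) :
    ContinuousOn (ker a c d) closedQuadrant :=
  ((continuous_leadExp a c).div_const _).continuousOn.add
    ((((isDecaying_corrI ha hc hd).continuousOn ha).mono fun _ hp => hp.1).const_mul _)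

lemma continuousOn_kerX (ha : 0 < a) (hc : 0 < c) (hd : 0 < d) :
    ContinuousOn (kerX a c d) openQuadrant :=
  ((continuous_leadExp a c).div_const _).neg.continuousOn.add
    ((isDecaying_corrIX ha hc hd).continuousOn_openQuadrant ha)

lemma continuousOn_kerY (ha : 0 < a) (hc : 0 < c) (hd : 0 < d) :
    ContinuousOn (kerY a c d) openQuadrant :=
  ((continuous_leadExp a c).div_const _).neg.continuousOn.add
    ((isDecaying_corrIY ha hc hd).continuousOn_openQuadrant ha)

lemma continuousOn_kerXY (ha : 0 < a) (hc : 0 < c) (hd : 0 < d) :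
    ContinuousOn (kerXY a c d) openQuadrant :=
  (continuous_leadExp a c).continuousOn.add
    ((isDecaying_corrIXY ha hc hd).continuousOn_openQuadrant ha)

lemma hasDerivAt_leadExp_fst (a c : ℝ) (p : ℝ × ℝ) :
    HasDerivAt (fun x => leadExp a c (x, p.2)) (-√c * leadExp a c p) p.1 :=
  ((hasDerivAt_exp_neg_mul (√c) p.1).mul_const (Real.exp (-(p.2 * √a)))).congr_deriv
    (by rw [leadExp]; ring)

lemma hasDerivAt_leadExp_snd (a c : ℝ) (p : ℝ × ℝ) :
    HasDerivAt (fun y => leadExp a c (p.1, y)) (-√a * leadExp a c p) p.2 :=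
  ((hasDerivAt_exp_neg_mul (√a) p.2).const_mul (Real.exp (-(p.1 * √c)))).congr_deriv
    (by rw [leadExp]; ring)

lemma hasDerivAt_ker_fst (ha : 0 < a) (hc : 0 < c) (hd : 0 < d) {p : ℝ × ℝ} (hp : 0 < p.1) :
    HasDerivAt (fun x => ker a c d (x, p.2)) (kerX a c d p) p.1 := by
  have := Real.sqrt_pos.2 hc
  have := Real.sqrt_pos.2 ha
  exact (((hasDerivAt_leadExp_fst a c p).div_const _).fun_add
    (hasDerivAt_corr_fst ha hc hd hp)).congr_deriv (by rw [kerX]; field_simp)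

lemma hasDerivAt_ker_snd (ha : 0 < a) (hc : 0 < c) (hd : 0 < d) {p : ℝ × ℝ} (hp : 0 < p.1) :
    HasDerivAt (fun y => ker a c d (p.1, y)) (kerY a c d p) p.2 := by
  have := Real.sqrt_pos.2 hc
  have := Real.sqrt_pos.2 ha
  exact (((hasDerivAt_leadExp_snd a c p).div_const _).fun_add
    (hasDerivAt_corr_snd ha hc hd hp.le)).congr_deriv (by rw [kerY]; field_simp)

lemma hasDerivAt_kerX_snd (ha : 0 < a) (hc : 0 < c) (hd : 0 < d) {p : ℝ × ℝ} (hp : 0 < p.1) :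
    HasDerivAt (fun y => kerX a c d (p.1, y)) (kerXY a c d p) p.2 := by
  have := Real.sqrt_pos.2 ha
  exact (((hasDerivAt_leadExp_snd a c p).div_const _).fun_neg.fun_add
    (hasDerivAt_corrX_snd ha hc hd hp.le)).congr_deriv (by rw [kerXY]; field_simp)

end Kernel

/-! ### Classical derivatives are weak derivatives -/

section Classical

variable {u g : ℝ × ℝ → ℝ} {φ : ℝ × ℝ → ℝ}

lemma integrableOn_mul_of_support {w : ℝ × ℝ → ℝ} (hu : ContinuousOn u openQuadrant)
    (hw : Continuous w) (hwc : HasCompactSupport w) (hws : tsupport w ⊆ openQuadrant) :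
    IntegrableOn (fun p => u p * w p) openQuadrant := by
  have h1 : IntegrableOn (fun p => u p * w p) (tsupport w) :=
    ((hu.mono hws).mul hw.continuousOn).integrableOn_compact hwc.isCompact
  refine Integrable.integrableOn ?_
  refine (integrableOn_iff_integrable_of_support_subset fun p hp => ?_).1 h1
  exact subset_tsupport _ (right_ne_zero_of_mul hp)

lemma IsTestFunction.hasDerivAt_fst (hφ : IsTestFunction φ) (x y : ℝ) :
    HasDerivAt (fun x => φ (x, y)) (partialX φ (x, y)) x := by
  have h1 := ((hφ.1.differentiable (by simp)) (x, y)).hasFDerivAt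
  have h2 : HasDerivAt (fun x : ℝ => (x, y)) ((1 : ℝ), (0 : ℝ)) x :=
    (hasDerivAt_id x).prodMk (hasDerivAt_const x y)
  exact h1.comp_hasDerivAt x h2

lemma isTestFunction_fderiv_apply (hφ : IsTestFunction φ) (e : ℝ × ℝ) :
    IsTestFunction (fun p => fderiv ℝ φ p e) := by
  refine ⟨(hφ.1.fderiv_right (by simp)).clm_apply contDiff_const, ?_, ?_⟩
  · exact hφ.2.1.fderiv_apply (𝕜 := ℝ) e
  · exact (tsupport_fderiv_apply_subset ℝ e).trans hφ.2.2

lemma IsTestFunction.partialX (hφ : IsTestFunction φ) : IsTestFunction (partialX φ) :=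
  isTestFunction_fderiv_apply hφ _

lemma IsTestFunction.partialY (hφ : IsTestFunction φ) : IsTestFunction (partialY φ) :=
  isTestFunction_fderiv_apply hφ _

lemma IsTestFunction.integrableOn_mul (hφ : IsTestFunction φ) (hu : ContinuousOn u openQuadrant) :
    IntegrableOn (fun p => u p * φ p) openQuadrant :=
  integrableOn_mul_of_support hu hφ.1.continuous hφ.2.1 hφ.2.2

lemma integral_mul_partialX (hu : ContinuousOn u openQuadrant) (hg : ContinuousOn g openQuadrant)
    (hd : ∀ p ∈ openQuadrant, HasDerivAt (fun x => u (x, p.2)) (g p) p.1)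
    (hφ : IsTestFunction φ) :
    ∫ p in openQuadrant, u p * partialX φ p = -∫ p in openQuadrant, g p * φ p := by
  have i1 := hφ.partialX.integrableOn_mul hu
  have i2 := hφ.integrableOn_mul hg
  rw [eq_neg_iff_add_eq_zero, ← integral_add i1 i2]
  have i3 : IntegrableOn (fun p => u p * partialX φ p + g p * φ p) openQuadrant := i1.add i2
  rw [setIntegral_openQuadrant_symm i3]
  have i4 := i3
  rw [IntegrableOn, restrict_openQuadrant] at i4
  refine integral_eq_zero_of_ae ?_
  filter_upwards [i4.prod_left_ae, ae_restrict_mem measurableSet_Ioi] with y hy hy0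
  have h0 : ∀ᶠ x in 𝓝 (0:ℝ), φ (x, y) = 0 := by
    have : ((0:ℝ), y) ∉ tsupport φ := fun h => lt_irrefl (0:ℝ) (hφ.2.2 h).1
    have h1 := (isClosed_tsupport φ).isOpen_compl.mem_nhds this
    have h2 : Tendsto (fun x : ℝ => (x, y)) (𝓝 0) (𝓝 (0, y)) :=
      (Continuous.prodMk_left y).tendsto 0
    filter_upwards [h2 h1] with x hx using image_eq_zero_of_notMem_tsupport hx
  have hinf : ∀ᶠ x in atTop, φ (x, y) = 0 := by
    obtain ⟨R, hR⟩ := (hφ.2.1.isCompact.isBounded).subset_closedBall 0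
    filter_upwards [Ioi_mem_atTop R] with x hx
    refine image_eq_zero_of_notMem_tsupport fun h => ?_
    have h2 := hR h
    rw [mem_closedBall_zero_iff] at h2
    have h3 : |x| ≤ ‖((x, y) : ℝ × ℝ)‖ := norm_fst_le (x, y)
    linarith [le_abs_self x, mem_Ioi.1 hx]
  have key := integral_Ioi_of_hasDerivAt_of_tendsto (a := (0:ℝ)) (m := 0)
    (f := fun x => u (x, y) * φ (x, y))
    (f' := fun x => u (x, y) * partialX φ (x, y) + g (x, y) * φ (x, y)) ?_ ?_ hy ?_
  · refine key.trans ?_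
    have : φ (0, y) = 0 := h0.self_of_nhds
    simp [this]
  · refine ContinuousAt.continuousWithinAt ?_
    have : (fun x => u (x, y) * φ (x, y)) =ᶠ[𝓝 0] fun _ => 0 := by
      filter_upwards [h0] with x hx using by rw [hx, mul_zero]
    exact continuousAt_const.congr this.symm
  · intro x hx
    exact ((hd (x, y) ⟨hx, hy0⟩).mul (hφ.hasDerivAt_fst x y)).congr_deriv (by simp only; ring)
  · refine tendsto_const_nhds.congr' ?_
    filter_upwards [hinf] with x hx using by rw [hx, mul_zero]

lemma IsTestFunction.swap (hφ : IsTestFunction φ) : IsTestFunction (fun p => φ p.swap) := by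
  have hsw : ContDiff ℝ ∞ (Prod.swap : ℝ × ℝ → ℝ × ℝ) := contDiff_snd.prodMk contDiff_fst
  refine ⟨hφ.1.comp hsw, hφ.2.1.comp_homeomorph (Homeomorph.prodComm ℝ ℝ), ?_⟩
  intro p hp
  have h1 : p.swap ∈ tsupport φ :=
    tsupport_comp_subset_preimage φ (f := (Prod.swap : ℝ × ℝ → ℝ × ℝ)) continuous_swap hp
  exact ⟨(hφ.2.2 h1).2, (hφ.2.2 h1).1⟩

lemma IsTestFunction.partialX_swap (hφ : IsTestFunction φ) (p : ℝ × ℝ) :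
    EkelandNirenberg.partialX (fun p => φ p.swap) p = EkelandNirenberg.partialY φ p.swap := by
  have h1 := ((hφ.1.differentiable (by simp)) p.swap).hasFDerivAt
  have h2 : HasFDerivAt (Prod.swap : ℝ × ℝ → ℝ × ℝ)
      ((ContinuousLinearMap.snd ℝ ℝ ℝ).prod (ContinuousLinearMap.fst ℝ ℝ ℝ)) p :=
    hasFDerivAt_snd.prodMk hasFDerivAt_fst
  have h3 := (h1.comp p h2).fderiv
  simp only [EkelandNirenberg.partialX, EkelandNirenberg.partialY]
  have h4 : (fun p : ℝ × ℝ => φ p.swap) = φ ∘ Prod.swap := rfl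
  rw [h4, h3]
  simp

lemma integral_mul_partialY (hu : ContinuousOn u openQuadrant) (hg : ContinuousOn g openQuadrant)
    (hd : ∀ p ∈ openQuadrant, HasDerivAt (fun y => u (p.1, y)) (g p) p.2)
    (hφ : IsTestFunction φ) :
    ∫ p in openQuadrant, u p * partialY φ p = -∫ p in openQuadrant, g p * φ p := by
  have hmaps : MapsTo Prod.swap openQuadrant openQuadrant := fun p hp => ⟨hp.2, hp.1⟩
  have := integral_mul_partialX (u := fun p => u p.swap) (g := fun p => g p.swap)
    (hu.comp continuous_swap.continuousOn hmaps) (hg.comp continuous_swap.continuousOn hmaps)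
    (fun p hp => hd p.swap (hmaps hp)) hφ.swap
  simp_rw [hφ.partialX_swap] at this
  rwa [setIntegral_openQuadrant_swap (fun p => u p * partialY φ p),
    setIntegral_openQuadrant_swap (fun p => g p * φ p)] at this

lemma InL2.locallyIntegrableOn (hg : InL2 g) : LocallyIntegrableOn g openQuadrant :=
  locallyIntegrableOn_of_locallyIntegrable_restrict (hg.locallyIntegrable (by norm_num))

end Classical

lemma isWeakRep_ker {a c d : ℝ} (ha : 0 < a) (hc : 0 < c) (hd : 0 < d) :
    IsWeakRep (ker a c d) (kerX a c d) (kerY a c d) (kerXY a c d) where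
  memL2 := inL2_ker ha hc hd
  memL2_x := inL2_kerX ha hc hd
  memL2_y := inL2_kerY ha hc hd
  memL2_xy := inL2_kerXY ha hc hd
  weak_x := ⟨(inL2_kerX ha hc hd).locallyIntegrableOn, fun _ hφ => integral_mul_partialX
    ((continuousOn_ker ha hc hd).mono openQuadrant_subset_closedQuadrant)
    (continuousOn_kerX ha hc hd) (fun _ hp => hasDerivAt_ker_fst ha hc hd hp.1) hφ⟩
  weak_y := ⟨(inL2_kerY ha hc hd).locallyIntegrableOn, fun _ hφ => integral_mul_partialY
    ((continuousOn_ker ha hc hd).mono openQuadrant_subset_closedQuadrant)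
    (continuousOn_kerY ha hc hd) (fun _ hp => hasDerivAt_ker_snd ha hc hd hp.1) hφ⟩
  weak_xy := ⟨(inL2_kerXY ha hc hd).locallyIntegrableOn, fun _ hφ => by
    rw [integral_mul_partialX
      ((continuousOn_ker ha hc hd).mono openQuadrant_subset_closedQuadrant)
      (continuousOn_kerX ha hc hd) (fun _ hp => hasDerivAt_ker_fst ha hc hd hp.1) hφ.partialY,
      integral_mul_partialY (continuousOn_kerX ha hc hd) (continuousOn_kerXY ha hc hd)
      (fun _ hp => hasDerivAt_kerX_snd ha hc hd hp.1) hφ, neg_neg]⟩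

/-! ### The reproducing property -/

section Reproducing

variable {a c d : ℝ} {v g₁ g₂ g₁₂ : ℝ × ℝ → ℝ}

lemma integrableOn_mul_bdd {g w : ℝ × ℝ → ℝ} (hg : IntegrableOn g openQuadrant)
    (hw : Continuous w) {C : ℝ} (hC : ∀ p ∈ openQuadrant, |w p| ≤ C) :
    IntegrableOn (fun p => g p * w p) openQuadrant := by
  refine Integrable.mul_bdd hg (c := C) hw.aestronglyMeasurable ?_
  filter_upwards [ae_restrict_mem measurableSet_openQuadrant] with p hp using hC p hp

/-- An integrable function times an exponential mode `e^{-kx} m w(yη)` with bounded `w`. -/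
lemma integrableOn_mul_mode {g : ℝ × ℝ → ℝ} (hg : IntegrableOn g openQuadrant) {k C : ℝ}
    (hk : 0 < k) (m : ℝ) {w : ℝ → ℝ} (hw : Continuous w) (hC : ∀ y, |w y| ≤ C) :
    IntegrableOn (fun p => g p * (Real.exp (-(p.1 * k)) / m * w p.2)) openQuadrant := by
  refine integrableOn_mul_bdd hg (C := 1 / |m| * C) (by fun_prop) fun p hp => ?_
  rw [abs_mul, abs_div, Real.abs_exp]
  have h1 : Real.exp (-(p.1 * k)) ≤ 1 := by
    refine Real.exp_le_one_iff.2 ?_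
    have : 0 < p.1 := hp.1
    nlinarith
  exact mul_le_mul (div_le_div_of_nonneg_right h1 (abs_nonneg _)) (hC _) (abs_nonneg _)
    (by positivity)

/-- The bilinear form of the energy, for the correction at one frequency against corner data. The
traces on `x = 0` of the two exponential modes cancel in the difference, and the mode with rate `√c`
contributes the defect `a c - d` of its dispersion relation. -/
lemma IsCornerRep.form_corrI (hr : IsCornerRep v g₁ g₂ g₁₂) (ha : 0 < a) (hc : 0 < c)
    (hd : 0 < d) (η : ℝ) :
    (∫ z in openQuadrant, g₁₂ z * corrIXY a c d z η) +
      a * (∫ z in openQuadrant, g₁ z * corrIX a c d z η) +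
      c * (∫ z in openQuadrant, g₂ z * corrIY a c d z η) +
      d * (∫ z in openQuadrant, v z * corrI a c d z η) =
    (a * c - d) * ∫ z in openQuadrant, v z *
      (Real.cos (z.2 * η) * (Real.exp (-(z.1 * √c)) / √c / (η ^ 2 + a))) := by
  have hk := rate_pos ha hc hd η
  have hp := Real.sqrt_pos.2 hc
  have hB : 0 < η ^ 2 + a := by positivity
  have hcos : ∀ y, |Real.cos (y * η)| ≤ 1 := fun y => Real.abs_cos_le_one _
  have hsin : ∀ y, |η * Real.sin (y * η)| ≤ 1 + |η| := fun y => abs_mul_sin_le_one_add y η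
  have cc : Continuous fun y : ℝ => Real.cos (y * η) := by fun_prop
  have cs : Continuous fun y : ℝ => η * Real.sin (y * η) := by fun_prop
  have fk := hr.form_exp_cos a c d η hk
  have fp := hr.form_exp_cos a c d η hp
  rw [rate_sq_mul ha hc hd, sub_self, zero_mul, zero_add] at fk
  rw [Real.sq_sqrt hc.le] at fp
  have diff : ∀ (g : ℝ × ℝ → ℝ) (w : ℝ → ℝ) (m n C : ℝ), IntegrableOn g openQuadrant →
      Continuous w → (∀ y, |w y| ≤ C) →
      ∫ z in openQuadrant, g z * (w z.2 * ((Real.exp (-(z.1 * rate a c d η)) / m -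
        Real.exp (-(z.1 * √c)) / n) / (η ^ 2 + a))) =
      ((∫ z in openQuadrant, g z * (Real.exp (-(z.1 * rate a c d η)) / m * w z.2)) -
        ∫ z in openQuadrant, g z * (Real.exp (-(z.1 * √c)) / n * w z.2)) / (η ^ 2 + a) := by
    intro g w m n C hg hw hC
    rw [← integral_sub (integrableOn_mul_mode hg hk m hw hC)
      (integrableOn_mul_mode hg hp n hw hC), ← integral_div]
    congr 1; ext z; ring
  have d1 := diff g₁₂ _ 1 1 _ hr.int_xy cs hsin
  have d2 := diff g₁ _ 1 1 _ hr.int_x cc hcos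
  have d3 := diff g₂ _ (rate a c d η) (√c) _ hr.int_y cs hsin
  have d4 := diff v _ (rate a c d η) (√c) _ hr.int cc hcos
  simp only [div_one] at d1 d2
  have e4 : ∫ z in openQuadrant, v z *
      (Real.cos (z.2 * η) * (Real.exp (-(z.1 * √c)) / √c / (η ^ 2 + a))) =
      (∫ z in openQuadrant, v z * (Real.exp (-(z.1 * √c)) / √c * Real.cos (z.2 * η))) /
        (η ^ 2 + a) := by
    rw [← integral_div]; congr 1; ext z; ring
  simp only [corrIXY, corrIX, corrIY, corrI, expDiff₀, expDiff₁, mul_neg, integral_neg]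
  rw [d1, d2, d3, d4, e4]
  linear_combination (fk - fp) / (η ^ 2 + a)

lemma isDecaying_cos_mul_exp (ha : 0 < a) (hc : 0 < c) :
    IsDecaying a (fun z η => Real.cos (z.2 * η) *
      (Real.exp (-(z.1 * √c)) / √c / (η ^ 2 + a))) where
  cont := by
    unfold Function.uncurry
    refine Continuous.mul (by fun_prop) (Continuous.div (by fun_prop) (by fun_prop) fun z => ?_)
    positivity
  bound := by
    have hp := Real.sqrt_pos.2 hc
    refine ⟨1 / √c, √c, hp, fun p _ η => ?_⟩
    have hB : 0 < η ^ 2 + a := by positivity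
    rw [abs_mul, abs_of_pos (a := _ / (η ^ 2 + a)) (by positivity)]
    refine (mul_le_of_le_one_left (by positivity) (Real.abs_cos_le_one _)).trans (le_of_eq ?_)
    rw [mul_comm p.1]
    ring

/-- The bilinear form of the energy, for the correction against corner data. By Fubini it is the
integral over all frequencies of `form_corrI`, which resums to the leading exponential. -/
lemma IsCornerRep.form_corr (hr : IsCornerRep v g₁ g₂ g₁₂) (ha : 0 < a) (hc : 0 < c)
    (hd : 0 < d) :
    (∫ z in openQuadrant, g₁₂ z * corrXY a c d z) +
      a * (∫ z in openQuadrant, g₁ z * corrX a c d z) +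
      c * (∫ z in openQuadrant, g₂ z * corrY a c d z) +
      d * (∫ z in openQuadrant, v z * corr a c d z) =
    (a * c - d) / (√c * √a) * ∫ z in openQuadrant, v z * leadExp a c z := by
  have hpi := Real.pi_pos
  have sw : ∀ (g : ℝ × ℝ → ℝ) (J : ℝ × ℝ → ℝ → ℝ), IsDecaying a J → IntegrableOn g openQuadrant →
      ∫ z in openQuadrant, g z * (2 / Real.pi * ∫ η in Ioi (0:ℝ), J z η) =
      2 / Real.pi * ∫ η in Ioi (0:ℝ), ∫ z in openQuadrant, g z * J z η := by
    intro g J hJ hg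
    rw [← hJ.integral_swap ha hg, ← integral_const_mul]
    congr 1; ext z; ring
  have h11 := isDecaying_corrIXY ha hc hd
  have h10 := isDecaying_corrIX ha hc hd
  have h01 := isDecaying_corrIY ha hc hd
  have h00 := isDecaying_corrI ha hc hd
  have hcos := isDecaying_cos_mul_exp (c := c) ha hc
  have comb := integral_lincomb_four (h11.integrable_slice ha hr.int_xy)
    (h10.integrable_slice ha hr.int_x) (h01.integrable_slice ha hr.int_y)
    (h00.integrable_slice ha hr.int) a c d
  simp_rw [hr.form_corrI ha hc hd] at comb
  rw [integral_const_mul, ← hcos.integral_swap ha hr.int] at comb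
  have lead : ∫ z in openQuadrant, v z * ∫ η in Ioi (0:ℝ),
      Real.cos (z.2 * η) * (Real.exp (-(z.1 * √c)) / √c / (η ^ 2 + a)) =
      Real.pi / 2 / (√c * √a) * ∫ z in openQuadrant, v z * leadExp a c z := by
    rw [← integral_const_mul]
    refine setIntegral_congr_fun measurableSet_openQuadrant fun z hz => ?_
    have : ∀ η : ℝ, Real.cos (z.2 * η) * (Real.exp (-(z.1 * √c)) / √c / (η ^ 2 + a)) =
        Real.exp (-(z.1 * √c)) / √c * (Real.cos (z.2 * η) / (η ^ 2 + a)) := by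
      intro η; ring
    simp_rw [this]
    rw [integral_const_mul, integral_cos_div_sq_add ha (le_of_lt hz.2), leadExp]
    ring
  unfold corrXY corrX corrY corr
  rw [sw _ _ h11 hr.int_xy, sw _ _ h10 hr.int_x, sw _ _ h01 hr.int_y, sw _ _ h00 hr.int]
  rw [lead] at comb
  calc _ = 2 / Real.pi * ((∫ η in Ioi (0:ℝ), ∫ z in openQuadrant, g₁₂ z * corrIXY a c d z η) +
      a * (∫ η in Ioi (0:ℝ), ∫ z in openQuadrant, g₁ z * corrIX a c d z η) +
      c * (∫ η in Ioi (0:ℝ), ∫ z in openQuadrant, g₂ z * corrIY a c d z η) +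
      d * (∫ η in Ioi (0:ℝ), ∫ z in openQuadrant, v z * corrI a c d z η)) := by ring
    _ = _ := by rw [← comb]; field_simp

/-- The reproducing property for integrable corner data: the defect of the correction cancels that
of the leading exponential, and only the corner value is left. -/
lemma IsCornerRep.form_ker (hr : IsCornerRep v g₁ g₂ g₁₂) (ha : 0 < a) (hc : 0 < c)
    (hd : 0 < d) (hL2 : ∀ g ∈ ({g₁₂, g₁, g₂, v} : Set (ℝ × ℝ → ℝ)), InL2 g) :
    (∫ z in openQuadrant, g₁₂ z * kerXY a c d z) +
      a * (∫ z in openQuadrant, g₁ z * kerX a c d z) +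
      c * (∫ z in openQuadrant, g₂ z * kerY a c d z) +
      d * (∫ z in openQuadrant, v z * ker a c d z) = v (0, 0) := by
  have hp := Real.sqrt_pos.2 hc
  have hq := Real.sqrt_pos.2 ha
  have split : ∀ (g w : ℝ × ℝ → ℝ) (s : ℝ), InL2 g → InL2 w →
      ∫ z in openQuadrant, g z * (s * leadExp a c z + w z) =
      s * (∫ z in openQuadrant, g z * leadExp a c z) + ∫ z in openQuadrant, g z * w z := by
    intro g w s hg hw
    rw [← integral_const_mul, ← integral_add
      ((hg.integrableOn_mul (inL2_leadExp ha hc)).const_mul s) (hg.integrableOn_mul hw)]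
    congr 1; ext z; ring
  have e1 := split g₁₂ (corrXY a c d) 1 (hL2 _ (by simp)) (inL2_corrXY ha hc hd)
  have e2 := split g₁ (corrX a c d) (-(1 / √a)) (hL2 _ (by simp)) (inL2_corrX ha hc hd)
  have e3 := split g₂ (corrY a c d) (-(1 / √c)) (hL2 _ (by simp)) (inL2_corrY ha hc hd)
  have e4 := split v (corr a c d) (1 / (√c * √a)) (hL2 _ (by simp)) (inL2_corr ha hc hd)
  have k1 : ∀ z, kerXY a c d z = 1 * leadExp a c z + corrXY a c d z := fun z => by
    rw [kerXY, one_mul]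
  have k2 : ∀ z, kerX a c d z = -(1 / √a) * leadExp a c z + corrX a c d z := fun z => by
    rw [kerX]; ring
  have k3 : ∀ z, kerY a c d z = -(1 / √c) * leadExp a c z + corrY a c d z := fun z => by
    rw [kerY]; ring
  have k4 : ∀ z, ker a c d z = 1 / (√c * √a) * leadExp a c z + corr a c d z := fun z => by
    rw [ker]; ring
  simp_rw [k1, k2, k3, k4]
  rw [e1, e2, e3, e4]
  have f1 := hr.form_corr ha hc hd
  have f2 := hr.form_exp_exp d hp hq
  rw [Real.sq_sqrt ha.le, Real.sq_sqrt hc.le] at f2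
  change _ - a * (∫ z in openQuadrant, g₁ z * leadExp a c z) / √a -
    c * (∫ z in openQuadrant, g₂ z * leadExp a c z) / √c +
    d * (∫ z in openQuadrant, v z * leadExp a c z) / (√c * √a) =
    (d - a * c) / (√c * √a) * (∫ z in openQuadrant, v z * leadExp a c z) + v (0, 0) at f2
  change (∫ z in openQuadrant, g₁₂ z * leadExp a c z) - _ - _ + _ = _ at f2
  linear_combination f1 + f2

end Reproducing

/-- Cutoffs equal to `1` on growing intervals, with uniformly bounded derivatives. -/
lemma exists_cutoff : ∃ χ : ℕ → ℝ → ℝ, (∀ n, IsBump (χ n)) ∧ (∀ n, χ n 0 = 1) ∧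
    (∀ n x, |χ n x| ≤ 1) ∧ (∃ C, ∀ n x, |deriv (χ n) x| ≤ C) ∧
    ∀ x, ∀ᶠ n in atTop, χ n x = 1 ∧ deriv (χ n) x = 0 := by
  set ψ : ℝ → ℝ := fun x => 1 - step (x ^ 2) with hψ
  have hψs : ContDiff ℝ ∞ ψ := contDiff_const.sub (contDiff_step.comp (contDiff_id.pow 2))
  have hψ1 : ∀ x, |x| < 1 → ψ x = 1 := by
    intro x hx
    have : x ^ 2 ≤ 1 := by rw [← sq_abs]; nlinarith [abs_nonneg x]
    simp [hψ, step_of_le this]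
  have hψb : IsBump ψ := by
    refine ⟨hψs, HasCompactSupport.intro (isCompact_Icc (a := (-2:ℝ)) (b := 2)) fun x hx => ?_⟩
    have : 2 ≤ x ^ 2 := by
      rw [mem_Icc, not_and_or, not_le, not_le] at hx
      rcases hx with hx | hx <;> nlinarith
    simp [hψ, step_of_ge this]
  have hψle : ∀ x, |ψ x| ≤ 1 := by
    intro x
    have h0 : 0 ≤ step (x ^ 2) := Real.smoothTransition.nonneg _
    have h1 : step (x ^ 2) ≤ 1 := Real.smoothTransition.le_one _
    simp only [hψ]
    rw [abs_le]; constructor <;> linarith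
  obtain ⟨C, hC⟩ := hψb.deriv.2.exists_bound_of_continuous hψb.deriv.continuous
  have hn : ∀ n : ℕ, (0:ℝ) < (n + 1 : ℝ)⁻¹ := fun n => by positivity
  have hn1 : ∀ n : ℕ, (n + 1 : ℝ)⁻¹ ≤ 1 := fun n =>
    inv_le_one_of_one_le₀ (by linarith [(Nat.cast_nonneg n : (0:ℝ) ≤ n)])
  have hderiv : ∀ (n : ℕ) x, deriv (fun x => ψ (x * (n + 1 : ℝ)⁻¹)) x =
      deriv ψ (x * (n + 1 : ℝ)⁻¹) * (n + 1 : ℝ)⁻¹ := by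
    intro n x
    have h1 : HasDerivAt (fun x : ℝ => x * (n + 1 : ℝ)⁻¹) ((n + 1 : ℝ)⁻¹) x := by
      simpa using (hasDerivAt_id x).mul_const ((n + 1 : ℝ)⁻¹)
    exact ((hψb.hasDerivAt _).comp x h1).deriv
  refine ⟨fun n x => ψ (x * (n + 1 : ℝ)⁻¹), fun n => ⟨?_, ?_⟩, fun n => ?_, fun n x => hψle _,
    ⟨C, fun n x => ?_⟩, fun x => ?_⟩
  · exact hψs.comp (contDiff_id.mul contDiff_const)
  · exact hψb.2.comp_homeomorph (Homeomorph.mulRight₀ _ (hn n).ne')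
  · exact hψ1 _ (by simp)
  · rw [hderiv, abs_mul, abs_of_pos (hn n)]
    exact (mul_le_of_le_one_right (abs_nonneg _) (hn1 n)).trans (hC _)
  · obtain ⟨N, hN⟩ := exists_nat_gt |x|
    filter_upwards [Ici_mem_atTop N] with n hnN
    have hlt : |x * (n + 1 : ℝ)⁻¹| < 1 := by
      have h1 : (N : ℝ) ≤ n := by exact_mod_cast hnN
      rw [abs_mul, abs_of_pos (hn n), ← div_eq_mul_inv, div_lt_one (by positivity)]
      linarith
    refine ⟨hψ1 _ hlt, ?_⟩
    have : ψ =ᶠ[𝓝 (x * (n + 1 : ℝ)⁻¹)] fun _ => 1 := by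
      filter_upwards [(isOpen_lt continuous_abs continuous_const).mem_nhds hlt] with t ht
        using hψ1 t ht
    rw [hderiv, this.deriv_eq, deriv_const, zero_mul]

section Limit

variable {a c d : ℝ} {v g₁ g₂ g₁₂ : ℝ × ℝ → ℝ}

lemma tendsto_integral_mul_of_dominated {k g G : ℝ × ℝ → ℝ} {f : ℕ → ℝ × ℝ → ℝ} (hk : InL2 k)
    (hG : InL2 G) (hf : ∀ n, InL2 (f n)) (hb : ∀ n p, |f n p| ≤ G p)
    (hlim : ∀ p, ∀ᶠ n in atTop, f n p = g p) :
    Tendsto (fun n => ∫ p in openQuadrant, f n p * k p) atTop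
      (𝓝 (∫ p in openQuadrant, g p * k p)) := by
  refine tendsto_integral_of_dominated_convergence (fun p => G p * |k p|)
    (fun n => ((hf n).1.mul hk.1)) (hG.integrableOn_mul hk.norm)
    (fun n => Eventually.of_forall fun p => ?_) (Eventually.of_forall fun p => ?_)
  · rw [norm_mul]
    exact mul_le_mul_of_nonneg_right (hb n p) (norm_nonneg _)
  · refine tendsto_const_nhds.congr' ?_
    filter_upwards [hlim p] with n hn using by rw [hn]

lemma reproducing_of_continuous (ha : 0 < a) (hc : 0 < c) (hd : 0 < d)
    (hw : IsWeakRep v g₁ g₂ g₁₂) (hv : Continuous v) :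
    (∫ z in openQuadrant, g₁₂ z * kerXY a c d z) +
      a * (∫ z in openQuadrant, g₁ z * kerX a c d z) +
      c * (∫ z in openQuadrant, g₂ z * kerY a c d z) +
      d * (∫ z in openQuadrant, v z * ker a c d z) = v (0, 0) := by
  obtain ⟨χ, hχ, hχ0, hχ1, ⟨C, hC⟩, hlim⟩ := exists_cutoff
  have hC0 : 0 ≤ C := (abs_nonneg _).trans (hC 0 0)
  set D := 1 + C with hD
  have hD1 : 1 ≤ D := by linarith
  have b1 : ∀ n x, |χ n x| ≤ D := fun n x => (hχ1 n x).trans hD1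
  have b2 : ∀ n x, |deriv (χ n) x| ≤ D := fun n x => (hC n x).trans (by linarith)
  -- one square integrable majorant for all truncated data
  set G : ℝ × ℝ → ℝ := fun z => (D * D) * (|g₁₂ z| + |g₁ z| + |g₂ z| + |v z|) with hG
  have hGL : InL2 G := (((hw.memL2_xy.norm.add hw.memL2_x.norm).add hw.memL2_y.norm).add
    hw.memL2.norm).const_mul (D * D)
  have tb : ∀ (s x y : ℝ), |x| ≤ D → |y| ≤ D → |s * (x * y)| ≤ D * D * |s| := by
    intro s x y hx hy
    rw [abs_mul, abs_mul, mul_comm]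
    exact mul_le_mul_of_nonneg_right (mul_le_mul hx hy (abs_nonneg _) (by linarith))
      (abs_nonneg _)
  have hDD : 0 ≤ D * D := by positivity
  have n12 : ∀ z, 0 ≤ D * D * |g₁₂ z| := fun z => by positivity
  have n1 : ∀ z, 0 ≤ D * D * |g₁ z| := fun z => by positivity
  have n2 : ∀ z, 0 ≤ D * D * |g₂ z| := fun z => by positivity
  have n0 : ∀ z, 0 ≤ D * D * |v z| := fun z => by positivity
  have hGe : ∀ z, G z = D * D * |g₁₂ z| + D * D * |g₁ z| + D * D * |g₂ z| + D * D * |v z| :=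
    fun z => by rw [hG]; ring
  have bd12 : ∀ n z, |g₁₂ z * (χ n z.1 * χ n z.2) + g₁ z * (χ n z.1 * deriv (χ n) z.2) +
      g₂ z * (deriv (χ n) z.1 * χ n z.2) + v z * (deriv (χ n) z.1 * deriv (χ n) z.2)| ≤ G z := by
    intro n z
    rw [hGe]
    refine (abs_add_le _ _).trans (add_le_add ((abs_add_le _ _).trans (add_le_add
      ((abs_add_le _ _).trans (add_le_add ?_ ?_)) ?_)) ?_)
    exacts [tb _ _ _ (b1 _ _) (b1 _ _), tb _ _ _ (b1 _ _) (b2 _ _), tb _ _ _ (b2 _ _) (b1 _ _),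
      tb _ _ _ (b2 _ _) (b2 _ _)]
  have bd1 : ∀ n z, |g₁ z * (χ n z.1 * χ n z.2) + v z * (deriv (χ n) z.1 * χ n z.2)| ≤ G z := by
    intro n z
    have h1 := tb (g₁ z) _ _ (b1 n z.1) (b1 n z.2)
    have h2 := tb (v z) _ _ (b2 n z.1) (b1 n z.2)
    linarith [abs_add_le (g₁ z * (χ n z.1 * χ n z.2)) (v z * (deriv (χ n) z.1 * χ n z.2)),
      hGe z, n12 z, n2 z]
  have bd2 : ∀ n z, |g₂ z * (χ n z.1 * χ n z.2) + v z * (χ n z.1 * deriv (χ n) z.2)| ≤ G z := by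
    intro n z
    have h1 := tb (g₂ z) _ _ (b1 n z.1) (b1 n z.2)
    have h2 := tb (v z) _ _ (b1 n z.1) (b2 n z.2)
    linarith [abs_add_le (g₂ z * (χ n z.1 * χ n z.2)) (v z * (χ n z.1 * deriv (χ n) z.2)),
      hGe z, n12 z, n1 z]
  have bd0 : ∀ n z, |v z * (χ n z.1 * χ n z.2)| ≤ G z := by
    intro n z
    have h1 := tb (v z) _ _ (b1 n z.1) (b1 n z.2)
    linarith [hGe z, n12 z, n1 z, n2 z]
  have hrep := fun n => hw.isCornerRep hv (hχ n) (hχ0 n)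
  have toL2 : ∀ f : ℝ × ℝ → ℝ, IntegrableOn f openQuadrant → (∀ z, |f z| ≤ G z) → InL2 f :=
    fun f hf hb => hGL.mono' hf.1 (Eventually.of_forall hb)
  have l12 := fun n => toL2 _ (hrep n).int_xy (bd12 n)
  have l1 := fun n => toL2 _ (hrep n).int_x (bd1 n)
  have l2 := fun n => toL2 _ (hrep n).int_y (bd2 n)
  have l0 := fun n => toL2 _ (hrep n).int (bd0 n)
  have lim12 := tendsto_integral_mul_of_dominated (g := g₁₂) (inL2_kerXY ha hc hd) hGL l12 bd12
    (fun z => by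
      filter_upwards [hlim z.1, hlim z.2] with n h1 h2
      rw [h1.1, h1.2, h2.1, h2.2]; ring)
  have lim1 := tendsto_integral_mul_of_dominated (g := g₁) (inL2_kerX ha hc hd) hGL l1 bd1
    (fun z => by
      filter_upwards [hlim z.1, hlim z.2] with n h1 h2
      rw [h1.1, h1.2, h2.1]; ring)
  have lim2 := tendsto_integral_mul_of_dominated (g := g₂) (inL2_kerY ha hc hd) hGL l2 bd2
    (fun z => by
      filter_upwards [hlim z.1, hlim z.2] with n h1 h2
      rw [h1.1, h2.1, h2.2]; ring)
  have lim0 := tendsto_integral_mul_of_dominated (g := v) (inL2_ker ha hc hd) hGL l0 bd0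
    (fun z => by
      filter_upwards [hlim z.1, hlim z.2] with n h1 h2
      rw [h1.1, h2.1]; ring)
  have lim := ((lim12.add (lim1.const_mul a)).add (lim2.const_mul c)).add (lim0.const_mul d)
  refine tendsto_nhds_unique lim (tendsto_const_nhds.congr fun n => ?_)
  have := (hrep n).form_ker ha hc hd (by
    intro g hg
    simp only [mem_insert_iff, mem_singleton_iff] at hg
    rcases hg with rfl | rfl | rfl | rfl
    exacts [l12 n, l1 n, l2 n, l0 n])
  rw [this]
  simp [hχ0 n]

lemma IsWeakRep.congr {v' : ℝ × ℝ → ℝ} (hw : IsWeakRep v g₁ g₂ g₁₂)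
    (h : EqOn v v' openQuadrant) : IsWeakRep v' g₁ g₂ g₁₂ := by
  have key : ∀ w : ℝ × ℝ → ℝ, ∫ p in openQuadrant, v' p * w p = ∫ p in openQuadrant, v p * w p :=
    fun w => setIntegral_congr_fun measurableSet_openQuadrant fun p hp => by
      simp only [h hp]
  refine ⟨?_, hw.memL2_x, hw.memL2_y, hw.memL2_xy, ⟨hw.weak_x.1, fun φ hφ => ?_⟩,
    ⟨hw.weak_y.1, fun φ hφ => ?_⟩, ⟨hw.weak_xy.1, fun φ hφ => ?_⟩⟩
  · refine (memLp_congr_ae ?_).1 hw.memL2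
    filter_upwards [ae_restrict_mem measurableSet_openQuadrant] with p hp using h hp
  · rw [key]; exact hw.weak_x.2 φ hφ
  · rw [key]; exact hw.weak_y.2 φ hφ
  · rw [key]; exact hw.weak_xy.2 φ hφ

/-- The reproducing property: pairing with the kernel in the energy inner product evaluates at
the corner. -/
lemma reproducing (ha : 0 < a) (hc : 0 < c) (hd : 0 < d)
    (hw : IsWeakRep v g₁ g₂ g₁₂) (hv : ContinuousOn v closedQuadrant) :
    (∫ z in openQuadrant, g₁₂ z * kerXY a c d z) +
      a * (∫ z in openQuadrant, g₁ z * kerX a c d z) +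
      c * (∫ z in openQuadrant, g₂ z * kerY a c d z) +
      d * (∫ z in openQuadrant, v z * ker a c d z) = v (0, 0) := by
  -- extend `v` continuously to the plane; nothing changes on the quadrant
  set v' : ℝ × ℝ → ℝ := fun z => v (max z.1 0, max z.2 0) with hv'
  have hcont : Continuous v' := hv.comp_continuous (by fun_prop)
    fun z => mem_prod.2 ⟨mem_Ici.2 (le_max_right _ _), mem_Ici.2 (le_max_right _ _)⟩
  have heq : EqOn v v' openQuadrant := by
    intro z hz
    simp only [hv', max_eq_left (le_of_lt (mem_Ioi.1 hz.1)), max_eq_left (le_of_lt (mem_Ioi.1 hz.2))]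
  have := reproducing_of_continuous ha hc hd (hw.congr heq) hcont
  have e : ∫ z in openQuadrant, v z * ker a c d z = ∫ z in openQuadrant, v' z * ker a c d z :=
    setIntegral_congr_fun measurableSet_openQuadrant fun z hz => by simp only [heq hz]
  rw [e, this]
  simp [hv']

end Limit

/-! ### Sign change for `a c < d` -/

open Complex in
/-- A continuous integrable function with nonnegative Fourier transform attains its maximal modulus
at the origin. No integrability of the transform is needed: it is regularized by Gaussians. -/
lemma norm_le_of_fourier_nonneg {f : ℝ → ℂ} (hf : Integrable f) (hc : Continuous f)
    (h : ∀ w, ∃ r : ℝ, 0 ≤ r ∧ FourierTransform.fourier f w = r) (v : ℝ) : ‖f v‖ ≤ ‖f 0‖ := by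
  choose r hr0 hr using h
  set A : ℝ → ℝ → ℂ := fun t v => ∫ w : ℝ, cexp (-t⁻¹ * ‖w‖ ^ 2 + 2 * Real.pi * I * inner ℝ v w) •
    FourierTransform.fourier f w with hA
  have lim : ∀ v, Tendsto (fun t => A t v) atTop (𝓝 (f v)) := by
    intro v
    refine (Real.tendsto_integral_gaussian_smul' hf (hc.continuousAt (x := v))).congr' ?_
    filter_upwards [Ioi_mem_atTop 0] with t (ht : 0 < t)
    have J : Integrable (fun w : ℝ => cexp (-t⁻¹ * ‖w‖ ^ 2 + 2 * Real.pi * I * inner ℝ v w)) :=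
      GaussianFourier.integrable_cexp_neg_mul_sq_norm_add (by simpa) _ _
    have flip := VectorFourier.integral_fourierIntegral_smul_eq_flip (L := innerₗ ℝ)
      Real.continuous_fourierChar continuous_inner J hf
    have e : A t v = ∫ w : ℝ, FourierTransform.fourier (fun w : ℝ =>
        cexp (-t⁻¹ * ‖w‖ ^ 2 + 2 * Real.pi * I * inner ℝ v w)) w • f w := by
      rw [flip_innerₗ] at flip
      exact flip.symm
    rw [e]
    congr with w
    rw [fourier_gaussian_innerProductSpace' (by simpa), ofReal_inv, div_inv_eq_mul,
      div_inv_eq_mul, mul_right_comm (-(Real.pi : ℂ) ^ 2)]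
  refine le_of_tendsto_of_tendsto (lim v).norm (lim 0).norm (Eventually.of_forall fun t => ?_)
  have e0 : A t 0 = ((∫ w : ℝ, Real.exp (-t⁻¹ * ‖w‖ ^ 2) * r w : ℝ) : ℂ) := by
    simp only [hA, hr]
    rw [← integral_complex_ofReal]
    congr 1; ext w
    simp [← ofReal_pow]
  have e1 : ∀ w : ℝ, ‖cexp (-t⁻¹ * ‖w‖ ^ 2 + 2 * Real.pi * I * inner ℝ v w) •
      FourierTransform.fourier f w‖ = Real.exp (-t⁻¹ * ‖w‖ ^ 2) * r w := by
    intro w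
    rw [hr, norm_smul, Complex.norm_exp, Complex.norm_real, Real.norm_eq_abs (r w),
      abs_of_nonneg (hr0 w)]
    congr 2
    simp [← ofReal_pow]
  calc ‖A t v‖ ≤ ∫ w : ℝ, Real.exp (-t⁻¹ * ‖w‖ ^ 2) * r w := by
        refine (norm_integral_le_integral_norm _).trans (le_of_eq ?_)
        simp_rw [e1]
    _ ≤ ‖A t 0‖ := by
        rw [e0, Complex.norm_real]
        exact le_abs_self _

lemma integral_even {f : ℝ → ℝ} (hf : ∀ x, f (-x) = f x) :
    ∫ x, f x = 2 * ∫ x in Ioi (0:ℝ), f x := by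
  rw [← integral_comp_abs (f := f)]
  congr 1; ext x
  rcases abs_choice x with h | h <;> simp [h, hf]

open Complex in
/-- The Fourier transform of an even real function is its cosine transform. -/
lemma fourier_ofReal_of_even {F : ℝ → ℝ} (hF : Integrable F) (he : ∀ x, F (-x) = F x) (w : ℝ) :
    FourierTransform.fourier (fun x => (F x : ℂ)) w =
      ((2 * ∫ η in Ioi (0:ℝ), Real.cos (2 * Real.pi * w * η) * F η : ℝ) : ℂ) := by
  have i1 : ∀ φ : ℝ → ℝ, Continuous φ → (∀ x, |φ x| ≤ 1) → Integrable (fun η => φ η * F η) :=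
    fun φ hφ hb => hF.bdd_mul hφ.aestronglyMeasurable (c := 1) (Eventually.of_forall hb)
  have ic := i1 (fun η => Real.cos (2 * Real.pi * w * η)) (by fun_prop)
    (fun _ => Real.abs_cos_le_one _)
  have is := i1 (fun η => Real.sin (2 * Real.pi * w * η)) (by fun_prop)
    (fun _ => Real.abs_sin_le_one _)
  have hodd : ∫ η, Real.sin (2 * Real.pi * w * η) * F η = 0 := by
    have h := integral_neg_eq_self (fun η => Real.sin (2 * Real.pi * w * η) * F η) volume
    simp only [he, mul_neg, Real.sin_neg, neg_mul, integral_neg] at h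
    linarith
  rw [← integral_even (f := fun η => Real.cos (2 * Real.pi * w * η) * F η)
    (fun x => by simp only [he, mul_neg, Real.cos_neg]), Real.fourier_eq']
  have e : ∀ η : ℝ, cexp (↑(-2 * Real.pi * inner ℝ η w) * I) • (F η : ℂ) =
      ((Real.cos (2 * Real.pi * w * η) * F η : ℝ) : ℂ) -
        I * ((Real.sin (2 * Real.pi * w * η) * F η : ℝ) : ℂ) := by
    intro η
    have : (-2 * Real.pi * inner ℝ η w : ℝ) = -(2 * Real.pi * w * η) := by
      simp only [RCLike.inner_apply, conj_trivial]; ring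
    rw [this, exp_mul_I, ← ofReal_cos, ← ofReal_sin, Real.cos_neg, Real.sin_neg, smul_eq_mul]
    push_cast
    ring
  have ic' : Integrable fun η : ℝ => ((Real.cos (2 * Real.pi * w * η) * F η : ℝ) : ℂ) := ic.ofReal
  have is' : Integrable fun η : ℝ => ((Real.sin (2 * Real.pi * w * η) * F η : ℝ) : ℂ) := is.ofReal
  simp_rw [e]
  rw [integral_sub ic' (is'.const_mul I), integral_const_mul, integral_complex_ofReal,
    integral_complex_ofReal, hodd]
  simp

/-- If the kernel were nonnegative, its cosine profile in `η` would be largest at `η = 0` for every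
`x`; but the rate at `η = 1` is smaller than at `η = 0`, which is incompatible with large `x`. -/
lemma exists_kernel_neg {a c d : ℝ} (ha : 0 < a) (hc : 0 < c) (hd : 0 < d) (h : a * c < d) :
    ∃ p ∈ closedQuadrant, kernel a c d p < 0 := by
  by_contra! hK
  have hpi := Real.pi_pos
  have k0 := rate_pos ha hc hd 0
  have k1 := rate_pos ha hc hd 1
  have hlt : rate a c d 1 < rate a c d 0 := by
    refine Real.sqrt_lt_sqrt (by positivity) ?_
    rw [div_lt_div_iff₀ (by positivity) (by positivity)]
    nlinarith
  set F : ℝ → ℝ → ℝ := fun x η =>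
    Real.exp (-(x * rate a c d η)) / rate a c d η / (η ^ 2 + a) with hFdef
  have hcont : ∀ x, Continuous (F x) := by
    intro x
    have := continuous_rate (c := c) (d := d) ha
    refine Continuous.div (Continuous.div (by fun_prop) this fun η => (rate_pos ha hc hd η).ne')
      (by fun_prop) fun η => ?_
    positivity
  have key : ∀ x, 0 ≤ x → F x 1 ≤ F x 0 := by
    intro x hx
    obtain ⟨κ, hκ, -, hκk⟩ := exists_le_rate ha hc hd
    have hpos : ∀ η, 0 < F x η := fun η => by
      have := rate_pos ha hc hd η
      have : 0 < η ^ 2 + a := by positivity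
      positivity
    have hint : Integrable (F x) := by
      refine ((integrable_inv_sq_add ha).const_mul κ⁻¹).mono'
        (hcont x).aestronglyMeasurable (Eventually.of_forall fun η => ?_)
      have hk := rate_pos ha hc hd η
      rw [Real.norm_eq_abs, abs_of_pos (hpos η), ← div_eq_mul_inv]
      refine div_le_div_of_nonneg_right ?_ (by positivity)
      rw [← one_div]
      refine div_le_div₀ zero_le_one (Real.exp_le_one_iff.2 ?_) hκ (hκk η)
      nlinarith
    have heven : ∀ η, F x (-η) = F x η := fun η => by simp [hFdef, rate]
    have hn := norm_le_of_fourier_nonneg (f := fun η => (F x η : ℂ)) hint.ofReal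
      (Complex.continuous_ofReal.comp (hcont x)) (fun w => ?_) 1
    · rwa [Complex.norm_real, Complex.norm_real, Real.norm_of_nonneg (hpos _).le,
        Real.norm_of_nonneg (hpos _).le] at hn
    · refine ⟨_, ?_, fourier_ofReal_of_even hint heven w⟩
      have h1 := hK (x, |2 * Real.pi * w|) (mem_prod.2 ⟨hx, abs_nonneg (2 * Real.pi * w)⟩)
      rw [kernel_eq_integral_rate ha hc hd hx] at h1
      have h2 := nonneg_of_mul_nonneg_right h1 (by positivity)
      have e : ∀ η : ℝ, Real.cos (|2 * Real.pi * w| * η) = Real.cos (2 * Real.pi * w * η) := by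
        intro η
        rcases abs_choice (2 * Real.pi * w) with h | h <;> rw [h]
        rw [neg_mul, Real.cos_neg]
      simp only [e] at h2
      exact mul_nonneg zero_le_two h2
  -- for large `x` the mode of frequency `1`, having the slower decay, dominates that of frequency `0`
  set R := rate a c d 1 * (1 + a) / (rate a c d 0 * a) with hR
  obtain ⟨x, hx⟩ := exists_gt (max 0 (R / (rate a c d 0 - rate a c d 1)))
  have hx0 : 0 < x := (le_max_left _ _).trans_lt hx
  have hx1 : R < x * (rate a c d 0 - rate a c d 1) := by
    rw [← div_lt_iff₀ (by linarith)]
    exact (le_max_right _ _).trans_lt hx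
  have hexp : R < Real.exp (x * (rate a c d 0 - rate a c d 1)) := by
    linarith [Real.add_one_le_exp (x * (rate a c d 0 - rate a c d 1))]
  have hk := key x hx0.le
  simp only [hFdef] at hk
  have hsplit : Real.exp (-(x * rate a c d 1)) =
      Real.exp (-(x * rate a c d 0)) * Real.exp (x * (rate a c d 0 - rate a c d 1)) := by
    rw [← Real.exp_add]; congr 1; ring
  rw [div_div, div_div, hsplit, div_le_div_iff₀ (by positivity) (by positivity)] at hk
  rw [hR, div_lt_iff₀ (by positivity)] at hexp
  have he := Real.exp_pos (-(x * rate a c d 0))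
  have := mul_lt_mul_of_pos_left hexp he
  norm_num at hk
  nlinarith

/-! ### Positivity for `d ≤ a c` -/

open Complex in
lemma integral_cos_mul_gaussian_nonneg {t : ℝ} (ht : 0 < t) (x : ℝ) :
    0 ≤ ∫ ξ in Ioi (0:ℝ), Real.cos (x * ξ) * Real.exp (-t * ξ ^ 2) := by
  have hg : Integrable (fun ξ : ℝ => Real.exp (-t * ξ ^ 2)) := integrable_exp_neg_mul_sq ht
  have hg' : Integrable (fun ξ : ℝ => ((Real.exp (-t * ξ ^ 2) : ℝ) : ℂ)) := hg.ofReal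
  have hgi : Integrable (fun ξ : ℝ => cexp (I * x * ξ) * ((Real.exp (-t * ξ ^ 2) : ℝ) : ℂ)) := by
    refine hg'.bdd_mul (c := 1) (Continuous.aestronglyMeasurable (by fun_prop))
      (Eventually.of_forall fun ξ => ?_)
    rw [Complex.norm_exp]
    simp
  have h1 : ∫ ξ : ℝ, Real.cos (x * ξ) * Real.exp (-t * ξ ^ 2) =
      (∫ ξ : ℝ, cexp (I * x * ξ) * cexp (-t * ξ ^ 2)).re := by
    rw [← RCLike.re_eq_complex_re, ← integral_re]
    · congr 1; ext ξ
      have e1 : (I * x * ξ : ℂ) = ((x * ξ : ℝ) : ℂ) * I := by push_cast; ring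
      have e2 : (-t * ξ ^ 2 : ℂ) = ((-t * ξ ^ 2 : ℝ) : ℂ) := by push_cast; ring
      rw [e1, e2, ← ofReal_exp, RCLike.re_eq_complex_re, re_mul_ofReal, exp_ofReal_mul_I_re]
    · simpa using hgi
  have h2 := integral_even (f := fun ξ => Real.cos (x * ξ) * Real.exp (-t * ξ ^ 2))
    (fun ξ => by simp)
  rw [h1, fourierIntegral_gaussian (by simpa using ht)] at h2
  have h3 : ((Real.pi / t : ℂ) ^ (1 / 2 : ℂ) * cexp (-(x : ℂ) ^ 2 / (4 * t))).re =
      (Real.pi / t) ^ (1 / 2 : ℝ) * Real.exp (-x ^ 2 / (4 * t)) := by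
    have e1 : (Real.pi / t : ℂ) ^ (1 / 2 : ℂ) = (((Real.pi / t) ^ (1 / 2 : ℝ) : ℝ) : ℂ) := by
      rw [ofReal_cpow (by positivity)]; push_cast; rfl
    have e2 : cexp (-(x : ℂ) ^ 2 / (4 * t)) = ((Real.exp (-x ^ 2 / (4 * t)) : ℝ) : ℂ) := by
      push_cast; rfl
    rw [e1, e2, ← ofReal_mul, ofReal_re]
  rw [h3] at h2
  have h4 : 0 ≤ (Real.pi / t) ^ (1 / 2 : ℝ) * Real.exp (-x ^ 2 / (4 * t)) := by positivity
  linarith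

lemma integral_pow_mul_exp_neg_mul (n : ℕ) {r : ℝ} (hr : 0 < r) :
    IntegrableOn (fun t : ℝ => t ^ n * Real.exp (-r * t)) (Ioi 0) ∧
    ∫ t in Ioi (0:ℝ), t ^ n * Real.exp (-r * t) = n.factorial / r ^ (n + 1) := by
  have h := Real.integral_rpow_mul_exp_neg_mul_Ioi (a := n + 1) (r := r) (by positivity) hr
  have e : ∫ t in Ioi (0:ℝ), t ^ n * Real.exp (-r * t) = n.factorial / r ^ (n + 1) := by
    simp only [add_sub_cancel_right, Real.rpow_natCast] at h
    simp only [neg_mul]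
    rw [h, Real.Gamma_nat_eq_factorial]
    have : (1 / r) ^ ((n : ℝ) + 1) = (1 / r) ^ (n + 1) := by
      rw [← Real.rpow_natCast]; push_cast; rfl
    rw [this, one_div, inv_pow]
    ring
  refine ⟨?_, e⟩
  by_contra hni
  have h0 := integral_undef hni
  rw [e] at h0
  have : (0:ℝ) < n.factorial / r ^ (n + 1) := by positivity
  linarith

lemma integrable_cos_div_pow {m : ℝ} (hm : 0 < m) (n : ℕ) (x : ℝ) :
    Integrable (fun ξ : ℝ => Real.cos (x * ξ) / (ξ ^ 2 + m) ^ (n + 1)) := by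
  refine ((integrable_inv_sq_add hm).const_mul ((m⁻¹) ^ n)).mono'
    (Continuous.aestronglyMeasurable ?_) (Eventually.of_forall fun ξ => ?_)
  · refine Continuous.div (by fun_prop) (by fun_prop) fun ξ => ?_
    positivity
  · have hB : 0 < ξ ^ 2 + m := by positivity
    rw [norm_div, norm_pow, Real.norm_eq_abs, Real.norm_eq_abs, abs_of_pos hB]
    calc |Real.cos (x * ξ)| / (ξ ^ 2 + m) ^ (n + 1) ≤ 1 / (ξ ^ 2 + m) ^ (n + 1) := by
          gcongr; exact Real.abs_cos_le_one _
      _ = ((ξ ^ 2 + m)⁻¹) ^ n * (ξ ^ 2 + m)⁻¹ := by rw [one_div, ← inv_pow, pow_succ]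
      _ ≤ _ := by
          gcongr
          nlinarith [sq_nonneg ξ]

/-- Positivity of the cosine transform of a power of the resolvent symbol, which is a mixture of
Gaussians. -/
lemma integral_cos_div_pow_nonneg {m : ℝ} (hm : 0 < m) (n : ℕ) (x : ℝ) :
    0 ≤ ∫ ξ in Ioi (0:ℝ), Real.cos (x * ξ) / (ξ ^ 2 + m) ^ (n + 1) := by
  set f : ℝ → ℝ → ℝ := fun ξ t =>
    Real.cos (x * ξ) * (t ^ n * Real.exp (-(ξ ^ 2 + m) * t)) with hf
  have hB : ∀ ξ : ℝ, 0 < ξ ^ 2 + m := fun ξ => by positivity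
  have inner : ∀ ξ : ℝ, ∫ t in Ioi (0:ℝ), f ξ t =
      n.factorial * (Real.cos (x * ξ) / (ξ ^ 2 + m) ^ (n + 1)) := by
    intro ξ
    rw [hf, integral_const_mul, (integral_pow_mul_exp_neg_mul n (hB ξ)).2]
    ring
  have hint : Integrable (Function.uncurry f)
      ((volume.restrict (Ioi (0:ℝ))).prod (volume.restrict (Ioi (0:ℝ)))) := by
    rw [integrable_prod_iff]
    · refine ⟨Eventually.of_forall fun ξ =>
        ((integral_pow_mul_exp_neg_mul n (hB ξ)).1).const_mul (Real.cos (x * ξ)), ?_⟩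
      refine (((integrable_cos_div_pow hm n x).norm.const_mul
        (n.factorial : ℝ)).integrableOn).congr (Eventually.of_forall fun ξ => ?_)
      have : ∫ t in Ioi (0:ℝ), ‖f ξ t‖ =
          ∫ t in Ioi (0:ℝ), |Real.cos (x * ξ)| * (t ^ n * Real.exp (-(ξ ^ 2 + m) * t)) := by
        refine setIntegral_congr_fun measurableSet_Ioi fun t ht => ?_
        have ht' : 0 < t := ht
        simp only [hf]
        rw [norm_mul, Real.norm_eq_abs, Real.norm_of_nonneg (by positivity)]
      change _ = ∫ t in Ioi (0:ℝ), ‖f ξ t‖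
      beta_reduce
      rw [this, integral_const_mul, (integral_pow_mul_exp_neg_mul n (hB ξ)).2, norm_div,
        norm_pow, Real.norm_eq_abs, Real.norm_of_nonneg (hB ξ).le]
      ring
    · exact Continuous.aestronglyMeasurable (by unfold Function.uncurry; fun_prop)
  have swap := integral_integral_swap hint
  simp_rw [inner] at swap
  rw [integral_const_mul] at swap
  have hn : (0:ℝ) < n.factorial := by positivity
  refine nonneg_of_mul_nonneg_right (a := (n.factorial : ℝ)) ?_ hn
  rw [swap]
  refine setIntegral_nonneg measurableSet_Ioi fun t ht => ?_
  have ht' : 0 < t := ht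
  have e : ∀ ξ : ℝ, f ξ t = (t ^ n * Real.exp (-m * t)) *
      (Real.cos (x * ξ) * Real.exp (-t * ξ ^ 2)) := by
    intro ξ
    simp only [hf]
    rw [show -(ξ ^ 2 + m) * t = -m * t + -t * ξ ^ 2 by ring, Real.exp_add]
    ring
  simp_rw [e]
  rw [integral_const_mul]
  exact mul_nonneg (by positivity) (integral_cos_mul_gaussian_nonneg ht' x)

lemma integral_cos_div_pos {m : ℝ} (hm : 0 < m) (x : ℝ) :
    0 < ∫ ξ in Ioi (0:ℝ), Real.cos (x * ξ) / (ξ ^ 2 + m) := by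
  have h := integral_cos_div_sq_add_sq (Real.sqrt_pos.2 hm) x
  rw [Real.sq_sqrt hm.le] at h
  rw [h]
  have := Real.sqrt_pos.2 hm
  have := Real.pi_pos
  positivity

/-- The denominator is `(ξ² + c)(η² + a) - δ` with `δ = a c - d ≥ 0`, and its geometric series in `δ`
has terms with nonnegative cosine transforms, the first being positive. -/
lemma kernel_pos {a c d : ℝ} (ha : 0 < a) (hc : 0 < c) (hd : 0 < d) (h : d ≤ a * c)
    (p : ℝ × ℝ) : 0 < kernel a c d p := by
  have hpi := Real.pi_pos
  set δ := a * c - d with hδ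
  have hδ0 : 0 ≤ δ := by linarith
  have hac : 0 < a * c := by positivity
  set F : ℕ → ℝ × ℝ → ℝ := fun n q => δ ^ n * ((Real.cos (p.1 * q.1) / (q.1 ^ 2 + c) ^ (n + 1)) *
    (Real.cos (p.2 * q.2) / (q.2 ^ 2 + a) ^ (n + 1))) with hF
  have hFint : ∀ n, IntegrableOn (F n) openQuadrant := by
    intro n
    rw [IntegrableOn, restrict_openQuadrant]
    exact ((integrable_cos_div_pow hc n p.1).integrableOn.mul_prod
      (integrable_cos_div_pow ha n p.2).integrableOn).const_mul _
  have hFval : ∀ n, ∫ q in openQuadrant, F n q = δ ^ n *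
      ((∫ ξ in Ioi (0:ℝ), Real.cos (p.1 * ξ) / (ξ ^ 2 + c) ^ (n + 1)) *
      ∫ η in Ioi (0:ℝ), Real.cos (p.2 * η) / (η ^ 2 + a) ^ (n + 1)) := by
    intro n
    rw [hF, integral_const_mul, restrict_openQuadrant]
    congr 1
    exact integral_prod_mul (μ := volume.restrict (Ioi (0:ℝ))) (ν := volume.restrict (Ioi (0:ℝ)))
      (fun ξ => Real.cos (p.1 * ξ) / (ξ ^ 2 + c) ^ (n + 1))
      (fun η => Real.cos (p.2 * η) / (η ^ 2 + a) ^ (n + 1))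
  set W : ℝ × ℝ → ℝ := fun q => (q.1 ^ 2 + c)⁻¹ * (q.2 ^ 2 + a)⁻¹ with hW
  have hWint : IntegrableOn W openQuadrant := by
    rw [IntegrableOn, restrict_openQuadrant]
    exact (integrable_inv_sq_add hc).integrableOn.mul_prod (integrable_inv_sq_add ha).integrableOn
  have hratio : δ / (a * c) < 1 := by rw [div_lt_one hac]; linarith
  have hFb : ∀ n q, ‖F n q‖ ≤ (δ / (a * c)) ^ n * W q := by
    intro n q
    have hA : 0 < q.1 ^ 2 + c := by positivity
    have hB : 0 < q.2 ^ 2 + a := by positivity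
    simp only [hF, hW]
    rw [norm_mul, norm_mul, norm_div, norm_div, norm_pow, norm_pow, norm_pow, Real.norm_eq_abs,
      Real.norm_eq_abs, Real.norm_eq_abs, Real.norm_eq_abs, Real.norm_eq_abs, abs_of_nonneg hδ0,
      abs_of_pos hA, abs_of_pos hB]
    calc δ ^ n * (|Real.cos (p.1 * q.1)| / (q.1 ^ 2 + c) ^ (n + 1) *
          (|Real.cos (p.2 * q.2)| / (q.2 ^ 2 + a) ^ (n + 1)))
        ≤ δ ^ n * (1 / (c ^ n * (q.1 ^ 2 + c)) * (1 / (a ^ n * (q.2 ^ 2 + a)))) := by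
          rw [pow_succ (q.1 ^ 2 + c), pow_succ (q.2 ^ 2 + a)]
          gcongr
          · exact Real.abs_cos_le_one _
          · nlinarith [sq_nonneg q.1]
          · exact Real.abs_cos_le_one _
          · nlinarith [sq_nonneg q.2]
      _ = _ := by rw [div_pow, mul_pow]; field_simp
  have hsum := hasSum_integral_of_summable_integral_norm (μ := volume.restrict openQuadrant)
    (F := F) hFint ?_
  · have htsum : ∀ q, ∑' n, F n q = kernelIntegrand a c d p q := by
      intro q
      have hA : 0 < q.1 ^ 2 + c := by positivity
      have hB : 0 < q.2 ^ 2 + a := by positivity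
      have hAB : δ < (q.1 ^ 2 + c) * (q.2 ^ 2 + a) := by
        nlinarith [sq_nonneg q.1, sq_nonneg q.2, mul_nonneg (sq_nonneg q.1) (sq_nonneg q.2)]
      have e : ∀ n, F n q = (Real.cos (p.1 * q.1) * Real.cos (p.2 * q.2) /
          ((q.1 ^ 2 + c) * (q.2 ^ 2 + a))) * (δ / ((q.1 ^ 2 + c) * (q.2 ^ 2 + a))) ^ n := by
        intro n
        simp only [hF]
        rw [div_pow, mul_pow]
        field_simp
        ring
      simp_rw [e]
      rw [tsum_mul_left, tsum_geometric_of_lt_one (by positivity)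
        (by rw [div_lt_one (by positivity)]; exact hAB), kernelIntegrand]
      have hne : (q.1 ^ 2 + c) * (q.2 ^ 2 + a) - δ ≠ 0 := by linarith
      have hD : q.1 ^ 2 * q.2 ^ 2 + a * q.1 ^ 2 + c * q.2 ^ 2 + d =
          (q.1 ^ 2 + c) * (q.2 ^ 2 + a) - δ := by rw [hδ]; ring
      rw [hD, one_sub_div (by positivity), inv_div]
      field_simp
    simp_rw [htsum] at hsum
    have hnn : ∀ n, 0 ≤ ∫ q in openQuadrant, F n q := fun n => by
      rw [hFval]
      exact mul_nonneg (pow_nonneg hδ0 n) (mul_nonneg (integral_cos_div_pow_nonneg hc n p.1)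
        (integral_cos_div_pow_nonneg ha n p.2))
    have h0 : 0 < ∫ q in openQuadrant, F 0 q := by
      rw [hFval]
      simp only [pow_zero, zero_add, pow_one, one_mul]
      exact mul_pos (integral_cos_div_pos hc p.1) (integral_cos_div_pos ha p.2)
    have hle := le_hasSum hsum 0 (fun n _ => hnn n)
    rw [kernel]
    exact mul_pos (by positivity) (h0.trans_le hle)
  · refine Summable.of_nonneg_of_le (fun n => integral_nonneg fun q => norm_nonneg _)
      (fun n => ?_) ((summable_geometric_of_lt_one (by positivity) hratio).mul_right
        (∫ q in openQuadrant, W q))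
    rw [← integral_const_mul]
    exact integral_mono (hFint n).norm (hWint.const_mul _) (hFb n)

/-! ### The minimizer -/

section Minimizer

variable {a c d : ℝ} {u v g₁ g₂ g₁₂ h₁ h₂ h₁₂ : ℝ × ℝ → ℝ}

lemma IsWeakRep.memE2 (hw : IsWeakRep v g₁ g₂ g₁₂) : MemE2 v :=
  ⟨hw.memL2, ⟨g₁, hw.weak_x, hw.memL2_x⟩, ⟨g₂, hw.weak_y, hw.memL2_y⟩,
    ⟨g₁₂, hw.weak_xy, hw.memL2_xy⟩⟩

lemma MemE2.exists_isWeakRep (h : MemE2 v) : ∃ g₁ g₂ g₁₂, IsWeakRep v g₁ g₂ g₁₂ := by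
  obtain ⟨h0, ⟨g₁, w1, l1⟩, ⟨g₂, w2, l2⟩, ⟨g₁₂, w12, l12⟩⟩ := h
  exact ⟨g₁, g₂, g₁₂, h0, l1, l2, l12, w1, w2, w12⟩

/-- Uniqueness of weak derivatives: a locally integrable function is determined almost everywhere
by its integrals against test functions. -/
lemma ae_eq_of_integral_test_eq {f g : ℝ × ℝ → ℝ} (hf : LocallyIntegrableOn f openQuadrant)
    (hg : LocallyIntegrableOn g openQuadrant)
    (h : ∀ φ, IsTestFunction φ →
      ∫ p in openQuadrant, f p * φ p = ∫ p in openQuadrant, g p * φ p) :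
    ∀ᵐ p ∂(volume : Measure (ℝ × ℝ)).restrict openQuadrant, f p = g p := by
  have hint : ∀ {f : ℝ × ℝ → ℝ} {φ}, LocallyIntegrableOn f openQuadrant → IsTestFunction φ →
      IntegrableOn (fun p => f p * φ p) openQuadrant := by
    intro f φ hf hφ
    have h1 : IntegrableOn f (tsupport φ) := hf.integrableOn_compact_subset hφ.2.2 hφ.2.1.isCompact
    have h2 : IntegrableOn (fun p => f p * φ p) (tsupport φ) :=
      h1.mul_continuousOn hφ.1.continuous.continuousOn hφ.2.1.isCompact
    refine Integrable.integrableOn ?_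
    refine (integrableOn_iff_integrable_of_support_subset fun p hp => ?_).1 h2
    exact subset_tsupport _ (right_ne_zero_of_mul hp)
  have key := isOpen_openQuadrant.ae_eq_zero_of_integral_contDiff_smul_eq_zero (μ := volume)
    (f := fun p => f p - g p) (hf.sub hg) ?_
  · rw [ae_restrict_iff' measurableSet_openQuadrant]
    filter_upwards [key] with p hp hpq using sub_eq_zero.1 (hp hpq)
  · intro φ h1 h2 h3
    have hφ : IsTestFunction φ := ⟨h1, h2, h3⟩
    have e : ∫ p in openQuadrant, (f p * φ p - g p * φ p) = 0 := by
      rw [integral_sub (hint hf hφ) (hint hg hφ), h φ hφ, sub_self]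
    rw [← setIntegral_eq_integral_of_forall_compl_eq_zero (s := openQuadrant)]
    · rw [← e]
      congr 1; ext p; rw [smul_eq_mul]; ring
    · intro p hp
      rw [image_eq_zero_of_notMem_tsupport fun hps => hp (h3 hps), zero_smul]

lemma IsWeakRep.energy_eq (hw : IsWeakRep v g₁ g₂ g₁₂) (a c d : ℝ) :
    energy a c d v = ∫ p in openQuadrant,
      (g₁₂ p ^ 2 + a * g₁ p ^ 2 + c * g₂ p ^ 2 + d * v p ^ 2) := by
  have ex : ∃ g, IsWeakX v g := ⟨g₁, hw.weak_x⟩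
  have ey : ∃ g, IsWeakY v g := ⟨g₂, hw.weak_y⟩
  have exy : ∃ g, IsWeakXY v g := ⟨g₁₂, hw.weak_xy⟩
  have hx : IsWeakX v (weakX v) := by rw [weakX, dif_pos ex]; exact ex.choose_spec
  have hy : IsWeakY v (weakY v) := by rw [weakY, dif_pos ey]; exact ey.choose_spec
  have hxy : IsWeakXY v (weakXY v) := by rw [weakXY, dif_pos exy]; exact exy.choose_spec
  have e1 := ae_eq_of_integral_test_eq hx.1 hw.weak_x.1 fun φ hφ =>
    neg_injective ((hx.2 φ hφ).symm.trans (hw.weak_x.2 φ hφ))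
  have e2 := ae_eq_of_integral_test_eq hy.1 hw.weak_y.1 fun φ hφ =>
    neg_injective ((hy.2 φ hφ).symm.trans (hw.weak_y.2 φ hφ))
  have e3 := ae_eq_of_integral_test_eq hxy.1 hw.weak_xy.1 fun φ hφ =>
    (hxy.2 φ hφ).symm.trans (hw.weak_xy.2 φ hφ)
  rw [energy]
  refine integral_congr_ae ?_
  filter_upwards [e1, e2, e3] with p h1 h2 h3
  rw [h1, h2, h3]

lemma IsWeakRep.const_mul (hw : IsWeakRep v g₁ g₂ g₁₂) (s : ℝ) :
    IsWeakRep (fun p => s * v p) (fun p => s * g₁ p) (fun p => s * g₂ p)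
      (fun p => s * g₁₂ p) where
  memL2 := hw.memL2.const_mul s
  memL2_x := hw.memL2_x.const_mul s
  memL2_y := hw.memL2_y.const_mul s
  memL2_xy := hw.memL2_xy.const_mul s
  weak_x := ⟨InL2.locallyIntegrableOn (hw.memL2_x.const_mul s), fun φ hφ => by
    simp_rw [mul_assoc, integral_const_mul, hw.weak_x.2 φ hφ, mul_neg]⟩
  weak_y := ⟨InL2.locallyIntegrableOn (hw.memL2_y.const_mul s), fun φ hφ => by
    simp_rw [mul_assoc, integral_const_mul, hw.weak_y.2 φ hφ, mul_neg]⟩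
  weak_xy := ⟨InL2.locallyIntegrableOn (hw.memL2_xy.const_mul s), fun φ hφ => by
    simp_rw [mul_assoc, integral_const_mul, hw.weak_xy.2 φ hφ]⟩

/-- The energy inner product of two elements, in terms of chosen weak derivatives. -/
noncomputable def form (a c d : ℝ) (g₁₂ g₁ g₂ v h₁₂ h₁ h₂ u : ℝ × ℝ → ℝ) : ℝ :=
  (∫ z in openQuadrant, g₁₂ z * h₁₂ z) + a * (∫ z in openQuadrant, g₁ z * h₁ z) +
    c * (∫ z in openQuadrant, g₂ z * h₂ z) + d * ∫ z in openQuadrant, v z * u z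

lemma IsWeakRep.energy_eq_form (hw : IsWeakRep v g₁ g₂ g₁₂) (a c d : ℝ) :
    energy a c d v = form a c d g₁₂ g₁ g₂ v g₁₂ g₁ g₂ v := by
  rw [hw.energy_eq, form, ← integral_lincomb_four (hw.memL2_xy.integrableOn_mul hw.memL2_xy)
    (hw.memL2_x.integrableOn_mul hw.memL2_x) (hw.memL2_y.integrableOn_mul hw.memL2_y)
    (hw.memL2.integrableOn_mul hw.memL2)]
  simp only [sq]

lemma form_smul (a c d s : ℝ) (g₁₂ g₁ g₂ v h₁₂ h₁ h₂ u : ℝ × ℝ → ℝ) :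
    form a c d g₁₂ g₁ g₂ v (fun z => s * h₁₂ z) (fun z => s * h₁ z) (fun z => s * h₂ z)
      (fun z => s * u z) = s * form a c d g₁₂ g₁ g₂ v h₁₂ h₁ h₂ u := by
  simp only [form, mul_left_comm _ s, integral_const_mul]
  ring

/-- Completing the square: `J(v - u) = J(v) - 2 B(v, u) + J(u)` dominates `d ‖v - u‖²`, where `B` is
the energy inner product. -/
lemma le_energy_sub (ha : 0 ≤ a) (hc : 0 ≤ c) (hv : IsWeakRep v g₁ g₂ g₁₂)
    (hu : IsWeakRep u h₁ h₂ h₁₂) :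
    d * ∫ z in openQuadrant, (v z - u z) ^ 2 ≤
      energy a c d v - 2 * form a c d g₁₂ g₁ g₂ v h₁₂ h₁ h₂ u + energy a c d u := by
  have sq_expand : ∀ {f g : ℝ × ℝ → ℝ}, InL2 f → InL2 g →
      ∫ z in openQuadrant, (f z - g z) ^ 2 = (∫ z in openQuadrant, f z * f z) -
        2 * (∫ z in openQuadrant, f z * g z) + ∫ z in openQuadrant, g z * g z := by
    intro f g hf hg
    have i1 := hf.integrableOn_mul hf
    have i2 := (hf.integrableOn_mul hg).const_mul 2
    have i3 := hg.integrableOn_mul hg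
    have i4 : IntegrableOn (fun z => f z * f z - 2 * (f z * g z)) openQuadrant := i1.sub i2
    rw [← integral_const_mul, ← integral_sub i1 i2, ← integral_add i4 i3]
    congr 1; ext z; ring
  have nn : ∀ f g : ℝ × ℝ → ℝ, 0 ≤ ∫ z in openQuadrant, (f z - g z) ^ 2 :=
    fun f g => integral_nonneg fun z => sq_nonneg _
  have n12 := nn g₁₂ h₁₂
  have n1 := mul_nonneg ha (nn g₁ h₁)
  have n2 := mul_nonneg hc (nn g₂ h₂)
  rw [hv.energy_eq_form, hu.energy_eq_form]
  simp only [form]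
  rw [sq_expand hv.memL2 hu.memL2]
  rw [sq_expand hv.memL2_xy hu.memL2_xy] at n12
  rw [sq_expand hv.memL2_x hu.memL2_x] at n1
  rw [sq_expand hv.memL2_y hu.memL2_y] at n2
  linarith

lemma closedQuadrant_subset_closure : closedQuadrant ⊆ closure openQuadrant := by
  rw [openQuadrant, closure_prod_eq, closure_Ioi, closedQuadrant]

lemma eqOn_closedQuadrant_of_ae (hv : ContinuousOn v closedQuadrant)
    (hu : ContinuousOn u closedQuadrant)
    (h : ∀ᵐ p ∂(volume : Measure (ℝ × ℝ)).restrict openQuadrant, v p = u p) :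
    EqOn v u closedQuadrant := by
  have h1 : EqOn v u openQuadrant :=
    Measure.eqOn_open_of_ae_eq h isOpen_openQuadrant
      (hv.mono openQuadrant_subset_closedQuadrant) (hu.mono openQuadrant_subset_closedQuadrant)
  exact h1.of_subset_closure hv hu openQuadrant_subset_closedQuadrant
    closedQuadrant_subset_closure

lemma kernel_eq_ker (ha : 0 < a) (hc : 0 < c) (hd : 0 < d) :
    EqOn (kernel a c d) (ker a c d) closedQuadrant :=
  fun _ hp => kernel_eq_lead_add_corr ha hc hd hp

lemma zero_mem_closedQuadrant : ((0 : ℝ), (0 : ℝ)) ∈ closedQuadrant :=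
  mem_prod.2 ⟨mem_Ici.2 le_rfl, mem_Ici.2 le_rfl⟩

lemma kernel_zero_pos (ha : 0 < a) (hc : 0 < c) (hd : 0 < d) : 0 < kernel a c d (0, 0) := by
  have hpi := Real.pi_pos
  rw [kernel]
  refine mul_pos (by positivity) ?_
  have hpos : ∀ q, 0 < kernelIntegrand a c d (0, 0) q := by
    intro q
    simp only [kernelIntegrand, zero_mul, Real.cos_zero, mul_one]
    positivity
  refine (setIntegral_pos_iff_support_of_nonneg_ae
    (Eventually.of_forall fun q => (hpos q).le)
    (integrableOn_kernelIntegrand ha hc hd (0, 0))).2 ?_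
  have : Function.support (kernelIntegrand a c d (0, 0)) = univ :=
    eq_univ_of_forall fun q => (hpos q).ne'
  rw [this, univ_inter]
  exact isOpen_openQuadrant.measure_pos volume ⟨(1, 1), by
    exact mem_prod.2 ⟨mem_Ioi.2 one_pos, mem_Ioi.2 one_pos⟩⟩

/-- The normalized kernel minimizes the energy, and it is the only minimizer on the quadrant. -/
lemma isMinimizer_kernel (ha : 0 < a) (hc : 0 < c) (hd : 0 < d) :
    IsMinimizer a c d (fun p => (kernel a c d (0, 0))⁻¹ * kernel a c d p) ∧
    ∀ v, IsMinimizer a c d v →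
      EqOn v (fun p => (kernel a c d (0, 0))⁻¹ * kernel a c d p) closedQuadrant := by
  set s := (kernel a c d (0, 0))⁻¹ with hs
  set u : ℝ × ℝ → ℝ := fun p => s * kernel a c d p with hu
  have hk0 := kernel_zero_pos ha hc hd
  have hker := kernel_eq_ker ha hc hd
  have hEq : EqOn (fun p => s * ker a c d p) u closedQuadrant := fun p hp => by
    simp only [hu, hker hp]
  have hcont : ContinuousOn u closedQuadrant :=
    ((continuousOn_ker ha hc hd).const_mul s).congr fun p hp => (hEq hp).symm
  have hrep : IsWeakRep u (fun p => s * kerX a c d p) (fun p => s * kerY a c d p)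
      (fun p => s * kerXY a c d p) :=
    ((isWeakRep_ker ha hc hd).const_mul s).congr (hEq.mono openQuadrant_subset_closedQuadrant)
  have hu0 : u (0, 0) = 1 := inv_mul_cancel₀ hk0.ne'
  have hform : ∀ {v g₁ g₂ g₁₂}, IsWeakRep v g₁ g₂ g₁₂ → ContinuousOn v closedQuadrant →
      v (0, 0) = 1 → form a c d g₁₂ g₁ g₂ v (fun p => s * kerXY a c d p)
        (fun p => s * kerX a c d p) (fun p => s * kerY a c d p) u = s := by
    intro v g₁ g₂ g₁₂ hw hv hv0
    have h1 := form_smul a c d s g₁₂ g₁ g₂ v (kerXY a c d) (kerX a c d) (kerY a c d) (ker a c d)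
    rw [show form a c d g₁₂ g₁ g₂ v (kerXY a c d) (kerX a c d) (kerY a c d) (ker a c d) = 1 from
      (reproducing ha hc hd hw hv).trans hv0, mul_one] at h1
    have e : ∫ z in openQuadrant, v z * u z = ∫ z in openQuadrant, v z * (s * ker a c d z) :=
      setIntegral_congr_fun measurableSet_openQuadrant fun p hp => by
        simp only [← hEq (openQuadrant_subset_closedQuadrant hp)]
    simp only [form] at h1 ⊢
    rw [e]
    exact h1
  have hEu : energy a c d u = s := by rw [hrep.energy_eq_form]; exact hform hrep hcont hu0
  have hgap : ∀ v, Admissible v →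
      d * ∫ z in openQuadrant, (v z - u z) ^ 2 ≤ energy a c d v - energy a c d u := by
    intro v hv
    obtain ⟨g₁, g₂, g₁₂, hw⟩ := hv.1.exists_isWeakRep
    have h1 := le_energy_sub (d := d) ha.le hc.le hw hrep
    rw [hform hw hv.2.1 hv.2.2, hEu] at h1
    rw [hEu]
    linarith
  have hnn : ∀ v : ℝ × ℝ → ℝ, 0 ≤ ∫ z in openQuadrant, (v z - u z) ^ 2 :=
    fun v => integral_nonneg fun z => sq_nonneg _
  have hadm : Admissible u := ⟨hrep.memE2, hcont, hu0⟩
  refine ⟨⟨hadm, fun v hv => ?_⟩, fun v hv => ?_⟩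
  · linarith [hgap v hv, mul_nonneg hd.le (hnn v)]
  · have h1 := hgap v hv.1
    have h2 := hv.2 u hadm
    have h3 : ∫ z in openQuadrant, (v z - u z) ^ 2 = 0 := by
      refine le_antisymm ?_ (hnn v)
      by_contra! hlt
      linarith [mul_pos hd hlt]
    have hL : InL2 (fun z => v z - u z) := hv.1.1.1.sub hrep.memL2
    rw [integral_eq_zero_iff_of_nonneg (fun z => sq_nonneg _) hL.integrable_sq] at h3
    refine eqOn_closedQuadrant_of_ae hv.1.2.1 hcont ?_
    filter_upwards [h3] with z hz
    exact sub_eq_zero.1 (pow_eq_zero_iff (two_ne_zero)|>.1 hz)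

end Minimizer

end EkelandNirenberg

theorem mainTheorem1 (a c d : ℝ) (ha : 0 < a) (hc : 0 < c) (hd : 0 < d) :
    (∀ p ∈ EkelandNirenberg.closedQuadrant,
      MeasureTheory.IntegrableOn (EkelandNirenberg.kernelIntegrand a c d p)
        EkelandNirenberg.openQuadrant) ∧
    ∃ u : ℝ × ℝ → ℝ,
      EkelandNirenberg.IsMinimizer a c d u ∧
      (∀ v : ℝ × ℝ → ℝ, EkelandNirenberg.IsMinimizer a c d v →
        Set.EqOn v u EkelandNirenberg.closedQuadrant) ∧
      List.TFAE [
        ∀ p ∈ EkelandNirenberg.closedQuadrant, 0 < u p,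
        ∀ p ∈ EkelandNirenberg.closedQuadrant, 0 < EkelandNirenberg.kernel a c d p,
        d ≤ a * c] ∧
      (a * c < d →
        EkelandNirenberg.ChangesSign u ∧
          EkelandNirenberg.ChangesSign (EkelandNirenberg.kernel a c d)) := by
  have hk0 := EkelandNirenberg.kernel_zero_pos ha hc hd
  have hz := EkelandNirenberg.zero_mem_closedQuadrant
  obtain ⟨hmin, huniq⟩ := EkelandNirenberg.isMinimizer_kernel ha hc hd
  refine ⟨fun p _ => EkelandNirenberg.integrableOn_kernelIntegrand ha hc hd p,
    fun p => (EkelandNirenberg.kernel a c d (0, 0))⁻¹ * EkelandNirenberg.kernel a c d p,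
    hmin, huniq, ?_, fun h => ?_⟩
  · tfae_have 1 ↔ 2 := by simp only [mul_pos_iff_of_pos_left (inv_pos.2 hk0)]
    tfae_have 3 → 2 := fun h p _ => EkelandNirenberg.kernel_pos ha hc hd h p
    tfae_have 2 → 3 := by
      intro h
      by_contra! hlt
      obtain ⟨p, hp, hneg⟩ := EkelandNirenberg.exists_kernel_neg ha hc hd hlt
      exact lt_asymm (h p hp) hneg
    tfae_finish
  · obtain ⟨p, hp, hneg⟩ := EkelandNirenberg.exists_kernel_neg ha hc hd h
    exact ⟨⟨⟨_, hz, mul_pos (inv_pos.2 hk0) hk0⟩,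
      ⟨p, hp, mul_neg_of_pos_of_neg (inv_pos.2 hk0) hneg⟩⟩, ⟨_, hz, hk0⟩, ⟨p, hp, hneg⟩⟩
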